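/- There is a deterministic whitebox identity test for sums of read-once oblivious arithmetic branching programs (ROABPs), in the following sense. An ROABP of width $w$ in $n$ variables over a field $\mathbb F$ is a layered directed graph with vertex layers $V_0,\dots,V_n$, $|V_0|=|V_n|=1$ and $|V_t|\le w$ for $0<t<n$, together with a permutation $\pi$ of the variables, in which every edge from $V_{t-1}$ to $V_t$ carries a univariate polynomial in $x_{\pi(t)}$; it computes the sum, over all paths from $V_0$ to $V_n$, of the product of the edge weights along the path. There are a single deterministic random-access program $P$ and a constant $K$ such that for every field $\mathbb F$, all $n,d,w,c\ge 1$ and all ROABPs $A_1,\dots,A_c$ over $\mathbb F$ of width $w$ in the variables $x_1,\dots,x_n$ for which $A=A_1+\dots+A_c$ has individual degree at most $d$ (the degree of $A$ in each variable is at most $d$), the program $P$, given $n,d,w,c$ and random access to the description of the $c$ ROABPs (variable orders, layer sizes, and coefficients of the edge weights), halts after time at most $$\max(w,2)^{K\cdot 2^c}\,(nd)^{K c},$$ that is, $w^{O(2^c)}(nd)^{O(c)}$, and decides correctly whether $A=0$. Here time counts field operations and zero tests in $\mathbb F$, additions, truncated subtractions and comparisons of natural numbers, and accesses to variables and to cells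 of arrays of natural numbers or field elements indexed by tuples of natural numbers, each at unit cost. -/

import Mathlib

/-! ### Arithmetic branching programs -/

namespace PIT

/-- A read-once oblivious arithmetic branching program of width at most `w` in `n` variables over
the field `F`: a layered graph with layers `0, …, n`, where layer `t` has the vertices
`0, …, size t - 1`, the first and the last layer consist of one vertex (the start and the end
node), and the other layers have at most `w` vertices. The edge from vertex `u` of layer `t` to
vertex `v` of layer `t + 1` carries the univariate polynomial `weight t u v` in the variable
`x_{order t}` (the weight is `0` if there is no edge). Only the values of `weight t u v` with
`t < n`, `u < size t`, `v < size (t + 1)` and of `size t` with `t ≤ n` belong to the program. -/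
structure ROABP (F : Type*) [Field F] (n w : ℕ) where
  /-- the variable order -/
  order : Equiv.Perm (Fin n)
  /-- the number of vertices of each layer -/
  size : ℕ → ℕ
  size_start : size 0 = 1
  size_end : size n = 1
  size_le : ∀ t, 0 < t → t < n → size t ≤ w
  /-- the edge weights -/
  weight : ℕ → ℕ → ℕ → Polynomial F

/-- A path from the start node to the end node: one vertex in each layer. -/
abbrev ROABP.Path {F : Type*} [Field F] {n w : ℕ} (R : ROABP F n w) : Type :=
  (t : Fin (n + 1)) → Fin (R.size t)

/-- The polynomial computed by an ROABP: the sum over all paths from the start node to the end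
node of the product of the edge weights along the path. -/
noncomputable def ROABP.poly {F : Type*} [Field F] {n w : ℕ} (R : ROABP F n w) :
    MvPolynomial (Fin n) F :=
  ∑ p : R.Path, ∏ t : Fin n,
    Polynomial.aeval (MvPolynomial.X (R.order t) : MvPolynomial (Fin n) F)
      (R.weight t (p t.castSucc) (p t.succ))

/-! ### Deterministic programs over a field, with their running time

A program works on natural number variables, on arrays of natural numbers and on arrays of field
elements. The arrays are indexed by finite tuples of natural numbers, and every array cell can be
accessed directly. On natural numbers there are addition, truncated subtraction and comparison
(multiplication is left out on purpose: at unit cost it would produce numbers of exponential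
bit length); on field elements there are the four field operations and the test for zero.
Every operation, every access to a variable or an array cell and every evaluation of a condition is
charged. A program is a finite text that refers neither to the field nor to the input sizes. -/

/-- Expressions with values in the natural numbers. -/
inductive NExpr : Type
  | const (k : ℕ)
  | var (x : ℕ)
  | add (e f : NExpr)
  | sub (e f : NExpr)

/-- Expressions with values in the field. `load a is` is the cell with index tuple `is` of the
field array number `a`. -/
inductive FExpr : Type
  | zero
  | one
  | load (a : ℕ) (is : List NExpr)
  | add (e f : FExpr)
  | sub (e f : FExpr)
  | mul (e f : FExpr)
  | div (e f : FExpr)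

/-- Conditions. -/
inductive BExpr : Type
  | le (e f : NExpr)
  | isZero (e : FExpr)
  | not (b : BExpr)
  | and (b b' : BExpr)

/-- Programs. -/
inductive Program : Type
  /-- do nothing -/
  | skip
  /-- the variable `x` gets the value of `e` -/
  | setVar (x : ℕ) (e : NExpr)
  /-- the variable `x` gets the content of cell `is` of the natural number array `a` -/
  | loadNat (x : ℕ) (a : ℕ) (is : List NExpr)
  /-- cell `is` of the natural number array `a` gets the value of `e` -/
  | storeNat (a : ℕ) (is : List NExpr) (e : NExpr)
  /-- cell `is` of the field array `a` gets the value of `e` -/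
  | storeField (a : ℕ) (is : List NExpr) (e : FExpr)
  /-- first `P`, then `Q` -/
  | seq (P Q : Program)
  /-- if `b` then `P` else `Q` -/
  | branch (b : BExpr) (P Q : Program)
  /-- while `b` do `P` -/
  | loop (b : BExpr) (P : Program)

/-- The memory: variables, arrays of natural numbers, arrays of field elements. -/
@[ext]
structure State (F : Type*) where
  var : ℕ → ℕ
  narr : ℕ → List ℕ → ℕ
  farr : ℕ → List ℕ → F

/-- Value of a natural number expression. -/
def NExpr.eval {F : Type*} (s : State F) : NExpr → ℕ
  | const k => k
  | var x => s.var x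
  | add e f => e.eval s + f.eval s
  | sub e f => e.eval s - f.eval s

/-- Cost of evaluating a natural number expression. -/
def NExpr.cost : NExpr → ℕ
  | const _ => 1
  | var _ => 1
  | add e f => e.cost + f.cost + 1
  | sub e f => e.cost + f.cost + 1

/-- The index tuple that a list of expressions denotes. -/
def evalIndex {F : Type*} (s : State F) (is : List NExpr) : List ℕ :=
  is.map (NExpr.eval s)

/-- Cost of accessing an array cell. -/
def indexCost (is : List NExpr) : ℕ :=
  (is.map NExpr.cost).sum + 1

/-- Value of a field expression (as everywhere in Mathlib, division by zero gives zero). -/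
def FExpr.eval {F : Type*} [Field F] (s : State F) : FExpr → F
  | zero => 0
  | one => 1
  | load a is => s.farr a (evalIndex s is)
  | add e f => e.eval s + f.eval s
  | sub e f => e.eval s - f.eval s
  | mul e f => e.eval s * f.eval s
  | div e f => e.eval s / f.eval s

/-- Cost of evaluating a field expression. -/
def FExpr.cost : FExpr → ℕ
  | zero => 1
  | one => 1
  | load _ is => indexCost is
  | add e f => e.cost + f.cost + 1
  | sub e f => e.cost + f.cost + 1
  | mul e f => e.cost + f.cost + 1
  | div e f => e.cost + f.cost + 1

/-- Truth of a condition. -/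
def BExpr.Holds {F : Type*} [Field F] (s : State F) : BExpr → Prop
  | le e f => e.eval s ≤ f.eval s
  | isZero e => e.eval s = 0
  | not b => ¬ b.Holds s
  | and b b' => b.Holds s ∧ b'.Holds s

/-- Cost of evaluating a condition. -/
def BExpr.cost : BExpr → ℕ
  | le e f => e.cost + f.cost + 1
  | isZero e => e.cost + 1
  | not b => b.cost + 1
  | and b b' => b.cost + b'.cost + 1

/-- The state after assigning to a variable. -/
def State.setVar {F : Type*} (s : State F) (x v : ℕ) : State F :=
  { s with var := Function.update s.var x v }

/-- The state after writing a natural number to an array cell. -/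
def State.setNat {F : Type*} (s : State F) (a : ℕ) (is : List ℕ) (v : ℕ) : State F :=
  { s with narr := Function.update s.narr a (Function.update (s.narr a) is v) }

/-- The state after writing a field element to an array cell. -/
def State.setField {F : Type*} (s : State F) (a : ℕ) (is : List ℕ) (v : F) : State F :=
  { s with farr := Function.update s.farr a (Function.update (s.farr a) is v) }

/-- `Exec P s T s'`: started in the state `s`, the program `P` halts in the state `s'`, after
running for time exactly `T`. -/
inductive Exec {F : Type*} [Field F] : Program → State F → ℕ → State F → Prop
  | skip (s : State F) : Exec .skip s 1 s
  | setVar (s : State F) (x : ℕ) (e : NExpr) :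
      Exec (.setVar x e) s (e.cost + 1) (s.setVar x (e.eval s))
  | loadNat (s : State F) (x a : ℕ) (is : List NExpr) :
      Exec (.loadNat x a is) s (indexCost is + 1) (s.setVar x (s.narr a (evalIndex s is)))
  | storeNat (s : State F) (a : ℕ) (is : List NExpr) (e : NExpr) :
      Exec (.storeNat a is e) s (indexCost is + e.cost + 1)
        (s.setNat a (evalIndex s is) (e.eval s))
  | storeField (s : State F) (a : ℕ) (is : List NExpr) (e : FExpr) :
      Exec (.storeField a is e) s (indexCost is + e.cost + 1)
        (s.setField a (evalIndex s is) (e.eval s))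
  | seq {P Q : Program} {s s' s'' : State F} {T T' : ℕ} :
      Exec P s T s' → Exec Q s' T' s'' → Exec (.seq P Q) s (T + T') s''
  | branchTrue {b : BExpr} {P Q : Program} {s s' : State F} {T : ℕ} :
      b.Holds s → Exec P s T s' → Exec (.branch b P Q) s (b.cost + T) s'
  | branchFalse {b : BExpr} {P Q : Program} {s s' : State F} {T : ℕ} :
      ¬ b.Holds s → Exec Q s T s' → Exec (.branch b P Q) s (b.cost + T) s'
  | loopFalse {b : BExpr} {P : Program} {s : State F} :
      ¬ b.Holds s → Exec (.loop b P) s b.cost s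
  | loopTrue {b : BExpr} {P : Program} {s s' s'' : State F} {T T' : ℕ} :
      b.Holds s → Exec P s T s' → Exec (.loop b P) s' T' s'' →
      Exec (.loop b P) s (b.cost + T + T') s''

/-- Programs are deterministic: running time and final state are determined by the program and
the initial state. -/
theorem Exec.deterministic {F : Type*} [Field F] {P : Program} {s s₁ s₂ : State F} {T₁ T₂ : ℕ}
    (h₁ : Exec P s T₁ s₁) (h₂ : Exec P s T₂ s₂) : T₁ = T₂ ∧ s₁ = s₂ := by
  induction h₁ generalizing T₂ s₂ with
  | skip | setVar | loadNat | storeNat | storeField => cases h₂; exact ⟨rfl, rfl⟩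
  | seq _ _ ih ih' =>
    cases h₂ with
    | seq g g' =>
      obtain ⟨rfl, rfl⟩ := ih g
      obtain ⟨rfl, rfl⟩ := ih' g'
      exact ⟨rfl, rfl⟩
  | branchTrue hb _ ih =>
    cases h₂ with
    | branchTrue _ g => obtain ⟨rfl, rfl⟩ := ih g; exact ⟨rfl, rfl⟩
    | branchFalse hb' _ => exact absurd hb hb'
  | branchFalse hb _ ih =>
    cases h₂ with
    | branchFalse _ g => obtain ⟨rfl, rfl⟩ := ih g; exact ⟨rfl, rfl⟩
    | branchTrue hb' _ => exact absurd hb' hb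
  | loopFalse hb =>
    cases h₂ with
    | loopFalse _ => exact ⟨rfl, rfl⟩
    | loopTrue hb' _ _ => exact absurd hb' hb
  | loopTrue hb _ _ ih ih' =>
    cases h₂ with
    | loopFalse hb' => exact absurd hb hb'
    | loopTrue _ g g' =>
      obtain ⟨rfl, rfl⟩ := ih g
      obtain ⟨rfl, rfl⟩ := ih' g'
      exact ⟨rfl, rfl⟩

/-! ### The input of the identity test -/

/-- The whitebox input: the numbers `n`, `d`, `w`, `c` in the variables `0, 1, 2, 3`, and the
ROABPs `R 0, …, R (c - 1)`, where
* cell `(i, t)` of the natural number array `0` is the index of the variable read in layer `t` of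
  `R i`, for `i < c` and `t < n`;
* cell `(i, t)` of the natural number array `1` is the number of vertices of layer `t` of `R i`,
  for `i < c` and `t ≤ n`;
* cell `(i, t, u, v, k)` of the field array `0` is the coefficient of the `k`-th power of the
  variable in the weight of the edge from vertex `u` of layer `t` to vertex `v` of layer `t + 1` of
  `R i`, if there are such vertices.
All other variables and cells contain `0`. -/
noncomputable def input {F : Type*} [Field F] (n d w c : ℕ) (R : Fin c → ROABP F n w) :
    State F where
  var
    | 0 => n
    | 1 => d
    | 2 => w
    | 3 => c
    | _ => 0
  narr
    | 0, [i, t] => if h : i < c ∧ t < n then ((R ⟨i, h.1⟩).order ⟨t, h.2⟩ : ℕ) else 0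
    | 1, [i, t] => if h : i < c ∧ t ≤ n then (R ⟨i, h.1⟩).size t else 0
    | _, _ => 0
  farr
    | 0, [i, t, u, v, k] =>
      if h : i < c then
        if t < n ∧ u < (R ⟨i, h⟩).size t ∧ v < (R ⟨i, h⟩).size (t + 1) then
          ((R ⟨i, h⟩).weight t u v).coeff k
        else 0
      else 0
    | _, _ => 0

end PIT

/-! The coefficient of a monomial in an ROABP is an entry of a product of transition matrices taken
in the reading order (`prefixVec_input`). Once the first `t` variables of that order have received
exponents, the rest of the computation sees them only through a state vector of length `w`. Hence a
linear dependency between the state vectors of several partial assignments survives every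
continuation.

A node of level `j` is a linear combination of `N` coefficient extractions, applied to each of the
ROABPs `j, …, c - 1`. Along the variable order of ROABP `j`, a set of partial assignments with
linearly independent states (now `N × w` matrices) is grown layer by layer. An extension of an
assignment by one more exponent either joins the set of the next layer or yields a dependency. In
the second case the corresponding combination of extractions kills ROABP `j`
(`sum_mul_extract_eq_zero`), and what remains is a node of level `j + 1` (`sum_mul_extract`). The
extension has coefficient `1` in the dependency, so if the new node vanishes, its extraction is a
combination of those of the set. Consequently, for exponents up to `d`, the node vanishes if all its
children vanish and its coefficients at the complete assignments left in layer `n` are zero.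
Conversely, children are combinations of extractions from their parent, and every test evaluates a
coefficient of it, so a zero node never raises an alarm.

There are at most `N * w` independent states (`Echelon.le`), so a child has at most `(N * w + 1) *
N` terms, and the quantity `N * w + 1` is at most squared from level to level. It stays below `(w +
1) ^ 2 ^ j` at level `j`. A node has at most `n * (N * w + 1) * (d + 1)` children, and multiplying
over the levels bounds the number of nodes by `nodeBound`.

The recursion is run as a queue. `candidateProg_spec`, `layersProg_spec` and `nodeProg_spec` carry
the correctness. The inner loops all obey one bound `loopBound`, so a node costs a fixed power of it
(`Program.timeBound_le`), while the potential `pending` limits the main loop (`exec_loop`). -/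

namespace PIT

variable {F : Type*} [Field F]

/-! ### Memory updates -/

section State

variable {F : Type*}

@[simp] theorem State.setVar_var (s : State F) (x v y : ℕ) :
    (s.setVar x v).var y = if y = x then v else s.var y := by
  simp [State.setVar, Function.update_apply]

@[simp] theorem State.setVar_narr (s : State F) (x v : ℕ) : (s.setVar x v).narr = s.narr := rfl

@[simp] theorem State.setVar_farr (s : State F) (x v : ℕ) : (s.setVar x v).farr = s.farr := rfl

@[simp] theorem State.setNat_var (s : State F) (a : ℕ) (is : List ℕ) (v : ℕ) :
    (s.setNat a is v).var = s.var := rfl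

@[simp] theorem State.setNat_narr (s : State F) (a : ℕ) (is : List ℕ) (v b : ℕ) (js : List ℕ) :
    (s.setNat a is v).narr b js = if b = a ∧ js = is then v else s.narr b js := by
  by_cases h : b = a
  · subst h; simp [State.setNat, Function.update_apply]
  · simp [State.setNat, h]

@[simp] theorem State.setNat_farr (s : State F) (a : ℕ) (is : List ℕ) (v : ℕ) :
    (s.setNat a is v).farr = s.farr := rfl

@[simp] theorem State.setField_var (s : State F) (a : ℕ) (is : List ℕ) (v : F) :
    (s.setField a is v).var = s.var := rfl

@[simp] theorem State.setField_narr (s : State F) (a : ℕ) (is : List ℕ) (v : F) :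
    (s.setField a is v).narr = s.narr := rfl

@[simp] theorem State.setField_farr (s : State F) (a : ℕ) (is : List ℕ) (v : F) (b : ℕ)
    (js : List ℕ) :
    (s.setField a is v).farr b js = if b = a ∧ js = is then v else s.farr b js := by
  by_cases h : b = a
  · subst h; simp [State.setField, Function.update_apply]
  · simp [State.setField, h]

end State

/-! ### Locations written by a program -/

/-- Does the program write to the variable `y`? -/
def Program.writesVar : Program → ℕ → Bool
  | .skip, _ => false
  | .setVar x _, y => x == y
  | .loadNat x _ _, y => x == y
  | .storeNat _ _ _, _ => false
  | .storeField _ _ _, _ => false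
  | .seq P Q, y => P.writesVar y || Q.writesVar y
  | .branch _ P Q, y => P.writesVar y || Q.writesVar y
  | .loop _ P, y => P.writesVar y

/-- Does the program write to the natural number array `b`? -/
def Program.writesNat : Program → ℕ → Bool
  | .skip, _ => false
  | .setVar _ _, _ => false
  | .loadNat _ _ _, _ => false
  | .storeNat a _ _, b => a == b
  | .storeField _ _ _, _ => false
  | .seq P Q, b => P.writesNat b || Q.writesNat b
  | .branch _ P Q, b => P.writesNat b || Q.writesNat b
  | .loop _ P, b => P.writesNat b

/-- Does the program write to the field array `b`? -/
def Program.writesField : Program → ℕ → Bool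
  | .skip, _ => false
  | .setVar _ _, _ => false
  | .loadNat _ _ _, _ => false
  | .storeNat _ _ _, _ => false
  | .storeField a _ _, b => a == b
  | .seq P Q, b => P.writesField b || Q.writesField b
  | .branch _ P Q, b => P.writesField b || Q.writesField b
  | .loop _ P, b => P.writesField b

/-- The states `s` and `s'` agree at all locations that `P` does not write to. -/
structure Agree (P : Program) (s s' : State F) : Prop where
  var : ∀ y, P.writesVar y = false → s'.var y = s.var y
  narr : ∀ b, P.writesNat b = false → s'.narr b = s.narr b
  farr : ∀ b, P.writesField b = false → s'.farr b = s.farr b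

/-- The frame property behind all specifications: that a subprogram leaves a location alone becomes
a Boolean computation, closed by `rfl` or `decide`. -/
theorem Exec.agree {P : Program} {s s' : State F} {T : ℕ} (h : Exec P s T s') : Agree P s s' := by
  induction h with
  | skip s => exact ⟨fun _ _ => rfl, fun _ _ => rfl, fun _ _ => rfl⟩
  | setVar s x e =>
    refine ⟨fun y hy => ?_, fun _ _ => rfl, fun _ _ => rfl⟩
    have : x ≠ y := by simpa [Program.writesVar] using hy
    simp [this.symm]
  | loadNat s x a is =>
    refine ⟨fun y hy => ?_, fun _ _ => rfl, fun _ _ => rfl⟩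
    have : x ≠ y := by simpa [Program.writesVar] using hy
    simp [this.symm]
  | storeNat s a is e =>
    refine ⟨fun _ _ => rfl, fun b hb => ?_, fun _ _ => rfl⟩
    have : a ≠ b := by simpa [Program.writesNat] using hb
    funext js
    simp [this.symm]
  | storeField s a is e =>
    refine ⟨fun _ _ => rfl, fun _ _ => rfl, fun b hb => ?_⟩
    have : a ≠ b := by simpa [Program.writesField] using hb
    funext js
    simp [this.symm]
  | seq _ _ ih ih' =>
    refine ⟨fun y hy => ?_, fun y hy => ?_, fun y hy => ?_⟩
    · simp only [Program.writesVar, Bool.or_eq_false_iff] at hy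
      rw [ih'.var y hy.2, ih.var y hy.1]
    · simp only [Program.writesNat, Bool.or_eq_false_iff] at hy
      rw [ih'.narr y hy.2, ih.narr y hy.1]
    · simp only [Program.writesField, Bool.or_eq_false_iff] at hy
      rw [ih'.farr y hy.2, ih.farr y hy.1]
  | branchTrue _ _ ih =>
    refine ⟨fun y hy => ?_, fun y hy => ?_, fun y hy => ?_⟩
    · simp only [Program.writesVar, Bool.or_eq_false_iff] at hy
      exact ih.var y hy.1
    · simp only [Program.writesNat, Bool.or_eq_false_iff] at hy
      exact ih.narr y hy.1
    · simp only [Program.writesField, Bool.or_eq_false_iff] at hy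
      exact ih.farr y hy.1
  | branchFalse _ _ ih =>
    refine ⟨fun y hy => ?_, fun y hy => ?_, fun y hy => ?_⟩
    · simp only [Program.writesVar, Bool.or_eq_false_iff] at hy
      exact ih.var y hy.2
    · simp only [Program.writesNat, Bool.or_eq_false_iff] at hy
      exact ih.narr y hy.2
    · simp only [Program.writesField, Bool.or_eq_false_iff] at hy
      exact ih.farr y hy.2
  | loopFalse _ => exact ⟨fun _ _ => rfl, fun _ _ => rfl, fun _ _ => rfl⟩
  | loopTrue _ _ _ ih ih' =>
    refine ⟨fun y hy => ?_, fun y hy => ?_, fun y hy => ?_⟩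
    · rw [ih'.var y hy, ih.var y hy]
    · rw [ih'.narr y hy, ih.narr y hy]
    · rw [ih'.farr y hy, ih.farr y hy]

/-! ### Running time when every loop makes at most `B` iterations -/

/-- An upper bound for the running time of a program if every execution of a loop in it makes at
most `B` iterations. -/
def Program.timeBound (B : ℕ) : Program → ℕ
  | .skip => 1
  | .setVar _ e => e.cost + 1
  | .loadNat _ _ is => indexCost is + 1
  | .storeNat _ is e => indexCost is + e.cost + 1
  | .storeField _ is e => indexCost is + e.cost + 1
  | .seq P Q => P.timeBound B + Q.timeBound B
  | .branch b P Q => b.cost + (P.timeBound B + Q.timeBound B)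
  | .loop b P => B * (b.cost + P.timeBound B) + b.cost

/-- The number of loops in a program, a bound for their nesting depth. -/
def Program.depth : Program → ℕ
  | .seq P Q => P.depth + Q.depth
  | .branch _ P Q => P.depth + Q.depth
  | .loop _ P => P.depth + 1
  | _ => 0

/-- Each loop contributes at most one factor `B`. Counting all loops instead of the nesting depth is
wasteful, but for a fixed program the exponent is a constant either way. -/
theorem Program.timeBound_le {B : ℕ} (hB : 1 ≤ B) (P : Program) :
    P.timeBound B ≤ P.timeBound 1 * B ^ P.depth := by
  induction P with
  | skip | setVar | loadNat | storeNat | storeField => simp [timeBound, depth]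
  | seq P Q ihP ihQ =>
    simp only [timeBound, depth]
    calc P.timeBound B + Q.timeBound B
        ≤ P.timeBound 1 * B ^ P.depth + Q.timeBound 1 * B ^ Q.depth := Nat.add_le_add ihP ihQ
      _ ≤ P.timeBound 1 * B ^ (P.depth + Q.depth) + Q.timeBound 1 * B ^ (P.depth + Q.depth) := by
        gcongr <;> omega
      _ = _ := by ring
  | branch b P Q ihP ihQ =>
    simp only [timeBound, depth]
    have h1 : 1 ≤ B ^ (P.depth + Q.depth) := Nat.one_le_pow _ _ hB
    calc b.cost + (P.timeBound B + Q.timeBound B)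
        ≤ b.cost * B ^ (P.depth + Q.depth) +
          (P.timeBound 1 * B ^ P.depth + Q.timeBound 1 * B ^ Q.depth) :=
          Nat.add_le_add (Nat.le_mul_of_pos_right _ h1) (Nat.add_le_add ihP ihQ)
      _ ≤ b.cost * B ^ (P.depth + Q.depth) + (P.timeBound 1 * B ^ (P.depth + Q.depth) +
          Q.timeBound 1 * B ^ (P.depth + Q.depth)) := by
        gcongr <;> omega
      _ = _ := by ring
  | loop b P ih =>
    simp only [timeBound, depth]
    have h1 : 1 ≤ B ^ P.depth := Nat.one_le_pow _ _ hB
    have h2 : 1 ≤ B ^ (P.depth + 1) := Nat.one_le_pow _ _ hB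
    calc B * (b.cost + P.timeBound B) + b.cost
        ≤ B * (b.cost * B ^ P.depth + P.timeBound 1 * B ^ P.depth) +
          b.cost * B ^ (P.depth + 1) := by
          gcongr
          · exact Nat.le_mul_of_pos_right _ h1
          · exact Nat.le_mul_of_pos_right _ h2
      _ = _ := by ring

/-! ### Total correctness with running time -/

/-- Started in the state `s`, the program `P` halts in a state with the property `Q`, within the
time that it needs if every loop makes at most `B` iterations. -/
def Triple (B : ℕ) (P : Program) (s : State F) (Q : State F → Prop) : Prop :=
  ∃ T s', Exec P s T s' ∧ T ≤ P.timeBound B ∧ Q s'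

namespace Triple

variable {B : ℕ} {P P' : Program} {s : State F} {Q R : State F → Prop}

theorem mono (h : Triple B P s Q) (hQ : ∀ s', Agree P s s' → Q s' → R s') : Triple B P s R := by
  obtain ⟨T, s', he, hT, hs⟩ := h
  exact ⟨T, s', he, hT, hQ s' he.agree hs⟩

theorem skip (h : Q s) : Triple B .skip s Q := ⟨_, _, .skip s, le_rfl, h⟩

theorem setVar {x : ℕ} {e : NExpr} (h : Q (s.setVar x (e.eval s))) :
    Triple B (.setVar x e) s Q := ⟨_, _, .setVar s x e, le_rfl, h⟩

theorem loadNat {x a : ℕ} {is : List NExpr}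
    (h : Q (s.setVar x (s.narr a (evalIndex s is)))) :
    Triple B (.loadNat x a is) s Q := ⟨_, _, .loadNat s x a is, le_rfl, h⟩

theorem storeNat {a : ℕ} {is : List NExpr} {e : NExpr}
    (h : Q (s.setNat a (evalIndex s is) (e.eval s))) :
    Triple B (.storeNat a is e) s Q := ⟨_, _, .storeNat s a is e, le_rfl, h⟩

theorem storeField {a : ℕ} {is : List NExpr} {e : FExpr}
    (h : Q (s.setField a (evalIndex s is) (e.eval s))) :
    Triple B (.storeField a is e) s Q := ⟨_, _, .storeField s a is e, le_rfl, h⟩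

theorem seq (h : Triple B P s R) (h' : ∀ s', Agree P s s' → R s' → Triple B P' s' Q) :
    Triple B (.seq P P') s Q := by
  obtain ⟨T, s', he, hT, hs⟩ := h
  obtain ⟨T', s'', he', hT', hs'⟩ := h' s' he.agree hs
  exact ⟨T + T', s'', .seq he he', Nat.add_le_add hT hT', hs'⟩

theorem seq' (h : Triple B P s (fun s' => Triple B P' s' Q)) :
    Triple B (.seq P P') s Q := h.seq fun _ _ h => h

theorem branch {b : BExpr} (h : b.Holds s → Triple B P s Q) (h' : ¬ b.Holds s → Triple B P' s Q) :
    Triple B (.branch b P P') s Q := by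
  by_cases hb : b.Holds s
  · obtain ⟨T, s', he, hT, hs⟩ := h hb
    exact ⟨_, s', .branchTrue hb he, by simp only [Program.timeBound]; omega, hs⟩
  · obtain ⟨T, s', he, hT, hs⟩ := h' hb
    exact ⟨_, s', .branchFalse hb he, by simp only [Program.timeBound]; omega, hs⟩

end Triple

/-- The part of a counting loop after the initialization. -/
def countLoop (x : ℕ) (hi : NExpr) (P : Program) : Program :=
  .loop (.le (.add (.var x) (.const 1)) hi) (.seq P (.setVar x (.add (.var x) (.const 1))))

/-- The counting loop `for x = lo, …, hi - 1 do P`. -/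
def forLoop (x : ℕ) (lo hi : NExpr) (P : Program) : Program :=
  .seq (.setVar x lo) (countLoop x hi P)

theorem Agree.refl {F : Type*} (P : Program) (s : State F) : Agree P s s :=
  ⟨fun _ _ => rfl, fun _ _ => rfl, fun _ _ => rfl⟩

theorem Agree.trans {F : Type*} {P : Program} {s s' s'' : State F} (h : Agree P s s')
    (h' : Agree P s' s'') :
    Agree P s s'' :=
  ⟨fun y hy => (h'.var y hy).trans (h.var y hy), fun y hy => (h'.narr y hy).trans (h.narr y hy),
    fun y hy => (h'.farr y hy).trans (h.farr y hy)⟩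

/-- Induction on the number `j` of remaining iterations. The lower bound `.const 0` in the frame
conditions is a placeholder: the locations written by a loop do not depend on it. -/
theorem exec_countLoop {B x h : ℕ} {hi : NExpr} {P : Program} {s₀ : State F}
    (I : ℕ → State F → Prop) (hx : P.writesVar x = false)
    (hhi : ∀ s, Agree (forLoop x (.const 0) hi P) s₀ s → hi.eval s = h) {l : ℕ}
    (step : ∀ k s, l ≤ k → k < h → Agree (forLoop x (.const 0) hi P) s₀ s → s.var x = k → I k s →
      Triple B P s (fun s' => I (k + 1) (s'.setVar x (k + 1)))) :
    ∀ (j k : ℕ) (s : State F), l ≤ k → k + j = h →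
      Agree (forLoop x (.const 0) hi P) s₀ s → s.var x = k → I k s →
      ∃ T s', Exec (countLoop x hi P) s T s' ∧
        T ≤ j * ((BExpr.le (.add (.var x) (.const 1)) hi).cost +
          (Program.seq P (.setVar x (.add (.var x) (.const 1)))).timeBound B) +
          (BExpr.le (.add (.var x) (.const 1)) hi).cost ∧ I h s' := by
  intro j
  induction j with
  | zero =>
    intro k s _ hk hA hv hI
    refine ⟨_, s, .loopFalse ?_, by simp, by simpa [← hk] using hI⟩
    simp only [BExpr.Holds, NExpr.eval, hhi s hA, hv]
    omega
  | succ j ih =>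
    intro k s hl hk hA hv hI
    obtain ⟨T, s', he, hT, hI'⟩ := step k s hl (by omega) hA hv hI
    have hv' : s'.var x = k := by rw [he.agree.var x hx, hv]
    have he2 : Exec (.setVar x (.add (.var x) (.const 1))) s'
        ((NExpr.add (.var x) (.const 1)).cost + 1) (s'.setVar x (k + 1)) := by
      have := Exec.setVar s' x (.add (.var x) (.const 1))
      simpa only [NExpr.eval, hv'] using this
    have he3 := Exec.seq he he2
    have hA' : Agree (forLoop x (.const 0) hi P) s₀ (s'.setVar x (k + 1)) := by
      refine hA.trans ?_
      have := he3.agree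
      refine ⟨fun y hy => this.var y ?_, fun y hy => this.narr y ?_, fun y hy => this.farr y ?_⟩
      · simp only [forLoop, countLoop, Program.writesVar, Bool.or_eq_false_iff] at hy ⊢
        exact hy.2
      · simpa [forLoop, countLoop, Program.writesNat] using hy
      · simpa [forLoop, countLoop, Program.writesField] using hy
    obtain ⟨T', s'', he4, hT', hI''⟩ := ih (k + 1) (s'.setVar x (k + 1)) (by omega) (by omega) hA'
      (by simp) hI'
    refine ⟨_, s'', .loopTrue ?_ he3 he4, ?_, hI''⟩
    · simp only [BExpr.Holds, NExpr.eval, hhi s hA, hv]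
      omega
    · simp only [Program.timeBound] at hT' ⊢
      rw [Nat.succ_mul]
      omega

/-- The invariant rule. The condition `hhi` keeps the upper limit constant although it is evaluated
anew in each round, and `I` is always read with the counter already set. -/
theorem Triple.forLoop {B x : ℕ} {lo hi : NExpr} {P : Program} {s : State F}
    {Q : State F → Prop} (I : ℕ → State F → Prop) (l h : ℕ) (hl : lo.eval s = l) (hlh : l ≤ h)
    (hB : h - l ≤ B) (hx : P.writesVar x = false)
    (hhi : ∀ s', Agree (forLoop x (.const 0) hi P) s s' → hi.eval s' = h)
    (init : I l (s.setVar x l))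
    (step : ∀ k s', l ≤ k → k < h → Agree (PIT.forLoop x (.const 0) hi P) s s' → s'.var x = k →
      I k s' → Triple B P s' (fun s'' => I (k + 1) (s''.setVar x (k + 1))))
    (post : ∀ s', Agree (PIT.forLoop x (.const 0) hi P) s s' → I h s' → Q s') :
    Triple B (PIT.forLoop x lo hi P) s Q := by
  have hA : Agree (PIT.forLoop x (.const 0) hi P) s (s.setVar x l) := by
    refine ⟨fun y hy => ?_, fun _ _ => rfl, fun _ _ => rfl⟩
    have : x ≠ y := by
      simp only [PIT.forLoop, Program.writesVar, Bool.or_eq_false_iff] at hy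
      simpa using hy.1
    simp [this.symm]
  obtain ⟨T, s', he, hT, hI⟩ := exec_countLoop (B := B) I hx hhi step (h - l) l (s.setVar x l)
    le_rfl (by omega) hA (by simp) init
  have he' : Exec (.setVar x lo) s (lo.cost + 1) (s.setVar x l) := by
    have := Exec.setVar s x lo
    rwa [hl] at this
  have he3 := Exec.seq he' he
  refine ⟨_, s', he3, ?_, post s' ⟨fun y hy => he3.agree.var y ?_, fun y hy => he3.agree.narr y ?_,
    fun y hy => he3.agree.farr y ?_⟩ hI⟩
  · simp only [PIT.forLoop, countLoop, Program.timeBound] at hT ⊢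
    have := Nat.mul_le_mul_right ((BExpr.le (.add (.var x) (.const 1)) hi).cost +
      (P.timeBound B + ((NExpr.add (.var x) (.const 1)).cost + 1))) hB
    omega
  · simpa [PIT.forLoop, Program.writesVar] using hy
  · simpa [PIT.forLoop, Program.writesNat] using hy
  · simpa [PIT.forLoop, Program.writesField] using hy

end PIT

namespace PIT

open Finset

variable {F : Type*} [Field F]

/-! ### Coefficients of an ROABP -/

/-- Every factor has its own variable, so expanding the product yields each monomial exactly once.
-/
theorem coeff_prod_aeval_X {σ : Type*} [Fintype σ] [DecidableEq σ] (q : σ → Polynomial F)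
    (m : σ →₀ ℕ) :
    MvPolynomial.coeff m (∏ x, Polynomial.aeval (MvPolynomial.X x : MvPolynomial σ F) (q x)) =
      ∏ x, (q x).coeff (m x) := by
  have h1 : ∀ x, Polynomial.aeval (MvPolynomial.X x : MvPolynomial σ F) (q x) =
      ∑ k ∈ range ((q x).natDegree + m x + 1),
        MvPolynomial.C ((q x).coeff k) * MvPolynomial.X x ^ k := by
    intro x
    -- The summand `m x` lengthens the range so that the exponent `m x` always occurs in it, even
    -- above the degree.
    conv_lhs => rw [Polynomial.as_sum_range' (q x) ((q x).natDegree + m x + 1) (by omega)]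
    simp [Polynomial.aeval_monomial, MvPolynomial.algebraMap_eq]
  simp_rw [h1]
  rw [prod_univ_sum, MvPolynomial.coeff_sum]
  have h2 : ∀ p : σ → ℕ, ∏ x, (MvPolynomial.C ((q x).coeff (p x)) *
      (MvPolynomial.X x : MvPolynomial σ F) ^ p x) =
      MvPolynomial.monomial (Finsupp.equivFunOnFinite.symm p) (∏ x, (q x).coeff (p x)) := by
    intro p
    rw [prod_mul_distrib, MvPolynomial.monomial_eq, map_prod]
    congr 1
    rw [Finsupp.prod_fintype _ _ (by simp)]
    simp
  simp_rw [h2, MvPolynomial.coeff_monomial]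
  rw [sum_eq_single (m : σ → ℕ)]
  · simp
  · intro p _ hp
    rw [if_neg]
    rintro rfl
    exact hp (by simp)
  · intro hm
    exact absurd (Fintype.mem_piFinset.2 fun x => mem_range.2 (by omega)) hm

/-- The transfer matrix method: the last vertex of the path is split off. The weight `h` of the end
vertex makes the induction work, since it absorbs the last edge. -/
theorem sum_path_prod (size : ℕ → ℕ) (h0 : size 0 = 1) (g : ℕ → ℕ → ℕ → F) (v : ℕ → ℕ → F)
    (hv0 : v 0 0 = 1)
    (hv : ∀ t u, v (t + 1) u = ∑ u' ∈ range (size t), v t u' * g t u' u) :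
    ∀ (n : ℕ) (h : ℕ → F),
      ∑ p : (t : Fin (n + 1)) → Fin (size t),
        (∏ t : Fin n, g t (p t.castSucc) (p t.succ)) * h (p (Fin.last n)) =
      ∑ u ∈ range (size n), v n u * h u := by
  intro n
  induction n with
  | zero =>
    intro h
    rw [← (Fin.snocEquiv (n := 0) (fun t => Fin (size t))).sum_comp]
    simp only [univ_eq_empty, prod_empty, one_mul, Fintype.sum_prod_type]
    rw [Finset.sum_range fun u => v 0 u * h u]
    change ∑ x : Fin (size 0), _ = _
    refine Finset.sum_congr rfl fun u _ => ?_
    have hu : (u : ℕ) = 0 := by have := u.2; omega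
    simp [hu, hv0, Fin.snocEquiv, Fin.snoc]
  | succ n ih =>
    intro h
    rw [← (Fin.snocEquiv (n := n + 1) (fun t => Fin (size t))).sum_comp, Fintype.sum_prod_type,
      Finset.sum_range fun u => v (n + 1) u * h u]
    change ∑ x : Fin (size (n + 1)), _ = _
    refine Finset.sum_congr rfl fun u _ => ?_
    have := ih (fun u' => g n u' u)
    rw [hv, ← this, sum_mul]
    refine Finset.sum_congr rfl fun p _ => ?_
    rw [Fin.prod_univ_castSucc]
    simp [Fin.snocEquiv, ← Fin.castSucc_succ]

/-- The vector that an automaton with the transition coefficients `C [i, t, u, v, k]`, the variable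
order `o [i, ·]` and `w` states per layer reaches in layer `t`, where a positive value `e x` stands
for the exponent `e x - 1` of the variable `x`. -/
def prefixVec (C : List ℕ → F) (o : List ℕ → ℕ) (w i : ℕ) (e : ℕ → ℕ) : ℕ → ℕ → F
  | 0, u => if u = 0 then 1 else 0
  | t + 1, v => ∑ u ∈ range w, prefixVec C o w i e t u * C [i, t, u, v, e (o [i, t]) - 1]

/-- The properties of the input arrays on which the correctness of the identity test rests. -/
structure IsInput (n w c : ℕ) (C : List ℕ → F) (o : List ℕ → ℕ) : Prop where
  n_pos : 1 ≤ n
  w_pos : 1 ≤ w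
  order_lt : ∀ i < c, ∀ t < n, o [i, t] < n
  order_inj : ∀ i < c, ∀ t < n, ∀ t' < n, o [i, t] = o [i, t'] → t = t'
  order_surj : ∀ i < c, ∀ x < n, ∃ t < n, o [i, t] = x
  coeff_zero : ∀ i < c, ∀ t u v k, w ≤ v → C [i, t, u, v, k] = 0

theorem prefixVec_congr {C : List ℕ → F} {o : List ℕ → ℕ} {w i : ℕ} {e e' : ℕ → ℕ} {t : ℕ}
    (h : ∀ s < t, e (o [i, s]) = e' (o [i, s])) (u : ℕ) :
    prefixVec C o w i e t u = prefixVec C o w i e' t u := by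
  induction t generalizing u with
  | zero => rfl
  | succ t ih =>
    simp only [prefixVec]
    refine Finset.sum_congr rfl fun u' _ => ?_
    rw [ih (fun s hs => h s (by omega)), h t (by omega)]

theorem IsInput.prefixVec_eq_zero {n w c : ℕ} {C : List ℕ → F} {o : List ℕ → ℕ}
    (hI : IsInput n w c C o) {i : ℕ} (hi : i < c) (U : ℕ) (e : ℕ → ℕ) (t : ℕ) {u : ℕ} (hu : w ≤ u) :
    prefixVec C o U i e t u = 0 := by
  cases t with
  | zero => have := hI.w_pos; simp [prefixVec]; omega
  | succ t => exact Finset.sum_eq_zero fun v _ => by rw [hI.coeff_zero i hi t v u _ hu, mul_zero]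

/-- States beyond `w` carry the value zero. This permits the program to use the single loop limit
`vU` for states and for coefficient vectors alike. -/
theorem IsInput.prefixVec_width {n w c : ℕ} {C : List ℕ → F} {o : List ℕ → ℕ}
    (hI : IsInput n w c C o) {i : ℕ} (hi : i < c) {U : ℕ} (hU : w ≤ U) (e : ℕ → ℕ) (t u : ℕ) :
    prefixVec C o U i e t u = prefixVec C o w i e t u := by
  induction t generalizing u with
  | zero => rfl
  | succ t ih =>
    simp only [prefixVec, ih]
    symm
    refine Finset.sum_subset (range_subset_range.2 hU) fun v _ hv => ?_
    rw [hI.prefixVec_eq_zero hi _ _ _ (by simpa using hv), zero_mul]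

theorem isInput_input {n d w c : ℕ} (hn : 1 ≤ n) (hw : 1 ≤ w) (R : Fin c → ROABP F n w) :
    IsInput n w c ((input n d w c R).farr 0) ((input n d w c R).narr 0) where
  n_pos := hn
  w_pos := hw
  order_lt i hi t ht := by simp [input, hi, ht]
  order_inj i hi t ht t' ht' h := by
    simp only [input, hi, ht, ht', and_self, dite_true] at h
    have := (R ⟨i, hi⟩).order.injective (Fin.ext h)
    simpa using this
  order_surj i hi x hx := by
    refine ⟨(R ⟨i, hi⟩).order.symm ⟨x, hx⟩, Fin.is_lt _, ?_⟩
    simp [input, hi]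
  coeff_zero i hi t u v k hv := by
    simp only [input, hi, dite_true]
    rw [if_neg]
    rintro ⟨ht, -, h⟩
    rcases Nat.lt_or_ge (t + 1) n with h' | h'
    · have := (R ⟨i, hi⟩).size_le (t + 1) (by omega) h'
      omega
    · have h1 : t + 1 = n := by omega
      have := (R ⟨i, hi⟩).size_end
      rw [h1] at h
      omega

theorem prefixVec_input {n d w c : ℕ} (hw : 1 ≤ w) (R : Fin c → ROABP F n w)
    (i : Fin c) (e : ℕ → ℕ) :
    prefixVec ((input n d w c R).farr 0) ((input n d w c R).narr 0) w i e n 0 =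
      MvPolynomial.coeff (Finsupp.equivFunOnFinite.symm fun x : Fin n => e x - 1) (R i).poly := by
  set C := (input n d w c R).farr 0 with hC
  set o := (input n d w c R).narr 0 with ho
  have hCi : ∀ t u v k, C [i, t, u, v, k] =
      if t < n ∧ u < (R i).size t ∧ v < (R i).size (t + 1) then ((R i).weight t u v).coeff k
      else 0 := by
    intro t u v k
    simp [hC, input]
  have key := sum_path_prod (R i).size (R i).size_start
    (fun t u v => C [i, t, u, v, e (o [i, t]) - 1]) (prefixVec C o w i e) (by simp [prefixVec])
    (by
      intro t u
      simp only [prefixVec]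
      by_cases ht : t < n
      · have hs : (R i).size t ≤ w := by
          rcases Nat.eq_zero_or_pos t with rfl | h0
          · rw [(R i).size_start]; exact hw
          · exact (R i).size_le t h0 ht
        symm
        refine Finset.sum_subset (range_subset_range.2 hs) fun v _ hv => ?_
        rw [hCi, if_neg, mul_zero]
        rintro ⟨-, h, -⟩
        exact hv (mem_range.2 h)
      -- Behind the last layer nothing is known about `size`, but there all stored coefficients are
      -- zero and so are both sums.
      · have : ∀ v k, C [i, t, v, u, k] = 0 := fun v k => by rw [hCi, if_neg (by tauto)]
        simp [this]) n (fun _ => 1)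
  rw [(R i).size_end] at key
  simp only [mul_one, range_one, sum_singleton] at key
  rw [← key, ROABP.poly, MvPolynomial.coeff_sum]
  refine Finset.sum_congr rfl fun p _ => ?_
  set q : Fin n → Polynomial F := fun t => (R i).weight t (p t.castSucc) (p t.succ) with hq
  have h1 := Equiv.prod_comp (R i).order fun x : Fin n =>
    Polynomial.aeval (MvPolynomial.X x : MvPolynomial (Fin n) F) (q ((R i).order.symm x))
  simp only [Equiv.symm_apply_apply] at h1
  rw [h1, coeff_prod_aeval_X, ← Equiv.prod_comp (R i).order fun x : Fin n =>
    (q ((R i).order.symm x)).coeff ((Finsupp.equivFunOnFinite.symm fun x : Fin n => e x - 1) x)]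
  refine Finset.prod_congr rfl fun t _ => ?_
  have h2 : o [i, t] = (R i).order t := by simp [ho, input]
  have h3 := (p t.succ).2
  have h4 := (p t.castSucc).2
  simp only [Fin.val_succ, Fin.val_castSucc] at h3 h4
  rw [hCi, if_pos ⟨t.2, h4, h3⟩]
  simp [h2, hq]

end PIT

/-! ### Vanishing of the sum in terms of coefficients, and elimination of one ROABP -/

namespace PIT

open Finset

variable {F : Type*} [Field F]

theorem sum_prefixVec_eq_zero {n d w c : ℕ} {R : Fin c → ROABP F n w} (hw : 1 ≤ w)
    {A : MvPolynomial (Fin n) F} (hA : A = ∑ i, (R i).poly) (h : A = 0) (e : ℕ → ℕ) :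
    ∑ i ∈ Ico 0 c,
      prefixVec ((input n d w c R).farr 0) ((input n d w c R).narr 0) w i e n 0 = 0 := by
  rw [← range_eq_Ico, Finset.sum_range]
  simp_rw [prefixVec_input hw R]
  rw [← MvPolynomial.coeff_sum, ← hA, h, MvPolynomial.coeff_zero]

theorem eq_zero_of_sum_prefixVec {n d w c : ℕ} {R : Fin c → ROABP F n w} (hw : 1 ≤ w)
    {A : MvPolynomial (Fin n) F} (hA : A = ∑ i, (R i).poly) (hd : ∀ j : Fin n, A.degreeOf j ≤ d)
    (h : ∀ e : ℕ → ℕ, (∀ x < n, 1 ≤ e x ∧ e x ≤ d + 1) → ∑ i ∈ Ico 0 c,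
      prefixVec ((input n d w c R).farr 0) ((input n d w c R).narr 0) w i e n 0 = 0) :
    A = 0 := by
  ext m
  rw [MvPolynomial.coeff_zero]
  by_cases hm : ∀ x, m x ≤ d
  -- Exponents are stored shifted by one, because the value `0` is reserved for a variable that is
  -- still free.
  · have := h (fun x => if hx : x < n then m ⟨x, hx⟩ + 1 else 0)
      (fun x hx => by simp [hx, hm])
    rw [← range_eq_Ico, Finset.sum_range] at this
    simp_rw [prefixVec_input hw R] at this
    rw [← MvPolynomial.coeff_sum, ← hA] at this
    rw [← this]
    congr 1
    ext x
    simp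
  · push Not at hm
    obtain ⟨x, hx⟩ := hm
    by_contra hc
    have := MvPolynomial.monomial_le_degreeOf x (MvPolynomial.mem_support_iff.2 hc)
    have := hd x
    omega

/-! ### Partial assignments of exponents -/

/-- The partial assignment `p`, completed by `e` where it is `0`. -/
def override (p e : ℕ → ℕ) : ℕ → ℕ := fun x => if p x = 0 then e x else p x

theorem override_assoc (p q e : ℕ → ℕ) :
    override (override p q) e = override p (override q e) := by
  funext x
  simp only [override]
  split_ifs <;> simp_all

/-- The value at `e` of the sum of the ROABPs `j, …, c - 1` after the coefficient extractions that
are given by the coefficients `lam` and the partial assignments `p`. -/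
def extract (n w c : ℕ) (C : List ℕ → F) (o : List ℕ → ℕ) (j N : ℕ) (lam : ℕ → F)
    (p : ℕ → ℕ → ℕ) (e : ℕ → ℕ) : F :=
  ∑ i ∈ Ico j c, ∑ m ∈ range N, lam m * prefixVec C o w i (override (p m) e) n 0

/-- The partial assignment `a` fixes exactly the variables read in the layers before `t`. -/
def FixesBefore (n : ℕ) (o : List ℕ → ℕ) (j t : ℕ) (a : ℕ → ℕ) : Prop :=
  ∀ s < n, a (o [j, s]) ≠ 0 ↔ s < t

variable {n w c : ℕ} {C : List ℕ → F} {o : List ℕ → ℕ}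

theorem IsInput.prefixVec_congr (hI : IsInput n w c C o) {i : ℕ} (hi : i < c) {e e' : ℕ → ℕ}
    (h : ∀ x < n, e x = e' x) (u : ℕ) {t : ℕ} (ht : t ≤ n) :
    prefixVec C o w i e t u = prefixVec C o w i e' t u :=
  PIT.prefixVec_congr (fun s hs => h _ (hI.order_lt i hi s (by omega))) u

theorem IsInput.extract_congr (hI : IsInput n w c C o) {j N : ℕ} {lam : ℕ → F} {p : ℕ → ℕ → ℕ}
    {e e' : ℕ → ℕ} (h : ∀ x < n, e x = e' x) :
    extract n w c C o j N lam p e = extract n w c C o j N lam p e' := by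
  refine Finset.sum_congr rfl fun i hi => Finset.sum_congr rfl fun m _ => ?_
  rw [hI.prefixVec_congr (mem_Ico.1 hi).2 (fun x hx => ?_) 0 le_rfl]
  simp only [override, h x hx]

theorem FixesBefore.update {j t k : ℕ} {a : ℕ → ℕ} (hI : IsInput n w c C o) (hj : j < c)
    (ht : t < n) (hk : k ≠ 0) (ha : FixesBefore n o j t a) :
    FixesBefore n o j (t + 1) (Function.update a (o [j, t]) k) := by
  intro s hs
  by_cases h : s = t
  · subst h; simp [hk]
  · rw [Function.update_of_ne fun h' => h (hI.order_inj j hj s hs t ht h'), ha s hs]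
    omega

/-- A linear dependency between the vectors reached in layer `t` is one between the polynomials
that remain after the extraction of coefficients. -/
theorem sum_mul_extract_eq_zero {j t N K : ℕ} {lam : ℕ → F} {p a : ℕ → ℕ → ℕ} {μ : ℕ → F}
    (hw : 1 ≤ w) (ht : t ≤ n) (ha : ∀ b < K, FixesBefore n o j t (a b))
    (h : ∀ m < N, ∀ u < w,
      ∑ b ∈ range K, μ b * prefixVec C o w j (override (p m) (a b)) t u = 0) (e : ℕ → ℕ) :
    ∑ b ∈ range K, μ b * ∑ m ∈ range N,
      lam m * prefixVec C o w j (override (p m) (override (a b) e)) n 0 = 0 := by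
  -- The assignments `a b` fix nothing from layer `t` on, so all of them use the same transition
  -- matrices there, and the dependency is carried along by linearity.
  have key : ∀ m < N, ∀ s, t + s ≤ n → ∀ u < w,
      ∑ b ∈ range K, μ b * prefixVec C o w j (override (p m) (override (a b) e)) (t + s) u = 0 := by
    intro m hm s
    induction s with
    | zero =>
      intro _ u hu
      rw [← h m hm u hu]
      refine Finset.sum_congr rfl fun b hb => ?_
      rw [add_zero, prefixVec_congr]
      intro s hs
      have := (ha b (mem_range.1 hb) s (by omega)).2 hs
      simp [override, this]
    | succ s ih =>
      intro hs u _
      rw [← add_assoc]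
      simp only [prefixVec, mul_sum]
      rw [sum_comm]
      refine Finset.sum_eq_zero fun u' hu' => ?_
      have h1 := ih (by omega) u' (mem_range.1 hu')
      have h2 : ∀ b < K, override (p m) (override (a b) e) (o [j, t + s]) =
          override (p m) e (o [j, t + s]) := by
        intro b hb
        have := (ha b hb (t + s) (by omega)).not.2 (by omega)
        simp only [not_not] at this
        simp [override, this]
      calc _ = ∑ b ∈ range K,
              μ b * prefixVec C o w j (override (p m) (override (a b) e)) (t + s) u' *
                C [j, t + s, u', u, override (p m) e (o [j, t + s]) - 1] := by
              refine Finset.sum_congr rfl fun b hb => ?_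
              rw [h2 b (mem_range.1 hb), mul_assoc]
        _ = 0 := by rw [← sum_mul, h1, zero_mul]
  simp_rw [mul_sum]
  rw [sum_comm]
  refine Finset.sum_eq_zero fun m hm => ?_
  have := key m (mem_range.1 hm) (n - t) (by omega) 0 hw
  rw [Nat.add_sub_cancel' ht] at this
  calc _ = lam m * ∑ b ∈ range K,
        μ b * prefixVec C o w j (override (p m) (override (a b) e)) n 0 := by
        rw [mul_sum]
        exact Finset.sum_congr rfl fun b _ => by ring
    _ = 0 := by rw [this, mul_zero]

/-- Linear combinations of extractions from the ROABPs `j, …, c - 1`, if their part for the `j`-th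
ROABP vanishes. -/
theorem sum_mul_extract {j N K : ℕ} {lam : ℕ → F} {p a : ℕ → ℕ → ℕ} {μ : ℕ → F} (hj : j < c)
    {e : ℕ → ℕ}
    (h : ∑ b ∈ range K, μ b * ∑ m ∈ range N,
      lam m * prefixVec C o w j (override (p m) (override (a b) e)) n 0 = 0) :
    ∑ b ∈ range K, μ b * extract n w c C o j N lam p (override (a b) e) =
      ∑ i ∈ Ico (j + 1) c, ∑ b ∈ range K, ∑ m ∈ range N, lam m * μ b *
        prefixVec C o w i (override (override (p m) (a b)) e) n 0 := by
  simp only [extract]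
  simp_rw [Finset.sum_eq_sum_Ico_succ_bot hj, mul_add, sum_add_distrib, h, zero_add, mul_sum]
  rw [sum_comm]
  refine Finset.sum_congr rfl fun i _ => Finset.sum_congr rfl fun b _ =>
    Finset.sum_congr rfl fun m _ => ?_
  rw [override_assoc]
  ring

/-- Giving a free variable the value that the completion would give it anyway changes nothing. This
leads from the extensions in layer `t + 1` back to the elements of layer `t`. -/
theorem override_update {a e : ℕ → ℕ} {x : ℕ} (ha : a x = 0) :
    override (Function.update a x (e x)) e = override a e := by
  funext y
  by_cases h : y = x
  · subst h; simp [override, ha]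
  · simp [override, h]

/-! ### Gaussian elimination -/

/-- The first `R` rows of the matrix `rho` are in echelon form with the pivots `pm`, `pu`. Row `N`
of `rho r` contains the coefficients that express the other rows by the vectors `v 0, …, v r`. -/
structure Echelon (N U R : ℕ) (rho : ℕ → ℕ → ℕ → F) (pm pu : ℕ → ℕ) (v : ℕ → ℕ → ℕ → F) :
    Prop where
  lin : ∀ r < R, ∀ m < N, ∀ u < U, rho r m u = ∑ b ∈ range (r + 1), rho r N b * v b m u
  tri : ∀ r < R, ∀ b, r < b → b < U → rho r N b = 0
  pm_lt : ∀ r < R, pm r < N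
  pu_lt : ∀ r < R, pu r < U
  pivot_ne : ∀ r < R, rho r (pm r) (pu r) ≠ 0
  pivot_zero : ∀ r < R, ∀ r' < r, rho r (pm r') (pu r') = 0

/-- The state `y` of the reduction of the vector `v R` after the first `k` of the rows `rho`. -/
structure Reduced (N U R k : ℕ) (pm pu : ℕ → ℕ) (v : ℕ → ℕ → ℕ → F) (y : ℕ → ℕ → F) :
    Prop where
  lin : ∀ m < N, ∀ u < U, y m u = ∑ b ∈ range (R + 1), y N b * v b m u
  tri : ∀ b, R < b → b < U → y N b = 0
  one : y N R = 1
  pivot_zero : ∀ r < k, y (pm r) (pu r) = 0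

variable {N U R k : ℕ} {rho : ℕ → ℕ → ℕ → F} {pm pu : ℕ → ℕ} {v : ℕ → ℕ → ℕ → F} {y : ℕ → ℕ → F}

theorem Echelon.zero : Echelon N U 0 rho pm pu v := by
  constructor <;> simp

theorem Echelon.congr {rho' : ℕ → ℕ → ℕ → F} {pm' pu' : ℕ → ℕ} {v' : ℕ → ℕ → ℕ → F}
    (h : Echelon N U R rho pm pu v) (hRU : R ≤ U)
    (hr : ∀ r < R, ∀ m ≤ N, ∀ u < U, rho' r m u = rho r m u)
    (hm : ∀ r < R, pm' r = pm r) (hu : ∀ r < R, pu' r = pu r)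
    (hv : ∀ b < R, ∀ m < N, ∀ u < U, v' b m u = v b m u) : Echelon N U R rho' pm' pu' v' where
  lin r hR m hm' u hu' := by
    rw [hr r hR m hm'.le u hu', h.lin r hR m hm' u hu']
    refine Finset.sum_congr rfl fun b hb => ?_
    have hb := mem_range.1 hb
    rw [hr r hR N le_rfl b (by omega), hv b (by omega) m hm' u hu']
  tri r hR b hb hbU := by rw [hr r hR N le_rfl b hbU, h.tri r hR b hb hbU]
  pm_lt r hR := by rw [hm r hR]; exact h.pm_lt r hR
  pu_lt r hR := by rw [hu r hR]; exact h.pu_lt r hR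
  pivot_ne r hR := by
    rw [hm r hR, hu r hR, hr r hR _ (h.pm_lt r hR).le _ (h.pu_lt r hR)]
    exact h.pivot_ne r hR
  pivot_zero r hR r' hr' := by
    have hR' : r' < R := by omega
    rw [hm r' hR', hu r' hR', hr r hR _ (h.pm_lt r' hR').le _ (h.pu_lt r' hR')]
    exact h.pivot_zero r hR r' hr'

/-- Subtracting a multiple of row `k` clears its pivot position. It does not disturb the earlier
ones, where row `k` is zero, nor the coefficient `1` of `v R`, as row `k` involves only `v 0, …, v
k`. -/
theorem Reduced.step {y' : ℕ → ℕ → F} (hE : Echelon N U R rho pm pu v)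
    (h : Reduced N U R k pm pu v y) (hk : k < R) (hRU : R < U)
    (hy : ∀ m ≤ N, ∀ u < U,
      y' m u = y m u - y (pm k) (pu k) / rho k (pm k) (pu k) * rho k m u) :
    Reduced N U R (k + 1) pm pu v y' where
  lin m hm u hu := by
    rw [hy m hm.le u hu, h.lin m hm u hu, hE.lin k hk m hm u hu]
    -- Row `k` is padded by the zeros of `tri` to the length of the combination for `y`. Those zeros
    -- are known only below `U`, which is where `R < U` enters.
    have h1 : ∑ b ∈ range (k + 1), rho k N b * v b m u =
        ∑ b ∈ range (R + 1), rho k N b * v b m u := by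
      refine Finset.sum_subset (range_subset_range.2 (by omega)) fun b hb hb' => ?_
      simp only [mem_range] at hb hb'
      rw [hE.tri k hk b (by omega) (by omega), zero_mul]
    rw [h1, mul_sum, ← sum_sub_distrib]
    refine Finset.sum_congr rfl fun b hb => ?_
    have := mem_range.1 hb
    rw [hy N le_rfl b (by omega)]
    ring
  tri b hb hbU := by
    rw [hy N le_rfl b hbU, h.tri b hb hbU, hE.tri k hk b (by omega) hbU]
    ring
  one := by
    rw [hy N le_rfl R hRU, h.one, hE.tri k hk R hk hRU]
    ring
  pivot_zero r hr := by
    have hrR : r < R := by omega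
    rw [hy _ (hE.pm_lt r hrR).le _ (hE.pu_lt r hrR)]
    rcases Nat.lt_succ_iff_lt_or_eq.1 hr with h' | rfl
    · rw [h.pivot_zero r h', hE.pivot_zero k hk r h']
      ring
    · rw [div_mul_cancel₀ _ (hE.pivot_ne r hrR), sub_self]

/-- A vector reduced by all rows vanishes at their pivots, so any nonzero entry left in it is a
legitimate new pivot. -/
theorem Echelon.succ (hE : Echelon N U R rho pm pu v) (h : Reduced N U R R pm pu v (rho R))
    (hm : pm R < N) (hu : pu R < U) (hne : rho R (pm R) (pu R) ≠ 0) :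
    Echelon N U (R + 1) rho pm pu v where
  lin r hr := by
    rcases Nat.lt_succ_iff_lt_or_eq.1 hr with h' | rfl
    exacts [hE.lin r h', h.lin]
  tri r hr := by
    rcases Nat.lt_succ_iff_lt_or_eq.1 hr with h' | rfl
    exacts [hE.tri r h', h.tri]
  pm_lt r hr := by
    rcases Nat.lt_succ_iff_lt_or_eq.1 hr with h' | rfl
    exacts [hE.pm_lt r h', hm]
  pu_lt r hr := by
    rcases Nat.lt_succ_iff_lt_or_eq.1 hr with h' | rfl
    exacts [hE.pu_lt r h', hu]
  pivot_ne r hr := by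
    rcases Nat.lt_succ_iff_lt_or_eq.1 hr with h' | rfl
    exacts [hE.pivot_ne r h', hne]
  pivot_zero r hr := by
    rcases Nat.lt_succ_iff_lt_or_eq.1 hr with h' | rfl
    exacts [hE.pivot_zero r h', h.pivot_zero]

/-- The pivot positions are pairwise distinct, and they lie in the first `w` columns because all
rows are combinations of vectors that vanish elsewhere. With `U = N * w + 1` there is thus always
room for one more coefficient. -/
theorem Echelon.le (hE : Echelon N U R rho pm pu v)
    (hv : ∀ b < R, ∀ m < N, ∀ u, w ≤ u → v b m u = 0) : R ≤ N * w := by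
  have hw : ∀ r < R, pu r < w := by
    intro r hr
    by_contra hc
    apply hE.pivot_ne r hr
    rw [hE.lin r hr _ (hE.pm_lt r hr) _ (hE.pu_lt r hr)]
    refine Finset.sum_eq_zero fun b hb => ?_
    have := mem_range.1 hb
    rw [hv b (by omega) _ (hE.pm_lt r hr) _ (by omega), mul_zero]
  have hlt : ∀ r < R, ∀ r' < r, ¬ (pm r = pm r' ∧ pu r = pu r') := by
    rintro r hr r' hr' ⟨h1, h2⟩
    apply hE.pivot_ne r hr
    rw [h1, h2]
    exact hE.pivot_zero r hr r' hr'
  have := Finset.card_le_card_of_injOn (s := range R) (t := range N ×ˢ range w)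
    (fun r => (pm r, pu r))
    (fun r hr => by
      have := mem_range.1 hr
      simp [hE.pm_lt r this, hw r this])
    (fun r hr r' hr' heq => by
      simp only [coe_range, Set.mem_Iio, Prod.mk.injEq] at hr hr' heq
      rcases Nat.lt_trichotomy r r' with h | h | h
      · exact absurd ⟨heq.1.symm, heq.2.symm⟩ (hlt r' hr' r h)
      · exact h
      · exact absurd heq (hlt r hr r' h))
  simpa using this

end PIT

namespace PIT

open Finset

/-! ### The program -/

-- The nodes awaiting treatment are those from `vHead` to `vTail - 1`. A node is stored in `aLevel`,
-- `aTerms`, `fLam` and `aPart`; `aSpan`, `aPivot`, `fRho` and `fY` serve the current node only. The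
-- input array `1` of layer sizes is never read, since the coefficients at absent vertices are zero.
notation "vN" => 0
notation "vD" => 1
notation "vW" => 2
notation "vC" => 3
notation "vHead" => 4
notation "vTail" => 5
notation "vOk" => 6
notation "vLevel" => 7
notation "vTerms" => 8
notation "vT" => 9
notation "vR" => 10
notation "vr" => 11
notation "vK" => 12
notation "vNew" => 13
notation "vm" => 14
notation "vu" => 15
notation "vv" => 16
notation "vs" => 17
notation "vE" => 18
notation "vFound" => 19
notation "vx" => 20
notation "vi" => 21
notation "vb" => 22
notation "vCount" => 23
notation "vq" => 24
notation "vU" => 25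
notation "vPm" => 26
notation "vPu" => 27
notation "vL" => 28

notation "aOrder" => 0
notation "aLevel" => 2
notation "aTerms" => 3
notation "aPart" => 4
notation "aSpan" => 5
notation "aPivot" => 6

notation "fCoeff" => 0
notation "fLam" => 1
notation "fY" => 2
notation "fRho" => 3
notation "fVec" => 4
notation "fScalar" => 5

attribute [simp] NExpr.eval FExpr.eval BExpr.Holds evalIndex

/-- The expression `x + 1`. -/
abbrev NExpr.succ (e : NExpr) : NExpr := .add e (.const 1)

/-- The vectors in the layers `0, …, L` of the `i`-th ROABP, for the `m`-th partial assignment of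
the current node, completed by the new partial assignment. -/
def prefixProg : Program :=
  .seq (forLoop vu (.const 0) (.var vU) (.storeField fVec [.const 0, .var vu] .zero)) <|
  .seq (.storeField fVec [.const 0, .const 0] .one) <|
  forLoop vs (.const 0) (.var vL) <|
    .seq (.loadNat vx aOrder [.var vi, .var vs]) <|
    .seq (.loadNat vE aPart [.var vHead, .var vm, .var vx]) <|
    .seq (.branch (.le (.var vE) (.const 0))
      (.loadNat vE aSpan [.succ (.var vT), .var vNew, .var vx]) .skip) <|
    forLoop vv (.const 0) (.var vU) <|
      .seq (.storeField fVec [.succ (.var vs), .var vv] .zero) <|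
      forLoop vu (.const 0) (.var vU) <|
        .storeField fVec [.succ (.var vs), .var vv]
          (.add (.load fVec [.succ (.var vs), .var vv])
            (.mul (.load fVec [.var vs, .var vu])
              (.load fCoeff [.var vi, .var vs, .var vu, .var vv, .sub (.var vE) (.const 1)])))

variable {F : Type*} [Field F]

/-- Dynamic programming over the layers. Only assignment `vm` of the node and slot `vNew` of `aSpan`
enter, the former with priority. -/
theorem prefixProg_spec {n w c B : ℕ} {C : List ℕ → F} {o : List ℕ → ℕ}
    (hI : IsInput n w c C o) (s₀ : State F) (hC : s₀.farr fCoeff = C) (ho : s₀.narr aOrder = o)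
    (hi : s₀.var vi < c) (hU : w ≤ s₀.var vU) (hUB : s₀.var vU ≤ B)
    (hLB : s₀.var vL ≤ B) :
    Triple B prefixProg s₀ fun s => ∀ u < s₀.var vU, s.farr fVec [s₀.var vL, u] =
      prefixVec C o w (s₀.var vi)
        (override (fun x => s₀.narr aPart [s₀.var vHead, s₀.var vm, x])
          (fun x => s₀.narr aSpan [s₀.var vT + 1, s₀.var vNew, x])) (s₀.var vL) u := by
  have hUpos : 0 < s₀.var vU := by have := hI.w_pos; omega
  set e := (override (fun x => s₀.narr aPart [s₀.var vHead, s₀.var vm, x])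
          (fun x => s₀.narr aSpan [s₀.var vT + 1, s₀.var vNew, x])) with he
  refine Triple.seq (R := fun s => ∀ u < s₀.var vU, s.farr fVec [0, u] = 0) ?_ ?_
  · refine Triple.forLoop (fun k s => ∀ u < k, s.farr fVec [0, u] = 0) 0 (s₀.var vU) rfl
      (Nat.zero_le _) (by omega) rfl (fun s hA => hA.var vU rfl) (by simp) ?_ (fun s _ h => h)
    intro k s _ hk hA hv hI
    refine Triple.storeField ?_
    intro u hu
    simp only [State.setVar_farr, State.setField_farr]
    by_cases h : u = k
    · simp [h, hv]
    · simp [h, hv, hI u (by omega)]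
  intro s₁ hA₁ h₁
  refine Triple.seq (R := fun s => ∀ u < s₀.var vU, s.farr fVec [0, u] = if u = 0 then 1 else 0)
    ?_ ?_
  · refine Triple.storeField ?_
    intro u hu
    by_cases h : u = 0
    · simp [h]
    · simp [h, h₁ u hu]
  intro s₂ hA₂ h₂
  refine Triple.forLoop (fun k s => ∀ u < s₀.var vU, s.farr fVec [k, u] =
    prefixVec C o (s₀.var vU) (s₀.var vi) e k u) 0 (s₀.var vL) rfl (Nat.zero_le _) (by omega) rfl
    (fun s hA => by simp [hA.var vL rfl, hA₂.var vL rfl, hA₁.var vL rfl]) h₂ ?_ ?_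
  · intro k s _ hk hA hv hI
    refine Triple.seq' (Triple.loadNat (Triple.seq' (Triple.loadNat ?_)))
    have ho' : s.narr aOrder = o := by
      rw [hA.narr aOrder rfl, hA₂.narr aOrder rfl, hA₁.narr aOrder rfl, ho]
    have hp' : s.narr aPart = s₀.narr aPart := by
      rw [hA.narr aPart rfl, hA₂.narr aPart rfl, hA₁.narr aPart rfl]
    have ha' : s.narr aSpan = s₀.narr aSpan := by
      rw [hA.narr aSpan rfl, hA₂.narr aSpan rfl, hA₁.narr aSpan rfl]
    have hC' : s.farr fCoeff = C := by
      rw [hA.farr fCoeff rfl, hA₂.farr fCoeff rfl, hA₁.farr fCoeff rfl, hC]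
    have hv' : ∀ y, prefixProg.writesVar y = false → s.var y = s₀.var y := by
      intro y hy
      simp only [prefixProg, Program.writesVar, Bool.or_eq_false_iff] at hy
      rw [hA.var y hy.2.2, hA₂.var y rfl, hA₁.var y hy.1]
    refine Triple.seq (R := fun s' => s'.var vE = e (o [s₀.var vi, k])) ?_ ?_
    · refine Triple.branch (fun hb => Triple.loadNat ?_) (fun hb => Triple.skip ?_)
      · simp [hv, hv' vi rfl, hv' vHead rfl, hv' vm rfl, hv' vT rfl, hv' vNew rfl, ho', hp', ha']
          at hb ⊢
        simp [he, override, hb]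
      · simp [hv, hv' vi rfl, hv' vHead rfl, hv' vm rfl, ho', hp'] at hb ⊢
        simp [he, override, hb]
    intro s₃ hA₃ h₃
    have hU₃ : s₃.var vU = s₀.var vU := by simp [hA₃.var vU rfl, hv' vU rfl]
    have hi₃ : s₃.var vi = s₀.var vi := by simp [hA₃.var vi rfl, hv' vi rfl]
    have hs₃ : s₃.var vs = k := by simp [hA₃.var vs rfl, hv]
    have hC₃ : s₃.farr fCoeff = C := by simp [hA₃.farr fCoeff rfl, hC']
    have hV₃ : s₃.farr fVec = s.farr fVec := by simp [hA₃.farr fVec rfl]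
    refine Triple.forLoop (fun v s => (∀ u < s₀.var vU, s.farr fVec [k, u] =
        prefixVec C o (s₀.var vU) (s₀.var vi) e k u) ∧ (∀ u < v, s.farr fVec [k + 1, u] =
        prefixVec C o (s₀.var vU) (s₀.var vi) e (k + 1) u)) 0 (s₀.var vU) rfl (Nat.zero_le _)
      (by omega) rfl (fun s hA => by simp [hA.var vU rfl, hU₃]) ?_ ?_ ?_
    · simpa [hV₃] using hI
    · intro v s₄ _ hv₄ hA₄ hvv₄ hI₄
      refine Triple.seq' (Triple.storeField ?_)
      refine Triple.forLoop (fun u s => (∀ u < s₀.var vU, s.farr fVec [k, u] =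
          prefixVec C o (s₀.var vU) (s₀.var vi) e k u) ∧ (∀ u < v, s.farr fVec [k + 1, u] =
          prefixVec C o (s₀.var vU) (s₀.var vi) e (k + 1) u) ∧
          s.farr fVec [k + 1, v] = ∑ u' ∈ range u, prefixVec C o (s₀.var vU) (s₀.var vi) e k u' *
            C [s₀.var vi, k, u', v, e (o [s₀.var vi, k]) - 1]) 0 (s₀.var vU) rfl (Nat.zero_le _)
        (by omega) rfl (fun s hA => by simp [hA.var vU rfl, hA₄.var vU rfl, hU₃]) ?_ ?_ ?_
      · simp only [State.setVar_farr, State.setField_farr]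
        refine ⟨fun u hu => ?_, fun u hu => ?_, ?_⟩
        · simp [hA₄.var vs rfl, hs₃, hI₄.1 u hu]
        · simp [hvv₄, hu.ne, hI₄.2 u hu]
        · simp [hvv₄, hA₄.var vs rfl, hs₃]
      · intro u s₅ _ hu₅ hA₅ huv hI₅
        refine Triple.storeField ?_
        have e1 : s₅.var vs = k := by simp [hA₅.var vs rfl, hA₄.var vs rfl, hs₃]
        have e2 : s₅.var vv = v := by simp [hA₅.var vv rfl, hvv₄]
        have e3 : s₅.var vi = s₀.var vi := by simp [hA₅.var vi rfl, hA₄.var vi rfl, hi₃]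
        have e4 : s₅.var vE = e (o [s₀.var vi, k]) := by
          simp [hA₅.var vE rfl, hA₄.var vE rfl, h₃]
        have e5 : s₅.farr fCoeff = C := by
          rw [hA₅.farr fCoeff rfl]
          funext is
          simp [hA₄.farr fCoeff rfl, hC₃]
        simp only [State.setVar_farr, State.setField_farr]
        refine ⟨fun u hu => ?_, fun u hu => ?_, ?_⟩
        · simp [e1, hI₅.1 u hu]
        · simp [e1, e2, hu.ne, hI₅.2.1 u hu]
        · simp [e1, e2, e3, e4, e5, huv, hI₅.2.2, sum_range_succ, hI₅.1 u hu₅]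
      · intro s₅ hA₅ hI₅
        simp only [State.setVar_farr]
        refine ⟨hI₅.1, fun u hu => ?_⟩
        rcases Nat.lt_succ_iff_lt_or_eq.1 hu with h | rfl
        · exact hI₅.2.1 u h
        · exact hI₅.2.2
    · intro s₄ hA₄ hI₄
      exact hI₄.2
  · intro s hA h u hu
    rw [h u hu, hI.prefixVec_width hi hU]

end PIT

/-! ### Subprograms that produce a new assignment and its vector -/

namespace PIT

open Finset

/-- `for m < hm do for u < hu do a[is, m, u] := e`. -/
def fillProg (a : ℕ) (is : List NExpr) (hm hu : NExpr) (e : FExpr) : Program :=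
  forLoop vm (.const 0) hm <| forLoop vu (.const 0) hu <|
    .storeField a (is ++ [.var vm, .var vu]) e

variable {F : Type*} [Field F]

/-- The condition `he` lets `e` read the old content of the very cell that is being written, so that
updates in place are covered. -/
theorem fillProg_spec {B : ℕ} (a : ℕ) (is : List NExpr) (hm hu : NExpr) (e : FExpr)
    (s₀ : State F) (M U : ℕ) (pre : List ℕ) (val : ℕ → ℕ → F) (hMB : M ≤ B) (hUB : U ≤ B)
    (hM : ∀ s, Agree (fillProg a is hm hu e) s₀ s → hm.eval s = M)
    (hU : ∀ s, Agree (fillProg a is hm hu e) s₀ s → hu.eval s = U)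
    (his : ∀ s, Agree (fillProg a is hm hu e) s₀ s → evalIndex s is = pre)
    (he : ∀ s, Agree (fillProg a is hm hu e) s₀ s → s.var vm < M → s.var vu < U →
      s.farr a (pre ++ [s.var vm, s.var vu]) = s₀.farr a (pre ++ [s.var vm, s.var vu]) →
      e.eval s = val (s.var vm) (s.var vu)) :
    Triple B (fillProg a is hm hu e) s₀ fun s =>
      (∀ m < M, ∀ u < U, s.farr a (pre ++ [m, u]) = val m u) ∧
      (∀ js, (∀ m < M, ∀ u < U, js ≠ pre ++ [m, u]) → s.farr a js = s₀.farr a js) := by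
  have hag : ∀ s s', Agree (fillProg a is hm hu e) s₀ s →
      Agree (forLoop vu (.const 0) hu <| .storeField a (is ++ [.var vm, .var vu]) e) s s' →
      Agree (fillProg a is hm hu e) s₀ s' := by
    intro s s' h h'
    refine h.trans ⟨fun y hy => h'.var y ?_, fun y hy => h'.narr y ?_, fun y hy => h'.farr y ?_⟩
    · simp only [fillProg, forLoop, countLoop, Program.writesVar, Bool.or_eq_false_iff] at hy ⊢
      tauto
    · simp [forLoop, countLoop, Program.writesNat]
    · simp only [fillProg, forLoop, countLoop, Program.writesField, Bool.or_eq_false_iff] at hy ⊢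
      tauto
  -- The whole array is described, for arbitrary index tuples; `getD` recovers `m` and `u` from the
  -- last two entries.
  refine Triple.forLoop (fun k s => ∀ js, s.farr a js =
    if ∃ m < k, ∃ u < U, js = pre ++ [m, u] then val (js.getD pre.length 0)
      (js.getD (pre.length + 1) 0) else s₀.farr a js) 0 M rfl (Nat.zero_le _) (by omega) rfl
    hM (by simp) ?_ ?_
  · intro m s _ hm hA hv hI
    refine Triple.forLoop (fun k s => ∀ js, s.farr a js =
      if (∃ m' < m, ∃ u < U, js = pre ++ [m', u]) ∨ (∃ u < k, js = pre ++ [m, u]) then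
        val (js.getD pre.length 0) (js.getD (pre.length + 1) 0) else s₀.farr a js) 0 U rfl
      (Nat.zero_le _) (by omega) rfl (fun s' hA' => hU s' (hag s s' hA hA')) (by simpa using hI)
      ?_ ?_
    · intro u s' _ hu hA' hv' hI'
      have hA2 := hag s s' hA hA'
      have hvm : s'.var vm = m := by rw [hA'.var vm rfl, hv]
      refine Triple.storeField ?_
      have h1 : evalIndex s' (is ++ [.var vm, .var vu]) = pre ++ [m, u] := by
        have := his s' hA2
        simp only [evalIndex] at this
        simp [this, hvm, hv']
      have h2 : e.eval s' = val m u := by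
        rw [he s' hA2 (by rw [hvm]; exact hm) (by rw [hv']; exact hu), hvm, hv']
        rw [hvm, hv', hI', if_neg]
        simp
      intro js
      simp only [State.setVar_farr, State.setField_farr, h1, h2, true_and]
      by_cases hjs : js = pre ++ [m, u]
      · subst hjs
        rw [if_pos rfl, if_pos (Or.inr ⟨u, by omega, rfl⟩)]
        simp
      · rw [if_neg hjs, hI']
        refine if_congr (or_congr Iff.rfl ⟨fun ⟨u', h, h'⟩ => ⟨u', by omega, h'⟩,
          fun ⟨u', h, h'⟩ => ⟨u', ?_, h'⟩⟩) rfl rfl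
        rcases Nat.lt_succ_iff_lt_or_eq.1 h with h | rfl
        · exact h
        · exact absurd h' hjs
    · intro s' hA' hI' js
      simp only [State.setVar_farr]
      rw [hI']
      refine if_congr ⟨?_, ?_⟩ rfl rfl
      · rintro (⟨m', h, h'⟩ | h)
        · exact ⟨m', by omega, h'⟩
        · exact ⟨m, by omega, h⟩
      · rintro ⟨m', h, h'⟩
        rcases Nat.lt_succ_iff_lt_or_eq.1 h with h | rfl
        · exact Or.inl ⟨m', h, h'⟩
        · exact Or.inr h'
  · intro s hA hI
    refine ⟨fun m hm u hu => ?_, fun js hjs => ?_⟩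
    · rw [hI, if_pos ⟨m, hm, u, hu, rfl⟩]
      simp
    · rw [hI, if_neg]
      rintro ⟨m, hm, u, hu, h⟩
      exact hjs m hm u hu h

/-- The new partial assignment: element `r` of layer `t`, extended by the value `k`. -/
def assignProg : Program :=
  .seq (forLoop vx (.const 0) (.var vN)
    (.seq (.loadNat vE aSpan [.var vT, .var vr, .var vx])
      (.storeNat aSpan [.succ (.var vT), .var vNew, .var vx] (.var vE)))) <|
  .seq (.loadNat vx aOrder [.var vLevel, .var vT]) <|
  .storeNat aSpan [.succ (.var vT), .var vNew, .var vx] (.var vK)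

/-- Slot `vNew` of layer `t + 1` is scratch space for the candidate. It becomes permanent only when
`vNew` is increased. -/
theorem assignProg_spec {B : ℕ} (s₀ : State F) (hB : s₀.var vN ≤ B) :
    Triple B assignProg s₀ fun s =>
      (∀ x < s₀.var vN, s.narr aSpan [s₀.var vT + 1, s₀.var vNew, x] =
        Function.update (fun x => s₀.narr aSpan [s₀.var vT, s₀.var vr, x])
          (s₀.narr aOrder [s₀.var vLevel, s₀.var vT]) (s₀.var vK) x) ∧
      (∀ t b x, ¬ (t = s₀.var vT + 1 ∧ b = s₀.var vNew) →
        s.narr aSpan [t, b, x] = s₀.narr aSpan [t, b, x]) := by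
  refine Triple.seq (R := fun s =>
    (∀ x < s₀.var vN, s.narr aSpan [s₀.var vT + 1, s₀.var vNew, x] =
      s₀.narr aSpan [s₀.var vT, s₀.var vr, x]) ∧
      (∀ t b x, ¬ (t = s₀.var vT + 1 ∧ b = s₀.var vNew) →
        s.narr aSpan [t, b, x] = s₀.narr aSpan [t, b, x])) ?_ ?_
  · refine Triple.forLoop (fun k s =>
      (∀ x < k, s.narr aSpan [s₀.var vT + 1, s₀.var vNew, x] =
        s₀.narr aSpan [s₀.var vT, s₀.var vr, x]) ∧
      (∀ t b x, ¬ (t = s₀.var vT + 1 ∧ b = s₀.var vNew) →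
        s.narr aSpan [t, b, x] = s₀.narr aSpan [t, b, x])) 0 (s₀.var vN) rfl (Nat.zero_le _)
      (by omega) rfl (fun s hA => hA.var vN rfl) (by simp) ?_ (fun s _ h => h)
    intro k s _ hk hA hv hI
    refine Triple.seq' (Triple.loadNat (Triple.storeNat ?_))
    have e1 := hA.var vT rfl
    have e2 := hA.var vNew rfl
    have e3 := hA.var vr rfl
    refine ⟨fun x hx => ?_, fun t b x h => ?_⟩
    · by_cases h : x = k
      · subst h; simp [e1, e2, e3, hv, hI.2]
      · simp [e1, e2, hv, h, hI.1 x (by omega)]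
    · simp [e1, e2, hv, hI.2 t b x h]
      tauto
  intro s hA hI
  refine Triple.seq' (Triple.loadNat (Triple.storeNat ?_))
  have e1 := hA.var vT rfl
  have e2 := hA.var vNew rfl
  have e3 := hA.var vLevel rfl
  have e4 := hA.var vK rfl
  have e5 := hA.narr aOrder rfl
  refine ⟨fun x hx => ?_, fun t b x h => ?_⟩
  · simp only [Function.update_apply]
    simp [e1, e2, e3, e4, e5, hI.1 x hx]
  · simp [e1, e2, hI.2 t b x h]
    tauto

/-- The vector reached by the new partial assignment, and its coefficient vector. -/
def vectorProg : Program :=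
  .seq (.setVar vi (.var vLevel)) <|
  .seq (.setVar vL (.succ (.var vT))) <|
  .seq (forLoop vm (.const 0) (.var vTerms) <| .seq prefixProg <|
    forLoop vu (.const 0) (.var vU) <|
      .storeField fY [.var vm, .var vu] (.load fVec [.var vL, .var vu])) <|
  .seq (forLoop vu (.const 0) (.var vU) <| .storeField fY [.var vTerms, .var vu] .zero) <|
  .storeField fY [.var vTerms, .var vNew] .one

/-- The extra row `vTerms` starts as the unit vector of the candidate and records, during the
elimination, which combination of vectors the other rows have become. -/
theorem vectorProg_spec {n w c B : ℕ} {C : List ℕ → F} {o : List ℕ → ℕ}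
    (hI : IsInput n w c C o) (s₀ : State F) (hC : s₀.farr fCoeff = C) (ho : s₀.narr aOrder = o)
    (hj : s₀.var vLevel < c) (hU : w ≤ s₀.var vU) (hUB : s₀.var vU ≤ B)
    (hTB : s₀.var vT + 1 ≤ B) (hNB : s₀.var vTerms ≤ B) :
    Triple B vectorProg s₀ fun s =>
      (∀ m < s₀.var vTerms, ∀ u < s₀.var vU, s.farr fY [m, u] =
        prefixVec C o w (s₀.var vLevel)
          (override (fun x => s₀.narr aPart [s₀.var vHead, m, x])
          (fun x => s₀.narr aSpan [s₀.var vT + 1, s₀.var vNew, x])) (s₀.var vT + 1) u) ∧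
      (∀ u < s₀.var vU, s.farr fY [s₀.var vTerms, u] = if u = s₀.var vNew then 1 else 0) := by
  refine Triple.seq' (Triple.setVar (Triple.seq' (Triple.setVar ?_)))
  set val : ℕ → ℕ → F := fun m u => prefixVec C o w (s₀.var vLevel)
          (override (fun x => s₀.narr aPart [s₀.var vHead, m, x])
          (fun x => s₀.narr aSpan [s₀.var vT + 1, s₀.var vNew, x])) (s₀.var vT + 1) u with hval
  refine Triple.seq (R := fun s => ∀ m < s₀.var vTerms, ∀ u < s₀.var vU,
    s.farr fY [m, u] = val m u) ?_ ?_
  · refine Triple.forLoop (fun k s => ∀ m < k, ∀ u < s₀.var vU, s.farr fY [m, u] = val m u)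
      0 (s₀.var vTerms) rfl (Nat.zero_le _) (by omega) rfl (fun s hA => by simp [hA.var vTerms rfl])
      (by simp) ?_ (fun s _ h => h)
    intro m s _ hm hA hv hI1
    have e1 : s.var vi = s₀.var vLevel := by simp [hA.var vi rfl]
    have e2 : s.var vL = s₀.var vT + 1 := by simp [hA.var vL rfl]
    have e3 : s.var vU = s₀.var vU := by simp [hA.var vU rfl]
    have e4 : s.var vHead = s₀.var vHead := by simp [hA.var vHead rfl]
    have e5 : s.var vT = s₀.var vT := by simp [hA.var vT rfl]
    have e6 : s.var vNew = s₀.var vNew := by simp [hA.var vNew rfl]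
    have e7 : s.narr aPart = s₀.narr aPart := hA.narr aPart rfl
    have e8 : s.narr aSpan = s₀.narr aSpan := hA.narr aSpan rfl
    refine Triple.seq (prefixProg_spec hI s ((hA.farr fCoeff rfl).trans hC)
      ((hA.narr aOrder rfl).trans ho) (by rw [e1]; exact hj) (by rw [e3]; exact hU)
      (by rw [e3]; exact hUB) (by rw [e2]; exact hTB)) ?_
    intro s₁ hA₁ h₁
    rw [e1, e2, e3, e4, e5, e6, e7, e8, hv] at h₁
    refine Triple.forLoop (fun k s => (∀ m' < m, ∀ u < s₀.var vU, s.farr fY [m', u] = val m' u) ∧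
      (∀ u < k, s.farr fY [m, u] = val m u))
      0 (s₀.var vU) rfl (Nat.zero_le _) (by omega) rfl
      (fun s hA => by simp [hA.var vU rfl, hA₁.var vU rfl, e3])
      (by simpa [hA₁.farr fY rfl] using hI1) ?_ ?_
    · intro u s₂ _ hu hA₂ hv₂ hI₂
      refine Triple.storeField ?_
      have e9 : s₂.var vm = m := by rw [hA₂.var vm rfl, hA₁.var vm rfl, hv]
      have e10 : s₂.var vL = s₀.var vT + 1 := by rw [hA₂.var vL rfl, hA₁.var vL rfl, e2]
      have e11 : s₂.farr fVec = s₁.farr fVec := hA₂.farr fVec rfl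
      refine ⟨fun m' hm' u' hu' => ?_, fun u' hu' => ?_⟩
      · simp [e9, hm'.ne, hI₂.1 m' hm' u' hu']
      · by_cases h : u' = u
        · subst h; simp [e9, hv₂, e10, e11, h₁ u' hu, hval]
        · simp [e9, hv₂, h, hI₂.2 u' (by omega)]
    · intro s₂ hA₂ hI₂ m' hm' u hu
      rcases Nat.lt_succ_iff_lt_or_eq.1 hm' with h | rfl
      · exact hI₂.1 m' h u hu
      · exact hI₂.2 u hu
  intro s₁ hA₁ h₁
  refine Triple.seq (R := fun s => (∀ m < s₀.var vTerms, ∀ u < s₀.var vU,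
    s.farr fY [m, u] = val m u) ∧ ∀ u < s₀.var vU, s.farr fY [s₀.var vTerms, u] = 0) ?_ ?_
  · refine Triple.forLoop (fun k s => (∀ m < s₀.var vTerms, ∀ u < s₀.var vU,
      s.farr fY [m, u] = val m u) ∧ ∀ u < k, s.farr fY [s₀.var vTerms, u] = 0)
      0 (s₀.var vU) rfl (Nat.zero_le _) (by omega) rfl
      (fun s hA => by simp [hA.var vU rfl, hA₁.var vU rfl]) (by simpa using h₁) ?_ (fun s _ h => h)
    intro u s₂ _ hu hA₂ hv₂ hI₂
    refine Triple.storeField ?_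
    have e1 : s₂.var vTerms = s₀.var vTerms := by simp [hA₂.var vTerms rfl, hA₁.var vTerms rfl]
    refine ⟨fun m' hm' u' hu' => ?_, fun u' hu' => ?_⟩
    · simp [e1, hm'.ne, hI₂.1 m' hm' u' hu']
    · by_cases h : u' = u
      · simp [e1, hv₂, h]
      · simp [e1, hv₂, h, hI₂.2 u' (by omega)]
  intro s₂ hA₂ h₂
  refine Triple.storeField ?_
  have e1 : s₂.var vTerms = s₀.var vTerms := by simp [hA₂.var vTerms rfl, hA₁.var vTerms rfl]
  have e2 : s₂.var vNew = s₀.var vNew := by simp [hA₂.var vNew rfl, hA₁.var vNew rfl]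
  refine ⟨fun m' hm' u' hu' => ?_, fun u' hu' => ?_⟩
  · simp [e1, hm'.ne, h₂.1 m' hm' u' hu', hval]
  · by_cases h : u' = s₀.var vNew
    · simp [e1, e2, h]
    · simp [e1, e2, h, h₂.2 u' hu']

end PIT

/-! ### Elimination, generation of a child node, and the coefficient test as programs -/

namespace PIT

open Finset

variable {F : Type*} [Field F]

/-- Reduction of `y` by the rows of the echelon form. -/
def reduceProg : Program :=
  forLoop vq (.const 0) (.var vNew) <|
    .seq (.loadNat vPm aPivot [.var vq, .const 0]) <|
    .seq (.loadNat vPu aPivot [.var vq, .const 1]) <|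
    -- The quotient is saved first, because the following pass overwrites the pivot entry from which
    -- it is computed.
    .seq (.storeField fScalar [.const 0]
      (.div (.load fY [.var vPm, .var vPu]) (.load fRho [.var vq, .var vPm, .var vPu]))) <|
    fillProg fY [] (.succ (.var vTerms)) (.var vU)
      (.sub (.load fY [.var vm, .var vu])
        (.mul (.load fScalar [.const 0]) (.load fRho [.var vq, .var vm, .var vu])))

theorem reduceProg_spec {B : ℕ} {v : ℕ → ℕ → ℕ → F} (s₀ : State F)
    (hNB : s₀.var vTerms + 1 ≤ B) (hUB : s₀.var vU ≤ B) (hRU : s₀.var vNew < s₀.var vU)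
    (hE : Echelon (s₀.var vTerms) (s₀.var vU) (s₀.var vNew) (fun r m u => s₀.farr fRho [r, m, u])
      (fun r => s₀.narr aPivot [r, 0]) (fun r => s₀.narr aPivot [r, 1]) v)
    (h : Reduced (s₀.var vTerms) (s₀.var vU) (s₀.var vNew) 0
      (fun r => s₀.narr aPivot [r, 0]) (fun r => s₀.narr aPivot [r, 1]) v
      (fun m u => s₀.farr fY [m, u])) :
    Triple B reduceProg s₀ fun s =>
      Reduced (s₀.var vTerms) (s₀.var vU) (s₀.var vNew) (s₀.var vNew)
      (fun r => s₀.narr aPivot [r, 0]) (fun r => s₀.narr aPivot [r, 1]) v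
      (fun m u => s.farr fY [m, u]) := by
  refine Triple.forLoop (fun k s => Reduced (s₀.var vTerms) (s₀.var vU) (s₀.var vNew) k
      (fun r => s₀.narr aPivot [r, 0]) (fun r => s₀.narr aPivot [r, 1]) v
      (fun m u => s.farr fY [m, u])) 0 (s₀.var vNew) rfl (Nat.zero_le _) (by omega) rfl
    (fun s hA => hA.var vNew rfl) h ?_ (fun s _ h => h)
  intro k s _ hk hA hv hI
  refine Triple.seq' (Triple.loadNat (Triple.seq' (Triple.loadNat
    (Triple.seq' (Triple.storeField ?_)))))
  have e1 : s.narr aPivot = s₀.narr aPivot := hA.narr aPivot rfl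
  have e2 : s.farr fRho = s₀.farr fRho := hA.farr fRho rfl
  have e3 : s.var vTerms = s₀.var vTerms := hA.var vTerms rfl
  have e4 : s.var vU = s₀.var vU := hA.var vU rfl
  refine (fillProg_spec fY [] _ _ _ _ (s₀.var vTerms + 1) (s₀.var vU) [] (fun m u =>
    s.farr fY [m, u] - s.farr fY [s₀.narr aPivot [k, 0], s₀.narr aPivot [k, 1]] /
      s₀.farr fRho [k, s₀.narr aPivot [k, 0], s₀.narr aPivot [k, 1]] * s₀.farr fRho [k, m, u])
    hNB hUB ?_ ?_ ?_ ?_).mono ?_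
  · intro s' hA'
    simp [hA'.var vTerms rfl, e3]
  · intro s' hA'
    simp [hA'.var vU rfl, e4]
  · intro s' hA'
    rfl
  · intro s' hA' hm hu hy
    have hy' : s'.farr fY [s'.var vm, s'.var vu] = s.farr fY [s'.var vm, s'.var vu] := by
      simpa using hy
    simp [hy', hA'.farr fScalar rfl, hA'.farr fRho rfl, hA'.var vq rfl, hv, e1, e2]
  · intro s' hA' h'
    refine hI.step hE hk hRU fun m hm u hu => ?_
    have := h'.1 m (by omega) u hu
    simpa using this

/-- Storage of the reduced vector as a new row of the echelon form. -/
def storeProg : Program :=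
  fillProg fRho [.var vNew] (.succ (.var vTerms)) (.var vU) (.load fY [.var vm, .var vu])

theorem storeProg_spec {B : ℕ} (s₀ : State F)
    (hNB : s₀.var vTerms + 1 ≤ B) (hUB : s₀.var vU ≤ B) :
    Triple B storeProg s₀ fun s =>
      (∀ m ≤ s₀.var vTerms, ∀ u < s₀.var vU,
        s.farr fRho [s₀.var vNew, m, u] = s₀.farr fY [m, u]) ∧
      (∀ r m u, r ≠ s₀.var vNew → s.farr fRho [r, m, u] = s₀.farr fRho [r, m, u]) := by
  refine (fillProg_spec fRho _ _ _ _ _ (s₀.var vTerms + 1) (s₀.var vU) [s₀.var vNew]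
    (fun m u => s₀.farr fY [m, u]) hNB hUB ?_ ?_ ?_ ?_).mono ?_
  · intro s' hA'
    simp [hA'.var vTerms rfl]
  · intro s' hA'
    simp [hA'.var vU rfl]
  · intro s' hA'
    simp [hA'.var vNew rfl]
  · intro s' hA' hm hu hy
    simp [hA'.farr fY rfl]
  · intro s' hA' h'
    refine ⟨fun m hm u hu => h'.1 m (by omega) u hu, fun r m u hr => h'.2 _ fun m' _ u' _ => ?_⟩
    simp [hr]

/-- Search for a nonzero entry of the reduced vector. -/
def searchProg : Program :=
  .seq (.setVar vFound (.const 0)) <|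
  forLoop vm (.const 0) (.var vTerms) <| forLoop vu (.const 0) (.var vU) <|
    .branch (.isZero (.load fY [.var vm, .var vu])) .skip <|
      .seq (.setVar vFound (.const 1)) <|
      .seq (.storeNat aPivot [.var vNew, .const 0] (.var vm)) <|
      .storeNat aPivot [.var vNew, .const 1] (.var vu)

theorem searchProg_spec {B : ℕ} (s₀ : State F)
    (hNB : s₀.var vTerms ≤ B) (hUB : s₀.var vU ≤ B) :
    Triple B searchProg s₀ fun s =>
      (∀ r i, r ≠ s₀.var vNew → s.narr aPivot [r, i] = s₀.narr aPivot [r, i]) ∧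
      ((s.var vFound = 0 ∧ ∀ m < s₀.var vTerms, ∀ u < s₀.var vU, s₀.farr fY [m, u] = 0) ∨
        (s.var vFound = 1 ∧ s.narr aPivot [s₀.var vNew, 0] < s₀.var vTerms ∧
          s.narr aPivot [s₀.var vNew, 1] < s₀.var vU ∧
          s₀.farr fY [s.narr aPivot [s₀.var vNew, 0], s.narr aPivot [s₀.var vNew, 1]] ≠ 0)) := by
  refine Triple.seq' (Triple.setVar ?_)
  -- Only rows below `vTerms` are searched: the coefficient row is never zero and must not supply a
  -- pivot. If there are several nonzero entries, any of them will do.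
  set I : ℕ → ℕ → State F → Prop := fun k l s =>
      (∀ r i, r ≠ s₀.var vNew → s.narr aPivot [r, i] = s₀.narr aPivot [r, i]) ∧
      ((s.var vFound = 0 ∧ (∀ m < k, ∀ u < s₀.var vU, s₀.farr fY [m, u] = 0) ∧
          ∀ u < l, s₀.farr fY [k, u] = 0) ∨
        (s.var vFound = 1 ∧ s.narr aPivot [s₀.var vNew, 0] < s₀.var vTerms ∧
          s.narr aPivot [s₀.var vNew, 1] < s₀.var vU ∧
          s₀.farr fY [s.narr aPivot [s₀.var vNew, 0], s.narr aPivot [s₀.var vNew, 1]] ≠ 0))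
    with hIdef
  refine Triple.forLoop (fun k s => I k 0 s) 0 (s₀.var vTerms) rfl (Nat.zero_le _) (by omega) rfl
    (fun s hA => by simp [hA.var vTerms rfl]) (by simp [hIdef]) ?_ ?_
  · intro m s _ hm hA hv hI
    refine Triple.forLoop (fun l s => I m l s) 0 (s₀.var vU) rfl (Nat.zero_le _) (by omega) rfl
      (fun s' hA' => by simp [hA'.var vU rfl, hA.var vU rfl]) (by simpa [hIdef] using hI) ?_ ?_
    · intro u s' _ hu hA' hv' hI'
      have e1 : s'.farr fY = s₀.farr fY := by rw [hA'.farr fY rfl, hA.farr fY rfl]; rfl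
      have e2 : s'.var vm = m := by rw [hA'.var vm rfl, hv]
      have e3 : s'.var vNew = s₀.var vNew := by simp [hA'.var vNew rfl, hA.var vNew rfl]
      refine Triple.branch (fun hb => Triple.skip ?_) (fun hb =>
        Triple.seq' (Triple.setVar (Triple.seq' (Triple.storeNat (Triple.storeNat ?_)))))
      · simp only [BExpr.Holds, FExpr.eval, evalIndex, List.map, NExpr.eval, e1, e2, hv'] at hb
        refine ⟨hI'.1, hI'.2.imp (fun h => ⟨h.1, h.2.1, fun u' hu' => ?_⟩) (fun h => h)⟩
        rcases Nat.lt_succ_iff_lt_or_eq.1 hu' with h' | rfl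
        · exact h.2.2 u' h'
        · exact hb
      · simp only [BExpr.Holds, FExpr.eval, evalIndex, List.map, NExpr.eval, e1, e2, hv'] at hb
        refine ⟨fun r i hr => ?_, Or.inr ?_⟩
        · simp [e3, hr, hI'.1 r i hr]
        · simp [e2, e3, hv', hm, hu, hb]
    · intro s' hA' hI'
      refine ⟨hI'.1, hI'.2.imp (fun h => ⟨h.1, fun m' hm' u hu => ?_, by simp⟩) (fun h => h)⟩
      rcases Nat.lt_succ_iff_lt_or_eq.1 hm' with h' | rfl
      · exact h.2.1 m' h' u hu
      · exact h.2.2 u hu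
  · intro s hA hI
    exact ⟨hI.1, hI.2.imp (fun h => ⟨h.1, h.2.1⟩) fun h => h⟩

/-- The new node that belongs to the linear dependency found by the reduction. -/
def childProg : Program :=
  .seq (.setVar vCount (.const 0)) <|
  .seq (forLoop vb (.const 0) (.succ (.var vNew)) <| forLoop vm (.const 0) (.var vTerms) <|
    .seq (.storeField fLam [.var vTail, .var vCount]
      (.mul (.load fLam [.var vHead, .var vm]) (.load fY [.var vTerms, .var vb]))) <|
    .seq (forLoop vx (.const 0) (.var vN) <|
      .seq (.loadNat vE aPart [.var vHead, .var vm, .var vx]) <|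
      .seq (.branch (.le (.var vE) (.const 0))
        (.loadNat vE aSpan [.succ (.var vT), .var vb, .var vx]) .skip) <|
      .storeNat aPart [.var vTail, .var vCount, .var vx] (.var vE)) <|
    .setVar vCount (.succ (.var vCount))) <|
  .seq (.storeNat aTerms [.var vTail] (.var vCount)) <|
  .seq (.storeNat aLevel [.var vTail] (.succ (.var vLevel))) <|
  .setVar vTail (.succ (.var vTail))

/-- The terms of the child are the pairs of an element `b` of the dependency and a term `m` of the
parent, with the product of their coefficients. By `hht` the new entry does not overwrite the parent
while it is still being read. -/
theorem childProg_spec {n w c B : ℕ} {C : List ℕ → F} {o : List ℕ → ℕ}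
    (hI : IsInput n w c C o) (s₀ : State F) (hn : s₀.var vN = n) (hnB : n ≤ B)
    (hNB : s₀.var vTerms ≤ B) (hRB : s₀.var vNew + 1 ≤ B) (hht : s₀.var vHead < s₀.var vTail) :
    Triple B childProg s₀ fun s =>
      s.var vTail = s₀.var vTail + 1 ∧
      (∀ q ≠ s₀.var vTail, s.narr aTerms [q] = s₀.narr aTerms [q] ∧
        s.narr aLevel [q] = s₀.narr aLevel [q] ∧
        (∀ m, s.farr fLam [q, m] = s₀.farr fLam [q, m]) ∧
        (∀ m x, s.narr aPart [q, m, x] = s₀.narr aPart [q, m, x])) ∧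
      s.narr aTerms [s₀.var vTail] = (s₀.var vNew + 1) * s₀.var vTerms ∧
      s.narr aLevel [s₀.var vTail] = s₀.var vLevel + 1 ∧
      (∀ i < c, ∀ e, ∑ l ∈ range (s.narr aTerms [s₀.var vTail]), s.farr fLam [s₀.var vTail, l] *
        prefixVec C o w i (override (fun x => s.narr aPart [s₀.var vTail, l, x]) e) n 0 =
        ∑ b ∈ range (s₀.var vNew + 1), ∑ m ∈ range (s₀.var vTerms),
          s₀.farr fLam [s₀.var vHead, m] * s₀.farr fY [s₀.var vTerms, b] *
          prefixVec C o w i (override (override (fun x => s₀.narr aPart [s₀.var vHead, m, x])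
            (fun x => s₀.narr aSpan [s₀.var vT + 1, b, x])) e) n 0) := by
  refine Triple.seq' (Triple.setVar ?_)
  set f : ℕ → ℕ → ℕ → (ℕ → ℕ) → F := fun b m i e =>
    s₀.farr fLam [s₀.var vHead, m] * s₀.farr fY [s₀.var vTerms, b] *
          prefixVec C o w i (override (override (fun x => s₀.narr aPart [s₀.var vHead, m, x])
            (fun x => s₀.narr aSpan [s₀.var vT + 1, b, x])) e) n 0 with hf
  -- The pair `(b, m)` has number `b * vTerms + m`; the two sums stand for the complete rounds and
  -- the current one.
  set I : ℕ → ℕ → State F → Prop := fun b m s =>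
    (∀ q ≠ s₀.var vTail,
        (∀ m, s.farr fLam [q, m] = s₀.farr fLam [q, m]) ∧
        (∀ m x, s.narr aPart [q, m, x] = s₀.narr aPart [q, m, x])) ∧
      s.var vCount = b * s₀.var vTerms + m ∧
      (∀ i < c, ∀ e, ∑ l ∈ range (s.var vCount), s.farr fLam [s₀.var vTail, l] *
        prefixVec C o w i (override (fun x => s.narr aPart [s₀.var vTail, l, x]) e) n 0 =
        ∑ b ∈ range b, ∑ m ∈ range (s₀.var vTerms), f b m i e + ∑ m ∈ range m, f b m i e)
    with hIdef
  refine Triple.seq (R := fun s => I (s₀.var vNew + 1) 0 s) ?_ ?_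
  · refine Triple.forLoop (fun b s => I b 0 s) 0 (s₀.var vNew + 1) rfl (Nat.zero_le _) (by omega)
      rfl (fun s hA => by simp [hA.var vNew rfl]) (by simp [hIdef]) ?_ (fun s _ h => h)
    intro b s _ hb hA hv hIb
    have e1 : s.var vTerms = s₀.var vTerms := by simp [hA.var vTerms rfl]
    have e2 : s.var vN = n := by simp [hA.var vN rfl, hn]
    have e3 : s.var vTail = s₀.var vTail := by simp [hA.var vTail rfl]
    have e4 : s.var vHead = s₀.var vHead := by simp [hA.var vHead rfl]
    have e5 : s.var vT = s₀.var vT := by simp [hA.var vT rfl]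
    have e6 : s.farr fY = s₀.farr fY := hA.farr fY rfl
    have e7 : s.narr aSpan = s₀.narr aSpan := hA.narr aSpan rfl
    refine Triple.forLoop (fun m s => I b m s) 0 (s₀.var vTerms) rfl (Nat.zero_le _) (by omega)
      rfl (fun s' hA' => by simp [hA'.var vTerms rfl, e1]) (by simpa [hIdef] using hIb) ?_ ?_
    · intro m s₁ _ hm hA₁ hv₁ hI₁
      obtain ⟨hI₁a, hI₁b, hI₁c⟩ := hI₁
      have k1 : s₁.var vTerms = s₀.var vTerms := by simp [hA₁.var vTerms rfl, e1]
      have k2 : s₁.var vN = n := by simp [hA₁.var vN rfl, e2]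
      have k3 : s₁.var vTail = s₀.var vTail := by simp [hA₁.var vTail rfl, e3]
      have k4 : s₁.var vHead = s₀.var vHead := by simp [hA₁.var vHead rfl, e4]
      have k5 : s₁.var vT = s₀.var vT := by simp [hA₁.var vT rfl, e5]
      have k6 : s₁.farr fY = s₀.farr fY := by rw [hA₁.farr fY rfl, e6]
      have k7 : s₁.narr aSpan = s₀.narr aSpan := by rw [hA₁.narr aSpan rfl, e7]
      have k8 : s₁.var vb = b := by rw [hA₁.var vb rfl, hv]
      refine Triple.seq' (Triple.storeField ?_)
      set p : ℕ → ℕ := override (fun x => s₀.narr aPart [s₀.var vHead, m, x])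
            (fun x => s₀.narr aSpan [s₀.var vT + 1, b, x]) with hp
      refine Triple.seq (R := fun s =>
        (∀ x < n, s.narr aPart [s₀.var vTail, s₁.var vCount, x] = p x) ∧
        ∀ q m' x, ¬ (q = s₀.var vTail ∧ m' = s₁.var vCount) →
          s.narr aPart [q, m', x] = s₁.narr aPart [q, m', x]) ?_ ?_
      · refine Triple.forLoop (fun k s =>
          (∀ x < k, s.narr aPart [s₀.var vTail, s₁.var vCount, x] = p x) ∧
          ∀ q m' x, ¬ (q = s₀.var vTail ∧ m' = s₁.var vCount) →
            s.narr aPart [q, m', x] = s₁.narr aPart [q, m', x]) 0 n rfl (Nat.zero_le _) (by omega)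
          rfl (fun s hA => by simp [hA.var vN rfl, k2]) (by simp) ?_ (fun s _ h => h)
        intro x s₂ _ hx hA₂ hv₂ hI₂
        have l1 : s₂.var vTail = s₀.var vTail := by simp [hA₂.var vTail rfl, k3]
        have l2 : s₂.var vHead = s₀.var vHead := by simp [hA₂.var vHead rfl, k4]
        have l3 : s₂.var vT = s₀.var vT := by simp [hA₂.var vT rfl, k5]
        have l4 : s₂.var vb = b := by simp [hA₂.var vb rfl, k8]
        have l5 : s₂.var vm = m := by simp [hA₂.var vm rfl, hv₁]
        have l6 : s₂.var vCount = s₁.var vCount := by simp [hA₂.var vCount rfl]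
        have l7 : s₂.narr aSpan = s₀.narr aSpan := by rw [hA₂.narr aSpan rfl]; simpa using k7
        have l8 : s₂.narr aPart [s₀.var vHead, m, x] = s₀.narr aPart [s₀.var vHead, m, x] := by
          rw [hI₂.2 _ _ _ (by omega)]
          exact (hI₁a _ hht.ne).2 m x
        refine Triple.seq' (Triple.loadNat ?_)
        refine Triple.seq (R := fun s => s.var vE = p x) ?_ ?_
        · refine Triple.branch (fun hb => Triple.loadNat ?_) (fun hb => Triple.skip ?_)
          · simp [l2, l3, l4, l5, l7, l8, hv₂] at hb ⊢
            simp [hp, override, hb]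
          · simp [l2, l5, l8, hv₂] at hb ⊢
            simp [hp, override, hb]
        intro s₃ hA₃ h₃
        refine Triple.storeNat ?_
        have m1 : s₃.var vTail = s₀.var vTail := by simp [hA₃.var vTail rfl, l1]
        have m2 : s₃.var vCount = s₁.var vCount := by simp [hA₃.var vCount rfl, l6]
        have m3 : s₃.var vx = x := by simp [hA₃.var vx rfl, hv₂]
        have m4 : s₃.narr aPart = s₂.narr aPart := by simp [hA₃.narr aPart rfl]
        refine ⟨fun x' hx' => ?_, fun q m' x' h => ?_⟩
        · by_cases h : x' = x
          · simp [m1, m2, m3, h, h₃]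
          · simp [m1, m2, m3, m4, h, hI₂.1 x' (by omega)]
        · simp [m1, m2, m3, m4, hI₂.2 q m' x' h]
          tauto
      intro s₂ hA₂ h₂
      refine Triple.setVar ?_
      have l1 : s₂.var vCount = s₁.var vCount := by simp [hA₂.var vCount rfl]
      have l2 : s₂.farr fLam = (s₁.setField fLam [s₀.var vTail, s₁.var vCount]
          (s₀.farr fLam [s₀.var vHead, m] * s₀.farr fY [s₀.var vTerms, b])).farr fLam := by
        rw [hA₂.farr fLam rfl]
        simp [k3, k4, k1, k6, k8, hv₁, (hI₁a _ hht.ne).1]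
      refine ⟨fun q hq => ⟨fun m' => ?_, fun m' x => ?_⟩, ?_, fun i hi e => ?_⟩
      · simp [l2, hq, (hI₁a q hq).1]
      · simp [h₂.2 q m' x (by omega), (hI₁a q hq).2]
      · simp [l1, hI₁b]
        omega
      · simp only [State.setVar_var, State.setVar_farr, State.setVar_narr, NExpr.eval, l1]
        simp only [↓reduceIte, Nat.reduceEqDiff]
        rw [sum_range_succ, sum_range_succ, ← add_assoc, ← hI₁c i hi e]
        congr 1
        · refine Finset.sum_congr rfl fun l hl => ?_
          have hl' : l ≠ s₁.var vCount := (mem_range.1 hl).ne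
          have : ∀ x, s₂.narr aPart [s₀.var vTail, l, x] = s₁.narr aPart [s₀.var vTail, l, x] :=
            fun x => h₂.2 _ _ x (by simp [hl'])
          simp [l2, hl', this]
        · have : s₂.farr fLam [s₀.var vTail, s₁.var vCount] =
              s₀.farr fLam [s₀.var vHead, m] * s₀.farr fY [s₀.var vTerms, b] := by
            rw [l2]; simp
          rw [this, hI.prefixVec_congr hi (e' := override p e) (fun x hx => ?_) 0 le_rfl]
          simp [override, h₂.1 x hx]
    · intro s₁ hA₁ hI₁
      obtain ⟨hI₁a, hI₁b, hI₁c⟩ := hI₁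
      refine ⟨hI₁a, ?_, fun i hi e => ?_⟩
      · simp [hI₁b, Nat.succ_mul]
      · rw [sum_range_succ _ b]
        simpa using hI₁c i hi e
  intro s hA hI
  obtain ⟨hIa, hIb, hIc⟩ := hI
  refine Triple.seq' (Triple.storeNat (Triple.seq' (Triple.storeNat (Triple.setVar ?_))))
  have e1 : s.var vTail = s₀.var vTail := by simp [hA.var vTail rfl]
  have e2 : s.var vLevel = s₀.var vLevel := by simp [hA.var vLevel rfl]
  refine ⟨by simp [e1], fun q hq => ?_, ?_, ?_, fun i hi e => ?_⟩
  · simp [e1, hq, hA.narr aTerms rfl, hA.narr aLevel rfl, hIa q hq]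
  · simp [e1, hIb]
  · simp [e1, e2]
  · simpa [e1] using hIc i hi e

/-- Evaluation at the new partial assignment. -/
def testProg : Program :=
  .seq (.storeField fScalar [.const 1] .zero) <|
  .seq (.setVar vL (.var vN)) <|
  .seq (forLoop vi (.var vLevel) (.var vC) <| forLoop vm (.const 0) (.var vTerms) <|
    .seq prefixProg <|
    .storeField fScalar [.const 1] (.add (.load fScalar [.const 1])
      (.mul (.load fLam [.var vHead, .var vm]) (.load fVec [.var vL, .const 0])))) <|
  .branch (.isZero (.load fScalar [.const 1])) .skip (.setVar vOk (.const 0))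

/-- Assignments that are still partial may be tested as well: a free variable has the value `0`, and
truncated subtraction turns it into the exponent `0`. The tested value is therefore always a
coefficient of the node. -/
theorem testProg_spec {n w c B : ℕ} {C : List ℕ → F} {o : List ℕ → ℕ}
    (hI : IsInput n w c C o) (s₀ : State F) (hC : s₀.farr fCoeff = C) (ho : s₀.narr aOrder = o)
    (hn : s₀.var vN = n) (hc : s₀.var vC = c)
    (hj : s₀.var vLevel < c) (hU : w ≤ s₀.var vU) (hUB : s₀.var vU ≤ B)
    (hnB : n ≤ B) (hcB : c ≤ B) (hNB : s₀.var vTerms ≤ B) :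
    Triple B testProg s₀ fun s =>
      (extract n w c C o (s₀.var vLevel) (s₀.var vTerms) (fun m => s₀.farr fLam [s₀.var vHead, m])
        (fun m x => s₀.narr aPart [s₀.var vHead, m, x])
        (fun x => s₀.narr aSpan [s₀.var vT + 1, s₀.var vNew, x]) = 0 → s.var vOk = s₀.var vOk) ∧
      (extract n w c C o (s₀.var vLevel) (s₀.var vTerms) (fun m => s₀.farr fLam [s₀.var vHead, m])
        (fun m x => s₀.narr aPart [s₀.var vHead, m, x])
        (fun x => s₀.narr aSpan [s₀.var vT + 1, s₀.var vNew, x]) ≠ 0 → s.var vOk = 0) := by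
  refine Triple.seq' (Triple.storeField (Triple.seq' (Triple.setVar ?_)))
  set f : ℕ → ℕ → F := fun i m => s₀.farr fLam [s₀.var vHead, m] * prefixVec C o w i
    (override (fun x => s₀.narr aPart [s₀.var vHead, m, x])
      (fun x => s₀.narr aSpan [s₀.var vT + 1, s₀.var vNew, x])) n 0 with hf
  have hex : extract n w c C o (s₀.var vLevel) (s₀.var vTerms)
      (fun m => s₀.farr fLam [s₀.var vHead, m]) (fun m x => s₀.narr aPart [s₀.var vHead, m, x])
      (fun x => s₀.narr aSpan [s₀.var vT + 1, s₀.var vNew, x]) =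
      ∑ i ∈ Ico (s₀.var vLevel) c, ∑ m ∈ range (s₀.var vTerms), f i m := rfl
  rw [hex]
  have hwpos := hI.w_pos
  refine Triple.seq (R := fun s => s.farr fScalar [1] =
    ∑ i ∈ Ico (s₀.var vLevel) c, ∑ m ∈ range (s₀.var vTerms), f i m) ?_ ?_
  · refine Triple.forLoop (fun i s => s.farr fScalar [1] =
      ∑ i ∈ Ico (s₀.var vLevel) i, ∑ m ∈ range (s₀.var vTerms), f i m) (s₀.var vLevel) c
      (by simp) hj.le (by omega) rfl (fun s hA => by simp [hA.var vC rfl, hc]) (by simp) ?_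
      (fun s _ h => h)
    intro i s hli hi hA hv hIi
    refine Triple.forLoop (fun m s => s.farr fScalar [1] =
      ∑ i ∈ Ico (s₀.var vLevel) i, ∑ m ∈ range (s₀.var vTerms), f i m + ∑ m ∈ range m, f i m)
      0 (s₀.var vTerms) rfl (Nat.zero_le _) (by omega) rfl
      (fun s' hA' => by simp [hA'.var vTerms rfl, hA.var vTerms rfl]) (by simpa using hIi) ?_ ?_
    · intro m s₁ _ hm hA₁ hv₁ hI₁
      have e1 : s₁.var vi = i := by rw [hA₁.var vi rfl, hv]
      have e2 : s₁.var vL = n := by simp [hA₁.var vL rfl, hA.var vL rfl, hn]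
      have e3 : s₁.var vU = s₀.var vU := by simp [hA₁.var vU rfl, hA.var vU rfl]
      have e4 : s₁.var vHead = s₀.var vHead := by simp [hA₁.var vHead rfl, hA.var vHead rfl]
      have e5 : s₁.var vT = s₀.var vT := by simp [hA₁.var vT rfl, hA.var vT rfl]
      have e6 : s₁.var vNew = s₀.var vNew := by simp [hA₁.var vNew rfl, hA.var vNew rfl]
      have e7 : s₁.narr aPart = s₀.narr aPart := (hA₁.narr aPart rfl).trans (hA.narr aPart rfl)
      have e8 : s₁.narr aSpan = s₀.narr aSpan := (hA₁.narr aSpan rfl).trans (hA.narr aSpan rfl)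
      have e9 : s₁.farr fCoeff = C := by
        rw [hA₁.farr fCoeff rfl, hA.farr fCoeff rfl, ← hC]
        funext is
        simp
      have e10 : s₁.narr aOrder = o := by
        rw [hA₁.narr aOrder rfl, hA.narr aOrder rfl, ← ho]
        rfl
      refine Triple.seq (prefixProg_spec hI s₁ e9 e10 (by rw [e1]; exact hi)
        (by rw [e3]; exact hU) (by rw [e3]; exact hUB) (by rw [e2]; exact hnB)) ?_
      intro s₂ hA₂ h₂
      have h₃ := h₂ 0 (by omega)
      rw [e1, e2, e4, e5, e6, e7, e8, hv₁] at h₃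
      refine Triple.storeField ?_
      have l1 : s₂.farr fLam = s₀.farr fLam := by
        rw [hA₂.farr fLam rfl, hA₁.farr fLam rfl, hA.farr fLam rfl]
        funext is
        simp
      have l2 : s₂.farr fScalar = s₁.farr fScalar := hA₂.farr fScalar rfl
      have l3 : s₂.var vHead = s₀.var vHead := by rw [hA₂.var vHead rfl, e4]
      have l4 : s₂.var vm = m := by rw [hA₂.var vm rfl, hv₁]
      have l5 : s₂.var vL = n := by rw [hA₂.var vL rfl, e2]
      simp [sum_range_succ, l1, l2, l3, l4, l5, h₃, hI₁, hf, add_assoc]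
    · intro s₁ hA₁ hI₁
      simpa [Finset.sum_Ico_succ_top hli] using hI₁
  intro s hA h
  have e1 : s.var vOk = s₀.var vOk := by simp [hA.var vOk rfl]
  refine Triple.branch (fun hb => Triple.skip ?_) (fun hb => Triple.setVar ?_)
  · simp [h] at hb
    simp [hb, e1]
  · simp [h] at hb
    simp [hb]

end PIT

/-! ### Invariants for the treatment of a node -/

namespace PIT

open Finset

variable {F : Type*} [Field F]

/-- Extension of element `r` of layer `t` by the value `k`, and reduction of its vector. -/
def extendProg : Program :=
  .seq assignProg <| .seq vectorProg <| .seq reduceProg <| .seq searchProg storeProg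

/-- The treatment of the extension of element `r` of layer `t` by the value `k`. -/
def candidateProg : Program :=
  .seq extendProg <| .seq testProg <|
  .branch (.le (.var vFound) (.const 0)) childProg (.setVar vNew (.succ (.var vNew)))

/-- The polynomial of the node `q`, as a function of the exponents. -/
def State.node (n w c : ℕ) (C : List ℕ → F) (o : List ℕ → ℕ) (s : State F) (q : ℕ) :
    (ℕ → ℕ) → F :=
  extract n w c C o (s.narr aLevel [q]) (s.narr aTerms [q]) (fun m => s.farr fLam [q, m])
    (fun m x => s.narr aPart [q, m, x])

/-- The polynomial of the current node, as a function of the exponents. -/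
def State.current (n w c : ℕ) (C : List ℕ → F) (o : List ℕ → ℕ) (s : State F) : (ℕ → ℕ) → F :=
  extract n w c C o (s.var vLevel) (s.var vTerms) (fun m => s.farr fLam [s.var vHead, m])
    (fun m x => s.narr aPart [s.var vHead, m, x])

/-- The assignment `e` encodes exponents between `0` and `d`. -/
def Valid (n d : ℕ) (e : ℕ → ℕ) : Prop := ∀ x < n, 1 ≤ e x ∧ e x ≤ d + 1

/-- No test failed, and the nodes generated after the state `s₀` vanish. -/
def Good (n d w c : ℕ) (C : List ℕ → F) (o : List ℕ → ℕ) (s₀ s : State F) : Prop :=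
  s.var vOk = 1 ∧ ∀ q, s₀.var vTail ≤ q → q < s.var vTail → ∀ e, Valid n d e →
    s.node n w c C o q e = 0

/-- The variables that describe the input and the current node. -/
structure NodeStart (n d w c : ℕ) (C : List ℕ → F) (o : List ℕ → ℕ) (s : State F) : Prop where
  n_eq : s.var vN = n
  d_eq : s.var vD = d
  c_eq : s.var vC = c
  C_eq : s.farr fCoeff = C
  o_eq : s.narr aOrder = o
  U_eq : s.var vU = s.var vTerms * w + 1
  level_lt : s.var vLevel < c
  terms_pos : 1 ≤ s.var vTerms
  head_lt : s.var vHead < s.var vTail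

/-- What remains true while the current node, set up in the state `s₀`, is processed. -/
structure NodeInv (n d w c : ℕ) (C : List ℕ → F) (o : List ℕ → ℕ) (s₀ s : State F) : Prop where
  n_eq : s.var vN = n
  d_eq : s.var vD = d
  c_eq : s.var vC = c
  C_eq : s.farr fCoeff = C
  o_eq : s.narr aOrder = o
  head_eq : s.var vHead = s₀.var vHead
  level_eq : s.var vLevel = s₀.var vLevel
  terms_eq : s.var vTerms = s₀.var vTerms
  U_eq : s.var vU = s₀.var vTerms * w + 1
  tail_le : s₀.var vTail ≤ s.var vTail
  old : ∀ q < s₀.var vTail, s.narr aTerms [q] = s₀.narr aTerms [q] ∧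
    s.narr aLevel [q] = s₀.narr aLevel [q] ∧ (∀ m, s.farr fLam [q, m] = s₀.farr fLam [q, m]) ∧
    (∀ m x, s.narr aPart [q, m, x] = s₀.narr aPart [q, m, x])
  ok : s.var vOk = s₀.var vOk ∨ s.var vOk = 0
  new : ∀ q, s₀.var vTail ≤ q → q < s.var vTail → s.narr aLevel [q] = s₀.var vLevel + 1 ∧
    1 ≤ s.narr aTerms [q] ∧ s.narr aTerms [q] ≤ (s₀.var vTerms * w + 1) * s₀.var vTerms
  -- Soundness needs no degree bound and speaks of all `e`, whereas completeness is claimed for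
  -- valid `e` only.
  sound : (∀ e, s₀.current n w c C o e = 0) → s.var vOk = s₀.var vOk ∧
    ∀ q, s₀.var vTail ≤ q → q < s.var vTail → ∀ e, s.node n w c C o q e = 0

/-- What remains true while the elements of layer `t + 1` are generated, if the extensions `r`, `k`
with `X r k` have been treated. -/
structure LayerInv (n d w c : ℕ) (C : List ℕ → F) (o : List ℕ → ℕ) (s₀ : State F) (t : ℕ)
    (X : ℕ → ℕ → Prop) (s : State F) : Prop where
  fixes : ∀ b < s.var vNew,
    FixesBefore n o (s₀.var vLevel) (t + 1) (fun x => s.narr aSpan [t + 1, b, x])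
  echelon : Echelon (s₀.var vTerms) (s₀.var vTerms * w + 1) (s.var vNew)
    (fun r m u => s.farr fRho [r, m, u]) (fun r => s.narr aPivot [r, 0])
    (fun r => s.narr aPivot [r, 1]) (fun b m u => prefixVec C o w (s₀.var vLevel)
      (override (fun x => s₀.narr aPart [s₀.var vHead, m, x])
        (fun x => s.narr aSpan [t + 1, b, x])) (t + 1) u)
  test : s.var vOk = 1 → ∀ b < s.var vNew,
    s₀.current n w c C o (fun x => s.narr aSpan [t + 1, b, x]) = 0
  -- The children are assumed to vanish although they are treated only later. The assumption is
  -- passed on to the invariant of the main loop and is void once the queue is empty.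
  cover : Good n d w c C o s₀ s → ∀ e, Valid n d e →
    (∀ b < s.var vNew,
      s₀.current n w c C o (override (fun x => s.narr aSpan [t + 1, b, x]) e) = 0) →
    ∀ r k, X r k → s₀.current n w c C o (override
      (Function.update (fun x => s.narr aSpan [t, r, x]) (o [s₀.var vLevel, t]) k) e) = 0

/-- The properties of the `R` elements of layer `t`. -/
structure SpanInv (n d w c : ℕ) (C : List ℕ → F) (o : List ℕ → ℕ) (s₀ : State F) (t R : ℕ)
    (s : State F) : Prop where
  le : R ≤ s₀.var vTerms * w + 1
  fixes : ∀ b < R, FixesBefore n o (s₀.var vLevel) t (fun x => s.narr aSpan [t, b, x])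
  test : s.var vOk = 1 → 0 < t → ∀ b < R,
    s₀.current n w c C o (fun x => s.narr aSpan [t, b, x]) = 0
  cover : Good n d w c C o s₀ s → ∀ e, Valid n d e →
    (∀ b < R, s₀.current n w c C o (override (fun x => s.narr aSpan [t, b, x]) e) = 0) →
    s₀.current n w c C o e = 0

variable {n d w c : ℕ} {C : List ℕ → F} {o : List ℕ → ℕ} {s₀ s s' : State F}

/-- A frame rule: for concrete programs the three conditions on the written locations are decidable.
-/
theorem NodeInv.congr (h : NodeInv n d w c C o s₀ s) {P : Program} (hA : Agree P s s')
    (hv : ∀ y ∈ [vN, vD, vC, vHead, vTail, vOk, vLevel, vTerms, vU], P.writesVar y = false)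
    (hn : ∀ y ∈ [aOrder, aLevel, aTerms, aPart], P.writesNat y = false)
    (hf : ∀ y ∈ [fCoeff, fLam], P.writesField y = false) : NodeInv n d w c C o s₀ s' := by
  have v := fun y hy => hA.var y (hv y hy)
  have a := fun y hy => hA.narr y (hn y hy)
  have f := fun y hy => hA.farr y (hf y hy)
  simp only [List.mem_cons, List.not_mem_nil, or_false, forall_eq_or_imp, forall_eq] at v a f
  obtain ⟨v1, v2, v3, v4, v5, v6, v7, v8, v9⟩ := v
  obtain ⟨a1, a2, a3, a4⟩ := a
  obtain ⟨f1, f2⟩ := f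
  constructor
  · rw [v1, h.n_eq]
  · rw [v2, h.d_eq]
  · rw [v3, h.c_eq]
  · rw [f1, h.C_eq]
  · rw [a1, h.o_eq]
  · rw [v4, h.head_eq]
  · rw [v7, h.level_eq]
  · rw [v8, h.terms_eq]
  · rw [v9, h.U_eq]
  · rw [v5]; exact h.tail_le
  · rw [a2, a3, a4, f2]; exact h.old
  · rw [v6]; exact h.ok
  · rw [v5, a2, a3]; exact h.new
  · simp only [State.node, v5, v6, a2, a3, a4, f2]
    exact h.sound

theorem node_congr {q q' : ℕ} (h1 : s'.narr aTerms [q'] = s.narr aTerms [q])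
    (h2 : s'.narr aLevel [q'] = s.narr aLevel [q])
    (h3 : ∀ m, s'.farr fLam [q', m] = s.farr fLam [q, m])
    (h4 : ∀ m x, s'.narr aPart [q', m, x] = s.narr aPart [q, m, x]) :
    s'.node n w c C o q' = s.node n w c C o q := by
  simp only [State.node, h1, h2, h3, h4]

end PIT

/-! ### Generation and reduction of a candidate -/

namespace PIT

open Finset

variable {F : Type*} [Field F]
variable {n d w c : ℕ} {C : List ℕ → F} {o : List ℕ → ℕ} {s₀ s s' : State F}

/-- Row `vNew` of `fRho` receives the reduced vector whether or not it is zero; the last clause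
separates the dependent case from the independent one. -/
theorem extendProg_spec {B t : ℕ} {X : ℕ → ℕ → Prop} (hI : IsInput n w c C o)
    (hS : NodeStart n d w c C o s₀) (hN : NodeInv n d w c C o s₀ s)
    (hL : LayerInv n d w c C o s₀ t X s) (ht : s.var vT = t) (htn : t < n)
    (hnB : n ≤ B) (hUB : s₀.var vTerms * w + 1 ≤ B) :
    Triple B extendProg s fun s' => NodeInv n d w c C o s₀ s' ∧
      (∀ x < n, s'.narr aSpan [t + 1, s.var vNew, x] =
        Function.update (fun x => s.narr aSpan [t, s.var vr, x]) (o [s₀.var vLevel, t])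
          (s.var vK) x) ∧
      (∀ t' b x, ¬ (t' = t + 1 ∧ b = s.var vNew) →
        s'.narr aSpan [t', b, x] = s.narr aSpan [t', b, x]) ∧
      Echelon (s₀.var vTerms) (s₀.var vTerms * w + 1) (s.var vNew)
        (fun r m u => s'.farr fRho [r, m, u]) (fun r => s'.narr aPivot [r, 0])
        (fun r => s'.narr aPivot [r, 1]) (fun b m u => prefixVec C o w (s₀.var vLevel)
          (override (fun x => s₀.narr aPart [s₀.var vHead, m, x])
            (fun x => s'.narr aSpan [t + 1, b, x])) (t + 1) u) ∧
      Reduced (s₀.var vTerms) (s₀.var vTerms * w + 1) (s.var vNew) (s.var vNew)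
        (fun r => s'.narr aPivot [r, 0]) (fun r => s'.narr aPivot [r, 1])
        (fun b m u => prefixVec C o w (s₀.var vLevel)
          (override (fun x => s₀.narr aPart [s₀.var vHead, m, x])
            (fun x => s'.narr aSpan [t + 1, b, x])) (t + 1) u)
        (fun m u => s'.farr fRho [s.var vNew, m, u]) ∧
      (∀ m ≤ s₀.var vTerms, ∀ u < s₀.var vTerms * w + 1,
        s'.farr fY [m, u] = s'.farr fRho [s.var vNew, m, u]) ∧
      ((s'.var vFound = 0 ∧ ∀ m < s₀.var vTerms, ∀ u < s₀.var vTerms * w + 1,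
          s'.farr fY [m, u] = 0) ∨
        (s'.var vFound = 1 ∧ s'.narr aPivot [s.var vNew, 0] < s₀.var vTerms ∧
          s'.narr aPivot [s.var vNew, 1] < s₀.var vTerms * w + 1 ∧
          s'.farr fY [s'.narr aPivot [s.var vNew, 0], s'.narr aPivot [s.var vNew, 1]] ≠ 0)) := by
  have hR : s.var vNew ≤ s₀.var vTerms * w := hL.echelon.le fun b _ m _ u hu =>
    hI.prefixVec_eq_zero hS.level_lt _ _ _ hu
  have hwU : w ≤ s₀.var vTerms * w + 1 := by
    have := Nat.le_mul_of_pos_left w hS.terms_pos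
    omega
  have hNU : s₀.var vTerms + 1 ≤ B := by
    have := Nat.le_mul_of_pos_right (s₀.var vTerms) hI.w_pos
    omega
  refine Triple.seq (assignProg_spec s (by rw [hN.n_eq]; exact hnB)) ?_
  intro s₁ hA₁ h₁
  have hN₁ := hN.congr hA₁ (by decide) (by decide) (by decide)
  have e1 : s₁.var vNew = s.var vNew := hA₁.var vNew rfl
  rw [ht, hN.n_eq, hN.level_eq, hN.o_eq] at h₁
  obtain ⟨h₁a, h₁b⟩ := h₁
  set v : ℕ → ℕ → ℕ → F := fun b m u => prefixVec C o w (s₀.var vLevel)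
    (override (fun x => s₀.narr aPart [s₀.var vHead, m, x])
      (fun x => s₁.narr aSpan [t + 1, b, x])) (t + 1) u with hv
  have hpart : ∀ m x, s₁.narr aPart [s₀.var vHead, m, x] = s₀.narr aPart [s₀.var vHead, m, x] :=
    (hN₁.old _ hS.head_lt).2.2.2
  refine Triple.seq (vectorProg_spec hI s₁ hN₁.C_eq hN₁.o_eq
    (by rw [hN₁.level_eq]; exact hS.level_lt)
    (by rw [hN₁.U_eq]; exact hwU) (by rw [hN₁.U_eq]; exact hUB)
    (by rw [hA₁.var vT rfl, ht]; omega) (by rw [hN₁.terms_eq]; omega)) ?_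
  intro s₂ hA₂ h₂
  have hN₂ := hN₁.congr hA₂ (by decide) (by decide) (by decide)
  rw [hN₁.terms_eq, hN₁.U_eq, hN₁.level_eq, hN₁.head_eq, hA₁.var vT rfl, ht, e1] at h₂
  simp only [hpart] at h₂
  obtain ⟨h₂a, h₂b⟩ := h₂
  have e2 : s₂.var vNew = s.var vNew := (hA₂.var vNew rfl).trans e1
  have hE₂ : Echelon (s₀.var vTerms) (s₀.var vTerms * w + 1) (s.var vNew)
      (fun r m u => s₂.farr fRho [r, m, u]) (fun r => s₂.narr aPivot [r, 0])
      (fun r => s₂.narr aPivot [r, 1]) v := by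
    refine hL.echelon.congr (by omega) (fun r _ m _ u _ => ?_) (fun r _ => ?_) (fun r _ => ?_)
      (fun b hb m _ u _ => ?_)
    · rw [hA₂.farr fRho rfl, hA₁.farr fRho rfl]
    · rw [hA₂.narr aPivot rfl, hA₁.narr aPivot rfl]
    · rw [hA₂.narr aPivot rfl, hA₁.narr aPivot rfl]
    · have : ∀ x, s₁.narr aSpan [t + 1, b, x] = s.narr aSpan [t + 1, b, x] :=
        fun x => h₁b _ _ x (by omega)
      simp only [hv, this]
  -- Before any reduction the vector is itself, expressed by a unit vector of coefficients.
  have hR₂ : Reduced (s₀.var vTerms) (s₀.var vTerms * w + 1) (s.var vNew) 0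
      (fun r => s₂.narr aPivot [r, 0]) (fun r => s₂.narr aPivot [r, 1]) v
      (fun m u => s₂.farr fY [m, u]) := by
    refine ⟨fun m hm u hu => ?_, fun b hb hbU => ?_, ?_, by simp⟩
    · rw [h₂a m hm u hu, Finset.sum_eq_single (s.var vNew)]
      · rw [h₂b _ (by omega), if_pos rfl, one_mul]
      · intro b hb hne
        rw [h₂b _ (by have := mem_range.1 hb; omega), if_neg hne, zero_mul]
      · simp
    · rw [h₂b _ hbU, if_neg (by omega)]
    · rw [h₂b _ (by omega), if_pos rfl]
  refine Triple.seq (reduceProg_spec (v := v) s₂ (by rw [hN₂.terms_eq]; exact hNU)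
    (by rw [hN₂.U_eq]; exact hUB) (by rw [hN₂.U_eq, e2]; omega)
    (by rw [hN₂.terms_eq, hN₂.U_eq, e2]; exact hE₂)
    (by rw [hN₂.terms_eq, hN₂.U_eq, e2]; exact hR₂)) ?_
  intro s₃ hA₃ h₃
  rw [hN₂.terms_eq, hN₂.U_eq, e2] at h₃
  have hN₃ := hN₂.congr hA₃ (by decide) (by decide) (by decide)
  have e3 : s₃.var vNew = s.var vNew := (hA₃.var vNew rfl).trans e2
  refine Triple.seq (searchProg_spec s₃ (by rw [hN₃.terms_eq]; omega)
    (by rw [hN₃.U_eq]; exact hUB)) ?_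
  intro s₄ hA₄ h₄
  rw [hN₃.terms_eq, hN₃.U_eq, e3] at h₄
  have hN₄ := hN₃.congr hA₄ (by decide) (by decide) (by decide)
  have e4 : s₄.var vNew = s.var vNew := (hA₄.var vNew rfl).trans e3
  refine (storeProg_spec s₄ (by rw [hN₄.terms_eq]; exact hNU)
    (by rw [hN₄.U_eq]; exact hUB)).mono ?_
  intro s₅ hA₅ h₅
  rw [hN₄.terms_eq, hN₄.U_eq, e4] at h₅
  have hN₅ := hN₄.congr hA₅ (by decide) (by decide) (by decide)
  have hspan : s₅.narr aSpan = s₁.narr aSpan := by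
    rw [hA₅.narr aSpan rfl, hA₄.narr aSpan rfl, hA₃.narr aSpan rfl, hA₂.narr aSpan rfl]
  have hY : s₅.farr fY = s₃.farr fY := by rw [hA₅.farr fY rfl, hA₄.farr fY rfl]
  have hpiv : s₅.narr aPivot = s₄.narr aPivot := hA₅.narr aPivot rfl
  have hpivb : ∀ r < s.var vNew, ∀ i, s₄.narr aPivot [r, i] = s₂.narr aPivot [r, i] := by
    intro r hr i
    rw [h₄.1 r i (by omega), hA₃.narr aPivot rfl]
  have hYR : ∀ m ≤ s₀.var vTerms, ∀ u < s₀.var vTerms * w + 1,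
      s₃.farr fY [m, u] = s₅.farr fRho [s.var vNew, m, u] := by
    intro m hm u hu
    rw [h₅.1 m hm u hu, hA₄.farr fY rfl]
  have hE₅ : Echelon (s₀.var vTerms) (s₀.var vTerms * w + 1) (s.var vNew)
      (fun r m u => s₅.farr fRho [r, m, u]) (fun r => s₄.narr aPivot [r, 0])
      (fun r => s₄.narr aPivot [r, 1]) v := by
    refine hE₂.congr (by omega) (fun r hr m _ u _ => ?_) (fun r hr => hpivb r hr 0)
      (fun r hr => hpivb r hr 1) (fun _ _ _ _ _ _ => rfl)
    rw [h₅.2 r m u (by omega), hA₄.farr fRho rfl, hA₃.farr fRho rfl]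
  refine ⟨hN₅, ?_, ?_, ?_, ?_, ?_, ?_⟩
  · rw [hspan]; exact h₁a
  · rw [hspan]; exact h₁b
  · rw [hspan, hpiv]; exact hE₅
  · rw [hspan, hpiv]
    refine ⟨fun m hm u hu => ?_, fun b hb hbU => ?_, ?_, fun r hr => ?_⟩
    · rw [← hYR m hm.le u hu, h₃.lin m hm u hu]
      refine Finset.sum_congr rfl fun b hb => ?_
      rw [hYR _ le_rfl b (by have := mem_range.1 hb; omega)]
    · rw [← hYR _ le_rfl b hbU, h₃.tri b hb hbU]
    · rw [← hYR _ le_rfl _ (by omega), h₃.one]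
    · rw [← hYR _ (hE₅.pm_lt r hr).le _ (hE₅.pu_lt r hr)]
      have := h₃.pivot_zero r hr
      simpa only [hpivb r hr] using this
  · rw [hY]; exact hYR
  · rw [hY, hpiv, hA₅.var vFound rfl]; exact h₄.2

end PIT

/-! ### Correctness for a single candidate -/

namespace PIT

open Finset

variable {F : Type*} [Field F]
variable {n d w c : ℕ} {C : List ℕ → F} {o : List ℕ → ℕ} {s₀ s s' : State F}

theorem NodeInv.current_eq (hS : NodeStart n d w c C o s₀) (hN : NodeInv n d w c C o s₀ s) :
    s.current n w c C o = s₀.current n w c C o := by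
  have := hN.old _ hS.head_lt
  simp only [State.current, hN.level_eq, hN.terms_eq, hN.head_eq, this]

/-- Here `vOk` may change, but only if some value of the current node is nonzero, and then soundness
holds vacuously. -/
theorem NodeInv.test (hN : NodeInv n d w c C o s₀ s) {P : Program} (hA : Agree P s s')
    (hv : ∀ y ∈ [vN, vD, vC, vHead, vTail, vLevel, vTerms, vU], P.writesVar y = false)
    (hn : ∀ y ∈ [aOrder, aLevel, aTerms, aPart], P.writesNat y = false)
    (hf : ∀ y ∈ [fCoeff, fLam], P.writesField y = false) {g : ℕ → ℕ}
    (h0 : s₀.current n w c C o g = 0 → s'.var vOk = s.var vOk)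
    (h1 : s₀.current n w c C o g ≠ 0 → s'.var vOk = 0) : NodeInv n d w c C o s₀ s' := by
  have v := fun y hy => hA.var y (hv y hy)
  have a := fun y hy => hA.narr y (hn y hy)
  have f := fun y hy => hA.farr y (hf y hy)
  simp only [List.mem_cons, List.not_mem_nil, or_false, forall_eq_or_imp, forall_eq] at v a f
  obtain ⟨v1, v2, v3, v4, v5, v7, v8, v9⟩ := v
  obtain ⟨a1, a2, a3, a4⟩ := a
  obtain ⟨f1, f2⟩ := f
  constructor
  · rw [v1, hN.n_eq]
  · rw [v2, hN.d_eq]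
  · rw [v3, hN.c_eq]
  · rw [f1, hN.C_eq]
  · rw [a1, hN.o_eq]
  · rw [v4, hN.head_eq]
  · rw [v7, hN.level_eq]
  · rw [v8, hN.terms_eq]
  · rw [v9, hN.U_eq]
  · rw [v5]; exact hN.tail_le
  · rw [a2, a3, a4, f2]; exact hN.old
  · by_cases h : s₀.current n w c C o g = 0
    · rw [h0 h]; exact hN.ok
    · exact Or.inr (h1 h)
  · rw [v5, a2, a3]; exact hN.new
  · simp only [State.node, v5, a2, a3, a4, f2]
    intro hz
    rw [h0 (hz _)]
    exact hN.sound hz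

/-- The heart of the test. An independent candidate joins the set and covers itself; a dependent one
is covered by the set together with the child node that it generates. At most one node arises per
candidate. -/
theorem candidateProg_spec {B t : ℕ} {X : ℕ → ℕ → Prop} (hI : IsInput n w c C o)
    (hS : NodeStart n d w c C o s₀) (hN : NodeInv n d w c C o s₀ s)
    (hL : LayerInv n d w c C o s₀ t X s) (ht : s.var vT = t) (htn : t < n)
    (hfix : FixesBefore n o (s₀.var vLevel) t (fun x => s.narr aSpan [t, s.var vr, x]))
    (hk : s.var vK ≠ 0)
    (hnB : n ≤ B) (hcB : c ≤ B) (hUB : s₀.var vTerms * w + 1 ≤ B) :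
    Triple B candidateProg s fun s' => NodeInv n d w c C o s₀ s' ∧
      LayerInv n d w c C o s₀ t (fun r k => X r k ∨ (r = s.var vr ∧ k = s.var vK)) s' ∧
      s'.var vTail ≤ s.var vTail + 1 ∧ (Good n d w c C o s₀ s' → Good n d w c C o s₀ s) ∧
      (s'.var vOk = 1 → s.var vOk = 1) ∧
      (∀ b x, s'.narr aSpan [t, b, x] = s.narr aSpan [t, b, x]) := by
  have hwU : w ≤ s₀.var vTerms * w + 1 := by
    have := Nat.le_mul_of_pos_left w hS.terms_pos
    omega
  have hNU : s₀.var vTerms ≤ B := by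
    have := Nat.le_mul_of_pos_right (s₀.var vTerms) hI.w_pos
    omega
  have hR : s.var vNew ≤ s₀.var vTerms * w := hL.echelon.le fun b _ m _ u hu =>
    hI.prefixVec_eq_zero hS.level_lt _ _ _ hu
  refine Triple.seq (extendProg_spec hI hS hN hL ht htn hnB hUB) ?_
  rintro s₁ hA₁ ⟨hN₁, hcand, hspan, hE, hRed, hY, hfound⟩
  set p : ℕ → ℕ := Function.update (fun x => s.narr aSpan [t, s.var vr, x])
    (o [s₀.var vLevel, t]) (s.var vK) with hp
  have hpfix : FixesBefore n o (s₀.var vLevel) (t + 1) p := hfix.update hI hS.level_lt htn hk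
  have hfix₁ : ∀ b < s.var vNew + 1, FixesBefore n o (s₀.var vLevel) (t + 1)
      (fun x => s₁.narr aSpan [t + 1, b, x]) := by
    intro b hb
    rcases Nat.lt_succ_iff_lt_or_eq.1 hb with h | rfl
    · simpa only [fun x => hspan (t + 1) b x (by omega)] using hL.fixes b h
    · intro l hl
      rw [← hpfix l hl]
      simp only [hcand _ (hI.order_lt _ hS.level_lt _ hl)]
  have hcur : ∀ e, s₀.current n w c C o
      (override (fun x => s₁.narr aSpan [t + 1, s.var vNew, x]) e) =
      s₀.current n w c C o (override p e) := fun e =>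
    hI.extract_congr fun x hx => by simp only [override, hcand x hx]
  have e1 : s₁.var vNew = s.var vNew := hA₁.var vNew rfl
  have e2 : s₁.var vT = t := (hA₁.var vT rfl).trans ht
  refine Triple.seq (testProg_spec hI s₁ hN₁.C_eq hN₁.o_eq hN₁.n_eq hN₁.c_eq
    (by rw [hN₁.level_eq]; exact hS.level_lt) (by rw [hN₁.U_eq]; exact hwU)
    (by rw [hN₁.U_eq]; exact hUB) hnB hcB (by rw [hN₁.terms_eq]; exact hNU)) ?_
  intro s₂ hA₂ htest
  change (s₁.current n w c C o _ = 0 → _) ∧ (s₁.current n w c C o _ ≠ 0 → _) at htest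
  rw [hN₁.current_eq hS, e1, e2] at htest
  have hN₂ := hN₁.test hA₂ (by decide) (by decide) (by decide) htest.1 htest.2
  have e3 : s₂.var vNew = s.var vNew := (hA₂.var vNew rfl).trans e1
  have e4 : s₂.var vT = t := (hA₂.var vT rfl).trans e2
  have hok : s₂.var vOk = 1 → s.var vOk = 1 ∧
      s₀.current n w c C o (fun x => s₁.narr aSpan [t + 1, s.var vNew, x]) = 0 := by
    intro h
    by_cases hz : s₀.current n w c C o (fun x => s₁.narr aSpan [t + 1, s.var vNew, x]) = 0
    · rw [htest.1 hz, hA₁.var vOk rfl] at h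
      exact ⟨h, hz⟩
    · rw [htest.2 hz] at h
      exact absurd h (by decide)
  have htail₂ : s₂.var vTail = s.var vTail := (hA₂.var vTail rfl).trans (hA₁.var vTail rfl)
  have hnode₂ : s₂.node n w c C o = s.node n w c C o := by
    funext q
    refine node_congr ?_ ?_ (fun m => ?_) (fun m x => ?_)
    · rw [hA₂.narr aTerms rfl, hA₁.narr aTerms rfl]
    · rw [hA₂.narr aLevel rfl, hA₁.narr aLevel rfl]
    · rw [hA₂.farr fLam rfl, hA₁.farr fLam rfl]
    · rw [hA₂.narr aPart rfl, hA₁.narr aPart rfl]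
  have hspan₂ : s₂.narr aSpan = s₁.narr aSpan := hA₂.narr aSpan rfl
  have hspanb : ∀ b < s.var vNew, ∀ x, s₁.narr aSpan [t + 1, b, x] = s.narr aSpan [t + 1, b, x] :=
    fun b hb x => hspan _ b x (by omega)
  have hspant : ∀ b x, s₁.narr aSpan [t, b, x] = s.narr aSpan [t, b, x] :=
    fun b x => hspan _ b x (by omega)
  refine Triple.branch (fun hb => ?_) (fun hb => Triple.setVar ?_)
  · have hf : s₂.var vFound = 0 := by simpa using hb
    have hf₁ : s₁.var vFound = 0 := (hA₂.var vFound rfl).symm.trans hf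
    have hzero : ∀ m < s₀.var vTerms, ∀ u < s₀.var vTerms * w + 1, s₁.farr fY [m, u] = 0 := by
      rcases hfound with h | h
      · exact h.2
      · exact absurd (hf₁.symm.trans h.1) (by decide)
    refine (childProg_spec hI s₂ hN₂.n_eq hnB (by rw [hN₂.terms_eq]; exact hNU)
      (by rw [e3]; omega) (by
        rw [hN₂.head_eq]; exact lt_of_lt_of_le hS.head_lt hN₂.tail_le)).mono ?_
    rintro s₃ hA₃ ⟨h3tail, h3old, h3terms, h3level, h3sum⟩
    have hlam₂ := (hN₂.old _ hS.head_lt).2.2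
    rw [hN₂.terms_eq, e3] at h3terms
    rw [hN₂.level_eq] at h3level
    -- The child is a combination of extractions from all ROABPs of its parent. The part of ROABP
    -- `j`, which the child no longer contains, cancels by the dependency.
    have hchild : ∀ e, s₃.node n w c C o (s₂.var vTail) e =
        ∑ b ∈ range (s.var vNew + 1), s₁.farr fY [s₀.var vTerms, b] *
          s₀.current n w c C o (override (fun x => s₁.narr aSpan [t + 1, b, x]) e) := by
      intro e
      -- All rows below `vTerms` were reduced to zero, so the coefficient row is a linear
      -- dependency.
      have hdep := sum_mul_extract_eq_zero (C := C) (N := s₀.var vTerms) (K := s.var vNew + 1)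
        (lam := fun m => s₀.farr fLam [s₀.var vHead, m])
        (p := fun m x => s₀.narr aPart [s₀.var vHead, m, x])
        (a := fun b x => s₁.narr aSpan [t + 1, b, x])
        (μ := fun b => s₁.farr fY [s₀.var vTerms, b]) hI.w_pos htn hfix₁ (by
          intro m hm u hu
          rw [← hzero m hm u (by omega), hY m hm.le u (by omega), hRed.lin m hm u (by omega)]
          refine Finset.sum_congr rfl fun b hb => ?_
          rw [hY _ le_rfl b (by have := mem_range.1 hb; omega)]) e
      rw [State.current, sum_mul_extract hS.level_lt hdep, State.node, extract, h3level]
      refine Finset.sum_congr rfl fun i hi => ?_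
      rw [h3sum i (mem_Ico.1 hi).2 e, hN₂.terms_eq, hN₂.head_eq, e3, e4, hspan₂, hA₂.farr fY rfl]
      simp only [hlam₂]
    have hnodeold : ∀ q < s₂.var vTail, s₃.node n w c C o q = s.node n w c C o q := by
      intro q hq
      have := h3old q hq.ne
      rw [node_congr this.1 this.2.1 this.2.2.1 this.2.2.2, hnode₂]
    have hok₃ : s₃.var vOk = s₂.var vOk := hA₃.var vOk rfl
    have e5 : s₃.var vNew = s.var vNew := (hA₃.var vNew rfl).trans e3
    have hspan₃ : s₃.narr aSpan = s₁.narr aSpan := (hA₃.narr aSpan rfl).trans hspan₂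
    have hgood : Good n d w c C o s₀ s₃ → Good n d w c C o s₀ s := by
      rintro ⟨h1, h2⟩
      refine ⟨(hok (by rwa [← hok₃])).1, fun q hq hq' e he => ?_⟩
      rw [← hnodeold q (by rwa [htail₂])]
      exact h2 q hq (by omega) e he
    refine ⟨?_, ⟨?_, ?_, ?_, ?_⟩, by omega, hgood, fun h => (hok (by rwa [← hok₃])).1, ?_⟩
    · constructor
      · rw [hA₃.var vN rfl, hN₂.n_eq]
      · rw [hA₃.var vD rfl, hN₂.d_eq]
      · rw [hA₃.var vC rfl, hN₂.c_eq]
      · rw [hA₃.farr fCoeff rfl, hN₂.C_eq]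
      · rw [hA₃.narr aOrder rfl, hN₂.o_eq]
      · rw [hA₃.var vHead rfl, hN₂.head_eq]
      · rw [hA₃.var vLevel rfl, hN₂.level_eq]
      · rw [hA₃.var vTerms rfl, hN₂.terms_eq]
      · rw [hA₃.var vU rfl, hN₂.U_eq]
      · have := hN₂.tail_le
        omega
      · intro q hq
        have h1 := h3old q (by have := hN₂.tail_le; omega)
        have h2 := hN₂.old q hq
        exact ⟨h1.1.trans h2.1, h1.2.1.trans h2.2.1, fun m => (h1.2.2.1 m).trans (h2.2.2.1 m),
          fun m x => (h1.2.2.2 m x).trans (h2.2.2.2 m x)⟩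
      · rw [hok₃]; exact hN₂.ok
      · intro q hq hq'
        by_cases h : q = s₂.var vTail
        · subst h
          rw [h3level, h3terms]
          refine ⟨rfl, Nat.mul_pos (Nat.succ_pos _) hS.terms_pos, ?_⟩
          exact Nat.mul_le_mul_right _ (by omega)
        · have h1 := h3old q h
          rw [h1.1, h1.2.1]
          exact hN₂.new q hq (by omega)
      · intro hz
        refine ⟨hok₃.trans (hN₂.sound hz).1, fun q hq hq' e => ?_⟩
        by_cases h : q = s₂.var vTail
        · subst h
          rw [hchild]
          exact Finset.sum_eq_zero fun b _ => by rw [hz, mul_zero]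
        · rw [hnodeold q (by omega), ← hnode₂]
          exact (hN₂.sound hz).2 q hq (by omega) e
    · rw [e5, hspan₃]
      exact fun b hb => hfix₁ b (by omega)
    · rw [e5, hspan₃, hA₃.farr fRho rfl, hA₃.narr aPivot rfl, hA₂.farr fRho rfl,
        hA₂.narr aPivot rfl]
      exact hE
    · rw [e5, hspan₃, hok₃]
      intro h b hb
      simpa only [hspanb b hb] using hL.test (hok h).1 b hb
    · rw [e5, hspan₃]
      intro hG e he hz r k hrk
      simp only [hspant]
      rcases hrk with h | ⟨rfl, rfl⟩
      · refine hL.cover (hgood hG) e he (fun b hb => ?_) r k h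
        simpa only [hspanb b hb] using hz b hb
      -- In the vanishing combination all terms of the old set are zero and the candidate has
      -- coefficient `1`, hence its term is zero too.
      · have h1 := hG.2 _ hN₂.tail_le (by omega) e he
        rw [hchild, sum_range_succ, Finset.sum_eq_zero, zero_add,
          hY _ le_rfl _ (by omega), hRed.one, one_mul, hcur] at h1
        · exact h1
        · intro b hb
          rw [hz b (mem_range.1 hb), mul_zero]
    · rw [hspan₃]
      exact hspant
  · have hf : s₂.var vFound ≠ 0 := by simpa using hb
    have hf₁ : s₁.var vFound ≠ 0 := by rwa [← hA₂.var vFound rfl]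
    obtain ⟨-, hpm, hpu, hne⟩ := hfound.resolve_left fun h => hf₁ h.1
    have hgood : Good n d w c C o s₀ (s₂.setVar vNew ((NExpr.succ (.var vNew)).eval s₂)) →
        Good n d w c C o s₀ s := by
      rintro ⟨h1, h2⟩
      refine ⟨(hok (by simpa using h1)).1, fun q hq hq' e he => ?_⟩
      have := h2 q hq (by simpa [htail₂] using hq') e he
      rw [← hnode₂]
      exact this
    refine ⟨?_, ⟨?_, ?_, ?_, ?_⟩, ?_, hgood, fun h => (hok (by simpa using h)).1, ?_⟩
    · exact hN₂.congr (Exec.setVar s₂ vNew _).agree (by decide) (by decide) (by decide)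
    · simp only [State.setVar_var, State.setVar_narr, NExpr.eval, if_true, e3, hspan₂]
      exact hfix₁
    · simp only [State.setVar_var, State.setVar_narr, State.setVar_farr, NExpr.eval, if_true, e3,
        hspan₂, hA₂.farr fRho rfl, hA₂.narr aPivot rfl]
      refine hE.succ hRed hpm hpu ?_
      rwa [← hY _ hpm.le _ hpu]
    · simp only [State.setVar_var, State.setVar_narr, NExpr.eval, if_true, e3, hspan₂]
      intro h b hb
      have h' := hok (by simpa using h)
      rcases Nat.lt_succ_iff_lt_or_eq.1 hb with h1 | rfl
      · simpa only [hspanb b h1] using hL.test h'.1 b h1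
      · exact h'.2
    · simp only [State.setVar_var, State.setVar_narr, NExpr.eval, if_true, e3, hspan₂]
      intro hG e he hz r k hrk
      simp only [hspant]
      rcases hrk with h | ⟨rfl, rfl⟩
      · refine hL.cover (hgood hG) e he (fun b hb => ?_) r k h
        simpa only [hspanb b hb] using hz b (by omega)
      -- The candidate now is an element of the set, so the hypothesis on the set applies to it
      -- directly.
      · rw [← hp, ← hcur]
        exact hz _ (by omega)
    · simp [htail₂]
    · simp only [State.setVar_narr, hspan₂]
      exact hspant

end PIT

/-! ### Passage from layer to layer -/

namespace PIT

open Finset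

variable {F : Type*} [Field F]
variable {n d w c : ℕ} {C : List ℕ → F} {o : List ℕ → ℕ} {s₀ s s' : State F}

theorem Good.congr {P : Program} (hA : Agree P s s')
    (hv : ∀ y ∈ [vTail, vOk], P.writesVar y = false)
    (hn : ∀ y ∈ [aLevel, aTerms, aPart], P.writesNat y = false)
    (hf : P.writesField fLam = false) (h : Good n d w c C o s₀ s') : Good n d w c C o s₀ s := by
  have v := fun y hy => hA.var y (hv y hy)
  have a := fun y hy => hA.narr y (hn y hy)
  have f := hA.farr _ hf
  simp only [List.mem_cons, List.not_mem_nil, or_false, forall_eq_or_imp, forall_eq] at v a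
  obtain ⟨v1, v2⟩ := v
  obtain ⟨a1, a2, a3⟩ := a
  simpa only [Good, State.node, v1, v2, a1, a2, a3, f] using h

theorem LayerInv.congr {t : ℕ} {X Y : ℕ → ℕ → Prop} (h : LayerInv n d w c C o s₀ t X s)
    {P : Program} (hA : Agree P s s')
    (hv : ∀ y ∈ [vTail, vOk, vNew], P.writesVar y = false)
    (hn : ∀ y ∈ [aLevel, aTerms, aPart, aSpan, aPivot], P.writesNat y = false)
    (hf : ∀ y ∈ [fLam, fRho], P.writesField y = false) (hXY : ∀ r k, Y r k → X r k) :
    LayerInv n d w c C o s₀ t Y s' := by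
  have v := fun y hy => hA.var y (hv y hy)
  have a := fun y hy => hA.narr y (hn y hy)
  have f := fun y hy => hA.farr y (hf y hy)
  have hG : Good n d w c C o s₀ s' → Good n d w c C o s₀ s :=
    Good.congr hA (fun y hy => hv y (by simp at hy ⊢; omega))
      (fun y hy => hn y (by simp at hy ⊢; omega)) (hf _ (by simp))
  simp only [List.mem_cons, List.not_mem_nil, or_false, forall_eq_or_imp, forall_eq] at v a f
  obtain ⟨v1, v2, v3⟩ := v
  obtain ⟨a1, a2, a3, a4, a5⟩ := a
  obtain ⟨f1, f2⟩ := f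
  constructor
  · rw [v3, a4]; exact h.fixes
  · rw [v3, a4, a5, f2]; exact h.echelon
  · rw [v2, v3, a4]; exact h.test
  · rw [v3, a4]
    exact fun hg e he hz r k hrk => h.cover (hG hg) e he hz r k (hXY r k hrk)

/-- Layer `t` stays covered while nodes are added and tests are run: a later state is good only if
the earlier one was. -/
theorem SpanInv.congr {t R : ℕ} (h : SpanInv n d w c C o s₀ t R s)
    (hG : Good n d w c C o s₀ s' → Good n d w c C o s₀ s)
    (hok : s'.var vOk = 1 → s.var vOk = 1)
    (ha : ∀ b x, s'.narr aSpan [t, b, x] = s.narr aSpan [t, b, x]) :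
    SpanInv n d w c C o s₀ t R s' where
  le := h.le
  fixes b hb := by simpa only [ha] using h.fixes b hb
  test h1 h2 b hb := by simpa only [ha] using h.test (hok h1) h2 b hb
  cover hg e he hz := h.cover (hG hg) e he (by simpa only [ha] using hz)

theorem SpanInv.setVar {t R : ℕ} (h : SpanInv n d w c C o s₀ t R s) (x v : ℕ)
    (hv : ∀ y ∈ [vTail, vOk], (Program.setVar x (.const v)).writesVar y = false) :
    SpanInv n d w c C o s₀ t R (s.setVar x v) := by
  refine h.congr (Good.congr (P := .setVar x (.const v)) (Exec.setVar s x (.const v)).agree hv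
    (by simp [Program.writesNat]) rfl) ?_ (fun _ _ => rfl)
  have := (Exec.setVar s x (.const v)).agree.var vOk (hv _ (by simp))
  simp only [NExpr.eval] at this
  rw [this]
  exact id

/-- The treatment of all extensions of the elements of layer `t`. -/
def layerProg : Program :=
  .seq (.setVar vNew (.const 0)) <|
  .seq (forLoop vr (.const 0) (.var vR) <|
    forLoop vK (.const 1) (.add (.var vD) (.const 2)) candidateProg) <|
  .setVar vR (.var vNew)

theorem layerProg_spec {B t : ℕ} (hI : IsInput n w c C o)
    (hS : NodeStart n d w c C o s₀) (hN : NodeInv n d w c C o s₀ s)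
    (hP : SpanInv n d w c C o s₀ t (s.var vR) s) (ht : s.var vT = t) (htn : t < n)
    (hnB : n ≤ B) (hcB : c ≤ B) (hdB : d + 1 ≤ B) (hUB : s₀.var vTerms * w + 1 ≤ B) :
    Triple B layerProg s fun s' => NodeInv n d w c C o s₀ s' ∧
      SpanInv n d w c C o s₀ (t + 1) (s'.var vR) s' ∧
      s'.var vTail ≤ s.var vTail + (s₀.var vTerms * w + 1) * (d + 1) := by
  refine Triple.seq' (Triple.setVar ?_)
  set R := s.var vR with hR
  -- The pairs `(r, k)` treated so far form a lexicographic initial segment. As `k` starts at `1`,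
  -- the counting inequality carries an additional `1` on the left.
  set I : ℕ → ℕ → State F → Prop := fun r k s' => NodeInv n d w c C o s₀ s' ∧
      SpanInv n d w c C o s₀ t R s' ∧
      LayerInv n d w c C o s₀ t (fun r' k' => 1 ≤ k' ∧ k' ≤ d + 1 ∧
        (r' < r ∨ (r' = r ∧ k' < k))) s' ∧
      s'.var vTail + 1 ≤ s.var vTail + r * (d + 1) + k with hIdef
  have hset : ∀ r k s' x v, I r k s' →
      (∀ y ∈ [vN, vD, vC, vHead, vTail, vOk, vLevel, vTerms, vU, vNew],
        (Program.setVar x (.const v)).writesVar y = false) → I r k (s'.setVar x v) := by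
    rintro r k s' x v ⟨h1, h2, h3, h4⟩ hy
    have hA := (Exec.setVar s' x (.const v)).agree
    refine ⟨h1.congr hA (fun y h => hy y (by simp at h ⊢; omega)) (by simp [Program.writesNat])
      (by simp [Program.writesField]), h2.setVar _ _ (fun y h => hy y (by simp at h ⊢; omega)),
      h3.congr hA (fun y h => hy y (by simp at h ⊢; omega)) (by simp [Program.writesNat])
      (by simp [Program.writesField]) (fun _ _ h => h), ?_⟩
    have := hA.var vTail (hy _ (by simp))
    simp only [NExpr.eval] at this
    omega
  refine Triple.seq (R := fun s' => I R 1 s') ?_ ?_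
  · refine Triple.forLoop (fun r s' => I r 1 s') 0 R rfl (Nat.zero_le _)
      (by have := hP.le; omega) rfl (fun s' hA => by simp [hA.var vR rfl, hR]) ?_ ?_
      (fun s _ h => h)
    · refine hset 0 1 _ vr 0 ⟨?_, hP.setVar _ _ (by simp [Program.writesVar]), ?_, by simp⟩
        (by simp [Program.writesVar])
      · exact hN.congr (Exec.setVar s vNew _).agree (by decide) (by decide) (by decide)
      · refine ⟨by simp, ?_, by simp, fun _ _ _ _ r k h => ?_⟩
        · exact Echelon.zero
        · omega
    · intro r s₁ _ hr hA₁ hv₁ hI₁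
      refine Triple.forLoop (fun k s' => I r k s') 1 (d + 2) rfl (by omega) (by omega) rfl
        (fun s' hA' => ?_) (hset _ _ _ _ _ hI₁ (by simp [Program.writesVar])) ?_ ?_
      · have h1 : s'.var vD = s₁.var vD := hA'.var vD rfl
        have h2 := hI₁.1.d_eq
        simp only [NExpr.eval]
        omega
      · rintro k s₂ hk1 hk2 hA₂ hv₂ ⟨h1, h2, h3, h4⟩
        have hr₂ : s₂.var vr = r := (hA₂.var vr rfl).trans hv₁
        have ht₂ : s₂.var vT = t := by
          rw [hA₂.var vT rfl, hA₁.var vT rfl]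
          simp [ht]
        refine (candidateProg_spec hI hS h1 h3 ht₂ htn (by rw [hr₂]; exact h2.fixes r hr)
          (by omega) hnB hcB hUB).mono ?_
        rintro s₃ hA₃ ⟨g1, g2, g3, g4, g5, g6⟩
        refine hset _ _ _ _ _ ⟨g1, h2.congr g4 g5 g6, ?_, by omega⟩ (by simp [Program.writesVar])
        -- Nothing is executed here; `skip` merely allows the description of the treated pairs to be
        -- rewritten.
        refine g2.congr (P := .skip) (Agree.refl _ _) (by simp [Program.writesVar])
          (by simp [Program.writesNat]) (by simp [Program.writesField]) ?_
        intro r' k' h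
        rw [hr₂, hv₂]
        omega
      · rintro s₂ hA₂ ⟨h1, h2, h3, h4⟩
        refine hset _ _ _ _ _ ⟨h1, h2, ?_, ?_⟩ (by simp [Program.writesVar])
        · refine h3.congr (P := .skip) (Agree.refl _ _) (by simp [Program.writesVar])
            (by simp [Program.writesNat]) (by simp [Program.writesField]) ?_
          intro r' k' h
          omega
        · rw [Nat.succ_mul]
          omega
  rintro s₁ hA₁ ⟨h1, h2, h3, h4⟩
  refine Triple.setVar ⟨?_, ?_, ?_⟩
  · exact h1.congr (Exec.setVar s₁ vR _).agree (by decide) (by decide) (by decide)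
  · refine SpanInv.setVar ?_ _ _ (by simp [Program.writesVar])
    simp only [NExpr.eval, State.setVar_var, if_true]
    have hle := h3.echelon.le fun b _ m _ u hu => hI.prefixVec_eq_zero hS.level_lt _ _ _ hu
    refine ⟨by omega, h3.fixes, fun h _ => h3.test h, fun hg e he hz => ?_⟩
    refine h2.cover hg e he fun r hr => ?_
    have hx := hI.order_lt _ hS.level_lt t htn
    -- Element `r` is extended by the value that `e` prescribes. Validity of `e` guarantees that
    -- this extension was among the candidates.
    have := h3.cover hg e he hz r (e (o [s₀.var vLevel, t])) ⟨(he _ hx).1, (he _ hx).2, by omega⟩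
    rwa [override_update] at this
    have := (h2.fixes r hr t htn).not.2 (by omega)
    simpa using this
  · have := Nat.mul_le_mul_right (d + 1) hP.le
    simp
    omega

/-- The treatment of all layers. -/
def layersProg : Program := forLoop vT (.const 0) (.var vN) layerProg

/-- Layer `0` holds the empty assignment only, so it covers every `e` trivially. In layer `n`
nothing is left free, and the hypothesis of `cover` is just what the tests have verified. -/
theorem layersProg_spec {B : ℕ} (hI : IsInput n w c C o)
    (hS : NodeStart n d w c C o s) (hR : s.var vR = 1) (ha : ∀ x < n, s.narr aSpan [0, 0, x] = 0)
    (hnB : n ≤ B) (hcB : c ≤ B) (hdB : d + 1 ≤ B) (hUB : s.var vTerms * w + 1 ≤ B) :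
    Triple B layersProg s fun s' => NodeInv n d w c C o s s' ∧
      (Good n d w c C o s s' → ∀ e, Valid n d e → s.current n w c C o e = 0) ∧
      s'.var vTail ≤ s.var vTail + n * ((s.var vTerms * w + 1) * (d + 1)) := by
  set I : ℕ → State F → Prop := fun t s' => NodeInv n d w c C o s s' ∧
      SpanInv n d w c C o s t (s'.var vR) s' ∧
      s'.var vTail ≤ s.var vTail + t * ((s.var vTerms * w + 1) * (d + 1)) with hIdef
  have hset : ∀ t s' v, I t s' → I t (s'.setVar vT v) := by
    rintro t s' v ⟨h1, h2, h3⟩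
    refine ⟨h1.congr (Exec.setVar s' vT (.const v)).agree (by simp [Program.writesVar])
      (by simp [Program.writesNat]) (by simp [Program.writesField]),
      h2.setVar _ _ (by simp [Program.writesVar]), by simpa using h3⟩
  refine Triple.forLoop I 0 n rfl (Nat.zero_le _) (by omega) rfl
    (fun s' hA => by simp [hA.var vN rfl, hS.n_eq]) ?_ ?_ ?_
  · refine hset _ _ _ ⟨?_, ?_, by simp⟩
    · exact ⟨hS.n_eq, hS.d_eq, hS.c_eq, hS.C_eq, hS.o_eq, rfl, rfl, rfl, hS.U_eq, le_rfl,
        fun q _ => ⟨rfl, rfl, fun _ => rfl, fun _ _ => rfl⟩, Or.inl rfl,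
        fun q h1 h2 => absurd h1 (by omega), fun _ => ⟨rfl, fun q h1 h2 => absurd h1 (by omega)⟩⟩
    · rw [hR]
      refine ⟨by omega, fun b hb l hl => ?_, fun _ h => absurd h (lt_irrefl _), ?_⟩
      · obtain rfl : b = 0 := by omega
        simp [ha _ (hI.order_lt _ hS.level_lt l hl)]
      · intro _ e _ hz
        rw [← hz 0 (by omega)]
        exact hI.extract_congr fun x hx => by simp [override, ha x hx]
  · rintro t s₁ _ ht hA₁ hv₁ ⟨h1, h2, h3⟩
    refine (layerProg_spec hI hS h1 h2 hv₁ ht hnB hcB hdB hUB).mono ?_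
    rintro s₂ hA₂ ⟨g1, g2, g3⟩
    refine hset _ _ _ ⟨g1, g2, ?_⟩
    rw [Nat.succ_mul]
    omega
  · rintro s' hA ⟨h1, h2, h3⟩
    refine ⟨h1, fun hg e he => h2.cover hg e he fun b hb => ?_, h3⟩
    -- Completing an assignment of the last layer by `e` has no effect. Layer `0` was never tested,
    -- hence the need for `n` to be positive.
    rw [← h2.test hg.1 (by have := hI.n_pos; omega) b hb]
    refine hI.extract_congr fun x hx => ?_
    obtain ⟨l, hl, rfl⟩ := hI.order_surj _ hS.level_lt x hx
    have := (h2.fixes b hb l hl).2 hl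
    simp only at this
    simp [override, this]

end PIT

/-! ### Treatment of a node and the potential of the queue -/

namespace PIT

open Finset

variable {F : Type*} [Field F]
variable {n d w c : ℕ} {C : List ℕ → F} {o : List ℕ → ℕ} {s₀ s s' : State F}

/-- Preparation of the treatment of the layers: the width and the only element of layer `0`. -/
def setupProg : Program :=
  .seq (.setVar vU (.const 1)) <|
  -- Multiplication of natural numbers is not an operation of the machine, so `vTerms * vW` is
  -- summed up.
  .seq (forLoop vm (.const 0) (.var vTerms) (.setVar vU (.add (.var vU) (.var vW)))) <|
  .seq (forLoop vx (.const 0) (.var vN) (.storeNat aSpan [.const 0, .const 0, .var vx] (.const 0)))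
  (.setVar vR (.const 1))

theorem setupProg_spec {B : ℕ} (hNB : s.var vTerms ≤ B) (hnB : s.var vN ≤ B) :
    Triple B setupProg s fun s' => s'.var vU = s.var vTerms * s.var vW + 1 ∧ s'.var vR = 1 ∧
      ∀ x < s.var vN, s'.narr aSpan [0, 0, x] = 0 := by
  refine Triple.seq' (Triple.setVar ?_)
  refine Triple.seq (R := fun s' => s'.var vU = s.var vTerms * s.var vW + 1) ?_ ?_
  · refine Triple.forLoop (fun m s' => s'.var vU = m * s.var vW + 1) 0 (s.var vTerms) rfl
      (Nat.zero_le _) (by omega) rfl (fun s' hA => by simp [hA.var vTerms rfl]) (by simp) ?_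
      (fun _ _ h => h)
    intro m s₁ _ hm hA hv h
    refine Triple.setVar ?_
    simp [h, hA.var vW rfl, Nat.succ_mul]
    omega
  intro s₁ hA₁ h₁
  refine Triple.seq (R := fun s' => ∀ x < s.var vN, s'.narr aSpan [0, 0, x] = 0) ?_ ?_
  · refine Triple.forLoop (fun k s' => ∀ x < k, s'.narr aSpan [0, 0, x] = 0) 0 (s.var vN) rfl
      (Nat.zero_le _) (by omega) rfl (fun s' hA => by simp [hA.var vN rfl, hA₁.var vN rfl])
      (by simp) ?_ (fun _ _ h => h)
    intro k s₂ _ hk hA hv h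
    refine Triple.storeNat fun x hx => ?_
    by_cases hxk : x = k
    · simp [hxk, hv]
    · simp [hxk, hv, h x (by omega)]
  intro s₂ hA₂ h₂
  refine Triple.setVar ⟨?_, by simp, h₂⟩
  simp [hA₂.var vU rfl, h₁]

/-- The treatment of the first pending node. -/
def nodeProg : Program :=
  .seq (.loadNat vLevel aLevel [.var vHead]) <| .seq (.loadNat vTerms aTerms [.var vHead]) <|
  .seq (.branch (.le (.succ (.var vLevel)) (.var vC)) (.seq setupProg layersProg) .skip) <|
  .setVar vHead (.succ (.var vHead))

/-- A bound for the number of nodes generated from a node of level `j`, including this node. -/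
def nodeBound (n d w c j : ℕ) : ℕ := (2 * (n * (d + 1))) ^ (c - j) * (w + 1) ^ (2 ^ c - 2 ^ j)

theorem nodeBound_pos (hn : 1 ≤ n) (j : ℕ) : 1 ≤ nodeBound n d w c j :=
  Nat.mul_pos (Nat.pow_pos (by positivity)) (Nat.pow_pos (by omega))

/-- The factor in front is the number of children of a node of level `j`, with `(w + 1) ^ 2 ^ j` for
`N * w + 1`. The exponents of `w + 1` telescope, and the factor `2` in `nodeBound` pays for the node
itself. -/
theorem nodeBound_succ_le (hn : 1 ≤ n) {j : ℕ} (hj : j < c) :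
    n * ((w + 1) ^ 2 ^ j * (d + 1)) * nodeBound n d w c (j + 1) + 1 ≤ nodeBound n d w c j := by
  have h1 : c - j = (c - (j + 1)) + 1 := by omega
  have h2 : 2 ^ c - 2 ^ j = (2 ^ c - 2 ^ (j + 1)) + 2 ^ j := by
    have : 2 ^ (j + 1) ≤ 2 ^ c := Nat.pow_le_pow_right (by norm_num) hj
    have h3 : 2 ^ (j + 1) = 2 * 2 ^ j := by ring
    omega
  have h4 : nodeBound n d w c j =
      2 * (n * ((w + 1) ^ 2 ^ j * (d + 1)) * nodeBound n d w c (j + 1)) := by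
    simp only [nodeBound]
    rw [h1, h2, pow_succ, pow_add]
    ring
  have h5 : 0 < n * ((w + 1) ^ 2 ^ j * (d + 1)) * nodeBound n d w c (j + 1) :=
    Nat.mul_pos (by positivity) (nodeBound_pos hn _)
  omega

/-- The invariant of the main loop. -/
structure MainInv (n d w c : ℕ) (C : List ℕ → F) (o : List ℕ → ℕ) (s : State F) : Prop where
  n_eq : s.var vN = n
  d_eq : s.var vD = d
  w_eq : s.var vW = w
  c_eq : s.var vC = c
  C_eq : s.farr fCoeff = C
  o_eq : s.narr aOrder = o
  head_le : s.var vHead ≤ s.var vTail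
  ok : s.var vOk = 0 ∨ s.var vOk = 1
  level_le : ∀ q, s.var vHead ≤ q → q < s.var vTail → s.narr aLevel [q] ≤ c
  terms_pos : ∀ q, s.var vHead ≤ q → q < s.var vTail → 1 ≤ s.narr aTerms [q]
  terms_le : ∀ q, s.var vHead ≤ q → q < s.var vTail →
    s.narr aTerms [q] * w + 1 ≤ (w + 1) ^ 2 ^ s.narr aLevel [q]
  sound : (∀ e, ∑ i ∈ Ico 0 c, prefixVec C o w i e n 0 = 0) → s.var vOk = 1 ∧
    ∀ q, s.var vHead ≤ q → q < s.var vTail → ∀ e, s.node n w c C o q e = 0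
  complete : s.var vOk = 1 → (∀ q, s.var vHead ≤ q → q < s.var vTail → ∀ e, Valid n d e →
    s.node n w c C o q e = 0) →
    ∀ e, Valid n d e → ∑ i ∈ Ico 0 c, prefixVec C o w i e n 0 = 0

/-- A bound for the number of nodes that are still to be treated. -/
def pending (n d w c : ℕ) (s : State F) : ℕ :=
  ∑ q ∈ Ico (s.var vHead) (s.var vTail), nodeBound n d w c (s.narr aLevel [q])

/-- The first node is replaced by its children, whose shares of the potential together with `1` do
not exceed its own share. -/
theorem nodeProg_spec {B : ℕ} (hI : IsInput n w c C o) (hM : MainInv n d w c C o s)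
    (hht : s.var vHead < s.var vTail)
    (hnB : n ≤ B) (hcB : c ≤ B) (hdB : d + 1 ≤ B) (hwB : (w + 1) ^ 2 ^ c ≤ B) :
    Triple B nodeProg s fun s' => MainInv n d w c C o s' ∧
      pending n d w c s' + 1 ≤ pending n d w c s := by
  have hpend : pending n d w c s = nodeBound n d w c (s.narr aLevel [s.var vHead]) +
      ∑ q ∈ Ico (s.var vHead + 1) (s.var vTail), nodeBound n d w c (s.narr aLevel [q]) :=
    Finset.sum_eq_sum_Ico_succ_bot hht _
  set j := s.narr aLevel [s.var vHead] with hj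
  set N := s.narr aTerms [s.var vHead] with hN
  have hNle : N * w + 1 ≤ (w + 1) ^ 2 ^ j := hM.terms_le _ le_rfl hht
  have hN1 : 1 ≤ N := hM.terms_pos _ le_rfl hht
  have hjc : j ≤ c := hM.level_le _ le_rfl hht
  have hNB : N * w + 1 ≤ B := hNle.trans <| (Nat.pow_le_pow_right (by omega)
    (Nat.pow_le_pow_right (by norm_num) hjc)).trans hwB
  have hNB' : N ≤ B := by
    have := Nat.le_mul_of_pos_right N hI.w_pos
    omega
  refine Triple.seq' (Triple.loadNat (Triple.seq' (Triple.loadNat ?_)))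
  refine Triple.seq (R := fun s' => s'.var vN = n ∧ s'.var vD = d ∧ s'.var vW = w ∧
    s'.var vC = c ∧ s'.farr fCoeff = C ∧ s'.narr aOrder = o ∧ s'.var vHead = s.var vHead ∧
    s.var vTail ≤ s'.var vTail ∧ (s'.var vOk = s.var vOk ∨ s'.var vOk = 0) ∧
    (∀ q < s.var vTail, s'.narr aLevel [q] = s.narr aLevel [q] ∧
      s'.narr aTerms [q] = s.narr aTerms [q] ∧
      s'.node n w c C o q = s.node n w c C o q) ∧
    (∀ q, s.var vTail ≤ q → q < s'.var vTail → j < c ∧ s'.narr aLevel [q] = j + 1 ∧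
      1 ≤ s'.narr aTerms [q] ∧ s'.narr aTerms [q] ≤ (N * w + 1) * N) ∧
    ((∀ e, s.node n w c C o (s.var vHead) e = 0) → s'.var vOk = s.var vOk ∧
      ∀ q, s.var vTail ≤ q → q < s'.var vTail → ∀ e, s'.node n w c C o q e = 0) ∧
    ((s'.var vOk = 1 ∧ ∀ q, s.var vTail ≤ q → q < s'.var vTail → ∀ e, Valid n d e →
      s'.node n w c C o q e = 0) → ∀ e, Valid n d e → s.node n w c C o (s.var vHead) e = 0) ∧
    s'.var vTail ≤ s.var vTail + n * ((N * w + 1) * (d + 1))) ?_ ?_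
  · refine Triple.branch (fun hb => ?_) (fun hb => Triple.skip ?_)
    · have hlt : j < c := by
        have := hM.c_eq
        simp [← hj] at hb
        omega
      refine Triple.seq (setupProg_spec (by simpa [← hN] using hNB') (by simpa [hM.n_eq])) ?_
      rintro s₁ hA₁ ⟨h1, h2, h3⟩
      have v1 : s₁.var vN = n := by simp [hA₁.var vN rfl, hM.n_eq]
      have v2 : s₁.var vD = d := by simp [hA₁.var vD rfl, hM.d_eq]
      have v3 : s₁.var vC = c := by simp [hA₁.var vC rfl, hM.c_eq]
      have v4 : s₁.var vTerms = N := by simp [hA₁.var vTerms rfl, hN]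
      have v5 : s₁.var vLevel = j := by simp [hA₁.var vLevel rfl, hj]
      have v6 : s₁.var vHead = s.var vHead := by simp [hA₁.var vHead rfl]
      have v7 : s₁.var vTail = s.var vTail := by simp [hA₁.var vTail rfl]
      have v8 : s₁.var vW = w := by simp [hA₁.var vW rfl, hM.w_eq]
      have v9 : s₁.var vOk = s.var vOk := by simp [hA₁.var vOk rfl]
      have f1 : s₁.farr fLam = s.farr fLam := hA₁.farr fLam rfl
      have a1 : s₁.narr aPart = s.narr aPart := hA₁.narr aPart rfl
      have a2 : s₁.narr aLevel = s.narr aLevel := hA₁.narr aLevel rfl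
      have a3 : s₁.narr aTerms = s.narr aTerms := hA₁.narr aTerms rfl
      have hS : NodeStart n d w c C o s₁ := by
        refine ⟨v1, v2, v3, ?_, ?_, ?_, ?_, ?_, ?_⟩
        · exact (hA₁.farr fCoeff rfl).trans hM.C_eq
        · exact (hA₁.narr aOrder rfl).trans hM.o_eq
        · rw [h1, v4]
          simp [hM.w_eq, hN]
        · omega
        · omega
        · omega
      have hcur : s₁.current n w c C o = s.node n w c C o (s.var vHead) := by
        simp only [State.current, State.node, v4, v5, v6, f1, a1, hN, hj]
      have hnode : s₁.node n w c C o = s.node n w c C o := by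
        funext q
        simp only [State.node, f1, a1, a2, a3]
      refine (layersProg_spec hI hS h2 (fun x hx => h3 x (by simpa [hM.n_eq] using hx)) hnB hcB
        hdB (by rw [v4]; exact hNB)).mono ?_
      rintro s₂ hA₂ ⟨h4, h5, h6⟩
      rw [hcur, Good, v7] at h5
      refine ⟨h4.n_eq, h4.d_eq, ?_, h4.c_eq, h4.C_eq, h4.o_eq, ?_, ?_, ?_, ?_, ?_, ?_, h5, ?_⟩
      · rw [hA₂.var vW rfl, v8]
      · rw [h4.head_eq, v6]
      · rw [← v7]; exact h4.tail_le
      · rw [← v9]; exact h4.ok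
      · intro q hq
        have := h4.old q (by omega)
        rw [a2, a3] at this
        refine ⟨this.2.1, this.1, ?_⟩
        rw [← hnode]
        exact node_congr (this.1.trans (by rw [a3])) (this.2.1.trans (by rw [a2])) this.2.2.1
          this.2.2.2
      · intro q hq hq'
        have := h4.new q (by omega) hq'
        rw [v4, v5] at this
        exact ⟨hlt, this⟩
      · have := h4.sound
        rw [hcur, v7, v9] at this
        exact this
      · rw [← v7, ← v4]
        exact h6
    -- At level `c` no ROABP is left and the polynomial is an empty sum, so skipping the node is
    -- correct.
    · have hge : j = c := by
        have := hM.c_eq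
        simp [← hj] at hb
        omega
      refine ⟨by simp [hM.n_eq], by simp [hM.d_eq], by simp [hM.w_eq], by simp [hM.c_eq],
        by simp [hM.C_eq], by simp [hM.o_eq], by simp, by simp, by simp,
        fun q hq => ⟨rfl, rfl, rfl⟩, fun q h1 h2 => absurd h1 (by simpa using h2),
        fun h => ⟨by simp, fun q h1 h2 => absurd h1 (by simpa using h2)⟩, fun _ e _ => ?_,
        by simp⟩
      simp [State.node, extract, ← hj, hge]
  rintro s₁ hA₁ ⟨h1, h2, h3, h4, h5, h6, h7, h8, h9, h10, h11, h12, h13, h14⟩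
  refine Triple.setVar ?_
  have hhead : (s₁.setVar vHead ((NExpr.succ (.var vHead)).eval s₁)).var vHead =
      s.var vHead + 1 := by simp [h7]
  have htail : (s₁.setVar vHead ((NExpr.succ (.var vHead)).eval s₁)).var vTail =
      s₁.var vTail := by simp
  have hok : (s₁.setVar vHead ((NExpr.succ (.var vHead)).eval s₁)).var vOk =
      s₁.var vOk := by simp
  set s₂ := s₁.setVar vHead ((NExpr.succ (.var vHead)).eval s₁) with hs₂
  have hlev : s₂.narr = s₁.narr := rfl
  have hnode : s₂.node n w c C o = s₁.node n w c C o := rfl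
  refine ⟨⟨by simp [hs₂, h1], by simp [hs₂, h2], by simp [hs₂, h3], by simp [hs₂, h4], h5, h6,
    by omega, ?_, ?_, ?_, ?_, ?_, ?_⟩, ?_⟩
  · rw [hok]
    have := hM.ok
    omega
  · intro q hq hq'
    rw [hlev]
    by_cases h : q < s.var vTail
    · rw [(h10 q h).1]; exact hM.level_le q (by omega) h
    · have := h11 q (by omega) (by omega)
      omega
  · intro q hq hq'
    rw [hlev]
    by_cases h : q < s.var vTail
    · rw [(h10 q h).2.1]; exact hM.terms_pos q (by omega) h
    · exact (h11 q (by omega) (by omega)).2.2.1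
  · intro q hq hq'
    rw [hlev]
    by_cases h : q < s.var vTail
    · rw [(h10 q h).1, (h10 q h).2.1]; exact hM.terms_le q (by omega) h
    · obtain ⟨g1, g2, g3, g4⟩ := h11 q (by omega) (by omega)
      rw [g2]
      -- Tracking `N * w + 1` instead of `N` turns the growth of the number of terms into plain
      -- squaring.
      calc s₁.narr aTerms [q] * w + 1 ≤ (N * w + 1) * N * w + 1 :=
            Nat.succ_le_succ (Nat.mul_le_mul_right _ g4)
        _ ≤ (N * w + 1) ^ 2 := by nlinarith
        _ ≤ ((w + 1) ^ 2 ^ j) ^ 2 := Nat.pow_le_pow_left hNle 2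
        _ = (w + 1) ^ 2 ^ (j + 1) := by rw [← pow_mul, pow_succ]
  · intro hz
    obtain ⟨g1, g2⟩ := hM.sound hz
    obtain ⟨g3, g4⟩ := h12 (g2 _ le_rfl hht)
    refine ⟨by rw [hok, g3, g1], fun q hq hq' e => ?_⟩
    rw [hnode]
    by_cases h : q < s.var vTail
    · rw [(h10 q h).2.2]; exact g2 q (by omega) h e
    · exact g4 q (by omega) (by omega) e
  · intro hok₂ hz
    have hok₁ : s₁.var vOk = 1 := by rw [← hok, hok₂]
    refine hM.complete (by omega) fun q hq hq' e he => ?_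
    -- The treated node vanishes because its children do; the other pending nodes are the same as
    -- before.
    rcases Nat.eq_or_lt_of_le hq with rfl | h
    · exact h13 ⟨hok₁, fun q g1 g2 e he => by
        rw [← hnode]; exact hz q (by omega) (by omega) e he⟩ e he
    · rw [← (h10 q hq').2.2, ← hnode]
      exact hz q (by omega) (by omega) e he
  · rw [hpend]
    have hsplit : pending n d w c s₂ =
        ∑ q ∈ Ico (s.var vHead + 1) (s.var vTail), nodeBound n d w c (s.narr aLevel [q]) +
        ∑ q ∈ Ico (s.var vTail) (s₁.var vTail), nodeBound n d w c (s₁.narr aLevel [q]) := by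
      rw [pending, hhead, htail, ← Finset.sum_Ico_consecutive _ (Nat.succ_le_of_lt hht) h8]
      congr 1
      refine Finset.sum_congr rfl fun q hq => ?_
      rw [hlev, (h10 q (mem_Ico.1 hq).2).1]
    have hnew : ∑ q ∈ Ico (s.var vTail) (s₁.var vTail), nodeBound n d w c (s₁.narr aLevel [q]) =
        (s₁.var vTail - s.var vTail) * nodeBound n d w c (j + 1) := by
      rw [Finset.sum_congr rfl (g := fun _ => nodeBound n d w c (j + 1)) fun q hq => ?_]
      · simp
      · have hq := mem_Ico.1 hq
        rw [(h11 q hq.1 hq.2).2.1]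
    rw [hsplit, hnew]
    have hpos : 1 ≤ nodeBound n d w c j := nodeBound_pos hI.n_pos j
    -- That `j < c` holds, which the estimate requires, is known only if at least one child was
    -- generated.
    by_cases hlt : s₁.var vTail = s.var vTail
    · rw [hlt]
      simp only [Nat.sub_self, zero_mul]
      omega
    · have hjlt : j < c := (h11 (s.var vTail) le_rfl (by omega)).1
      have hb := nodeBound_succ_le (d := d) (w := w) hI.n_pos hjlt
      have : (s₁.var vTail - s.var vTail) * nodeBound n d w c (j + 1) ≤
          n * ((w + 1) ^ 2 ^ j * (d + 1)) * nodeBound n d w c (j + 1) := by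
        refine Nat.mul_le_mul_right _ ?_
        refine (Nat.sub_le_iff_le_add'.2 h14).trans ?_
        gcongr
      omega

end PIT

/-! ### The main loop, the complete test and its running time -/

namespace PIT

open Finset

variable {F : Type*} [Field F]
variable {n d w c : ℕ} {C : List ℕ → F} {o : List ℕ → ℕ}

/-- The queue grows while it is worked off, so the main loop is no counting loop; a decreasing
potential takes the place of the counter. -/
theorem exec_loop {B : ℕ} {b : BExpr} {P : Program} (I : State F → Prop) (μ : State F → ℕ)
    (step : ∀ s, I s → b.Holds s → Triple B P s fun s' => I s' ∧ μ s' + 1 ≤ μ s) :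
    ∀ (k : ℕ) (s : State F), μ s ≤ k → I s → ∃ T s', Exec (.loop b P) s T s' ∧
      T ≤ k * (b.cost + P.timeBound B) + b.cost ∧ I s' ∧ ¬ b.Holds s' := by
  intro k
  induction k with
  | zero =>
    intro s hk hI
    by_cases hb : b.Holds s
    · obtain ⟨_, s', _, _, _, h⟩ := step s hI hb
      omega
    · exact ⟨_, s, .loopFalse hb, by simp, hI, hb⟩
  | succ k ih =>
    intro s hk hI
    by_cases hb : b.Holds s
    · obtain ⟨T, s', he, hT, hI', h⟩ := step s hI hb
      obtain ⟨T', s'', he', hT', hI'', hb'⟩ := ih s' (by omega) hI'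
      refine ⟨_, s'', .loopTrue hb he he', ?_, hI'', hb'⟩
      rw [Nat.succ_mul]
      omega
    · exact ⟨_, s, .loopFalse hb, by omega, hI, hb⟩

/-- The first node: the sum of all ROABPs. -/
def initProg : Program :=
  .seq (.storeNat aTerms [.const 0] (.const 1)) <|
  .seq (.storeField fLam [.const 0, .const 0] .one) <|
  .seq (.setVar vTail (.const 1)) <|
  .setVar vOk (.const 1)

/-- The condition of the main loop. -/
def pendingCond : BExpr := .le (.succ (.var vHead)) (.var vTail)

/-- The identity test. -/
def testIdentity : Program :=
  .seq initProg <| .seq (.loop pendingCond nodeProg) <| .setVar 0 (.var vOk)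

theorem initProg_spec {B : ℕ} (R : Fin c → ROABP F n w) :
    Triple B initProg (input n d w c R) fun s =>
      MainInv n d w c ((input n d w c R).farr 0) ((input n d w c R).narr 0) s ∧
        pending n d w c s = nodeBound n d w c 0 := by
  refine Triple.seq' (Triple.storeNat (Triple.seq' (Triple.storeField (Triple.seq'
    (Triple.setVar (Triple.setVar ?_))))))
  set C := (input n d w c R).farr 0 with hC
  set o := (input n d w c R).narr 0 with ho
  set s := (((((input n d w c R).setNat aTerms (evalIndex (input n d w c R) [.const 0])
    ((NExpr.const 1).eval (input n d w c R))).setField fLam _ _).setVar vTail _).setVar vOk _)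
    with hs
  -- The level, the empty assignment and `vHead` of the first node are never written: they are the
  -- zeros that fill the memory initially.
  have hlevel : s.narr aLevel [0] = 0 := by simp [hs, input]
  have hterms : s.narr aTerms [0] = 1 := by simp [hs]
  have hnode : ∀ e, s.node n w c C o 0 e = ∑ i ∈ Ico 0 c, prefixVec C o w i e n 0 := by
    intro e
    rw [State.node, extract, hlevel, hterms]
    refine Finset.sum_congr rfl fun i _ => ?_
    have h1 : s.farr fLam [0, 0] = 1 := by simp [hs]
    have h2 : override (fun x => s.narr aPart [0, 0, x]) e = e := by
      funext x
      simp [override, hs, input]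
    rw [sum_range_one, h1, h2, one_mul]
  have hhead : s.var vHead = 0 := by simp [hs, input]
  have htail : s.var vTail = 1 := by simp [hs]
  have hok : s.var vOk = 1 := by simp [hs]
  refine ⟨⟨by simp [hs, input], by simp [hs, input], by simp [hs, input], by simp [hs, input],
    ?_, ?_, by omega, Or.inr hok, ?_, ?_, ?_, ?_, ?_⟩, ?_⟩
  · funext is
    simp [hs, hC]
  · funext is
    simp [hs, ho]
  · intro q _ hq
    obtain rfl : q = 0 := by omega
    omega
  · intro q _ hq
    obtain rfl : q = 0 := by omega
    omega
  · intro q _ hq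
    obtain rfl : q = 0 := by omega
    rw [hlevel, hterms]
    simp
  · intro hz
    refine ⟨hok, fun q _ hq e => ?_⟩
    obtain rfl : q = 0 := by omega
    rw [hnode, hz]
  · intro _ hz e he
    rw [← hnode]
    exact hz 0 (by omega) (by omega) e he
  · rw [pending, hhead, htail]
    simp [hlevel]

/-- A bound for the number of iterations of the inner loops. -/
def loopBound (n d w c : ℕ) : ℕ := n + c + (d + 1) + (w + 1) ^ 2 ^ c

/-- When the queue is empty, the completeness part of the invariant has no hypothesis left except
`vOk = 1`. -/
theorem testIdentity_spec (hn : 1 ≤ n) (hw : 1 ≤ w) (R : Fin c → ROABP F n w)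
    {A : MvPolynomial (Fin n) F} (hA : A = ∑ i, (R i).poly) (hd : ∀ j : Fin n, A.degreeOf j ≤ d) :
    ∃ (T : ℕ) (s : State F), Exec testIdentity (input n d w c R) T s ∧
      (A = 0 → s.var 0 = 1) ∧ (A ≠ 0 → s.var 0 = 0) ∧
      T ≤ initProg.timeBound 1 + (nodeBound n d w c 0 *
        (pendingCond.cost + nodeProg.timeBound (loopBound n d w c)) + pendingCond.cost) + 2 := by
  have hI := isInput_input (d := d) hn hw R
  obtain ⟨T₁, s₁, he₁, hT₁, hM₁, hp₁⟩ := initProg_spec (B := 1) (d := d) R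
  obtain ⟨T₂, s₂, he₂, hT₂, hM₂, hb₂⟩ := exec_loop (B := loopBound n d w c) (b := pendingCond)
    (P := nodeProg)
    (MainInv n d w c ((input n d w c R).farr 0) ((input n d w c R).narr 0)) (pending n d w c)
    (fun s hM hb => nodeProg_spec hI hM (by simpa [pendingCond] using hb)
      (by unfold loopBound; omega) (by unfold loopBound; omega) (by unfold loopBound; omega)
      (by unfold loopBound; omega)) _ s₁ hp₁.le hM₁
  have hdone : s₂.var vTail ≤ s₂.var vHead := by simpa [pendingCond] using hb₂
  refine ⟨_, _, .seq he₁ (.seq he₂ (.setVar s₂ 0 (.var vOk))), fun hz => ?_, fun hz => ?_, ?_⟩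
  · simpa using (hM₂.sound (sum_prefixVec_eq_zero hw hA hz)).1
  · rcases hM₂.ok with h | h
    · simpa using h
    · refine absurd (eq_zero_of_sum_prefixVec hw hA hd ?_) hz
      exact hM₂.complete h fun q _ _ => by omega
  · simp only [NExpr.cost]
    omega

/-- Uses `2 * n * (d + 1) ≤ 4 * n * d` and `w + 1 ≤ max w 2 ^ 2`. The surplus `4 ^ c` is absorbed by
a power of `max w 2`, which is why this is at least `2`. -/
theorem nodeBound_zero_le (hd : 1 ≤ d) :
    nodeBound n d w c 0 ≤ max w 2 ^ (4 * 2 ^ c) * (n * d) ^ c := by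
  have hW : 2 ≤ max w 2 := le_max_right _ _
  have hw1 : w + 1 ≤ max w 2 ^ 2 := by
    have := le_max_left w 2
    nlinarith
  have hc : c ≤ 2 ^ c := Nat.lt_two_pow_self.le
  calc nodeBound n d w c 0 ≤ (2 ^ 2 * (n * d)) ^ c * (max w 2 ^ 2) ^ 2 ^ c := by
        unfold nodeBound
        refine Nat.mul_le_mul (Nat.pow_le_pow_left ?_ _)
          ((Nat.pow_le_pow_left hw1 _).trans (Nat.pow_le_pow_right (by positivity) (by omega)))
        nlinarith
    _ = 2 ^ (2 * c) * (max w 2) ^ (2 * 2 ^ c) * (n * d) ^ c := by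
        rw [mul_pow, ← pow_mul, ← pow_mul]; ring
    _ ≤ (max w 2) ^ (2 * 2 ^ c) * (max w 2) ^ (2 * 2 ^ c) * (n * d) ^ c := by
        refine Nat.mul_le_mul_right _ (Nat.mul_le_mul_right _ ?_)
        exact (Nat.pow_le_pow_left hW _).trans (Nat.pow_le_pow_right (by omega) (by omega))
    _ = _ := by rw [← pow_add]; ring_nf

theorem loopBound_le (hn : 1 ≤ n) (hd : 1 ≤ d) :
    loopBound n d w c ≤ max w 2 ^ (5 * 2 ^ c) * (n * d) := by
  have hW : 2 ≤ max w 2 := le_max_right _ _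
  have hw1 : w + 1 ≤ max w 2 ^ 2 := by
    have := le_max_left w 2
    nlinarith
  have hc : c ≤ 2 ^ c := Nat.lt_two_pow_self.le
  have h1 : c ≤ max w 2 ^ (2 * 2 ^ c) := hc.trans ((Nat.pow_le_pow_left hW _).trans
    (Nat.pow_le_pow_right (by omega) (by omega)))
  have h2 : (w + 1) ^ 2 ^ c ≤ max w 2 ^ (2 * 2 ^ c) := by
    rw [pow_mul]
    exact Nat.pow_le_pow_left hw1 _
  -- The summands of `loopBound` amount to at most five times `max w 2 ^ (2 * 2 ^ c) * (n * d)`; `8`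
  -- is a convenient power of two above that.
  have h3 : 8 ≤ max w 2 ^ (3 * 2 ^ c) := by
    have h4 : 1 ≤ 2 ^ c := Nat.one_le_two_pow
    calc 8 = 2 ^ 3 := by norm_num
      _ ≤ max w 2 ^ 3 := Nat.pow_le_pow_left hW _
      _ ≤ _ := Nat.pow_le_pow_right (by omega) (by omega)
  have h5 : 1 ≤ max w 2 ^ (2 * 2 ^ c) := Nat.one_le_pow _ _ (by omega)
  have h6 : 5 * 2 ^ c = 3 * 2 ^ c + 2 * 2 ^ c := by ring
  rw [h6, pow_add]
  generalize max w 2 ^ (3 * 2 ^ c) = X at *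
  generalize max w 2 ^ (2 * 2 ^ c) = Y at *
  have hnd : 1 ≤ n * d := Nat.mul_pos hn hd
  have hn' : n ≤ n * d := Nat.le_mul_of_pos_right n hd
  have hd' : d ≤ n * d := Nat.le_mul_of_pos_left d hn
  have h7 : n * d ≤ Y * (n * d) := Nat.le_mul_of_pos_left _ h5
  have h8 : Y ≤ Y * (n * d) := Nat.le_mul_of_pos_right _ hnd
  have h9 : 8 * (Y * (n * d)) ≤ X * (Y * (n * d)) := Nat.mul_le_mul_right _ h3
  unfold loopBound
  rw [mul_assoc]
  omega

end PIT

theorem theorem3p2 :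
    ∃ (P : PIT.Program) (K : ℕ),
      ∀ (F : Type*) [Field F] (n d w c : ℕ), 1 ≤ n → 1 ≤ d → 1 ≤ w → 1 ≤ c →
      ∀ (R : Fin c → PIT.ROABP F n w) (A : MvPolynomial (Fin n) F),
        A = ∑ i, (R i).poly →
        (∀ j : Fin n, A.degreeOf j ≤ d) →
        ∃ (T : ℕ) (s : PIT.State F),
          PIT.Exec P (PIT.input n d w c R) T s ∧
          (A = 0 → s.var 0 = 1) ∧
          (A ≠ 0 → s.var 0 = 0) ∧
          T ≤ (max w 2) ^ (K * 2 ^ c) * (n * d) ^ (K * c) := by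
  set κ := PIT.initProg.timeBound 1 + 2 * PIT.pendingCond.cost + PIT.nodeProg.timeBound 1 + 2
    with hκ
  set δ := PIT.nodeProg.depth with hδ
  -- In the exponent of `max w 2`, `κ` stands for the constant costs (by `κ ≤ 2 ^ κ`), `4` for the
  -- number of nodes, and each of the `δ` loops of `nodeProg` adds `5`.
  refine ⟨PIT.testIdentity, κ + 4 + 5 * δ, ?_⟩
  intro F _ n d w c hn hd hw hc R A hA hdeg
  obtain ⟨T, s, he, h1, h0, hT⟩ := PIT.testIdentity_spec hn hw R hA hdeg
  refine ⟨T, s, he, h1, h0, ?_⟩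
  have hLpos : 1 ≤ PIT.loopBound n d w c := by unfold PIT.loopBound; omega
  have hnode := PIT.Program.timeBound_le hLpos PIT.nodeProg
  have hNpos : 1 ≤ PIT.nodeBound n d w c 0 := PIT.nodeBound_pos hn 0
  have hLδ : 1 ≤ PIT.loopBound n d w c ^ δ := Nat.one_le_pow _ _ hLpos
  have hW : 2 ≤ max w 2 := le_max_right _ _
  have h2c : 1 ≤ 2 ^ c := Nat.one_le_two_pow
  have hnd : 1 ≤ n * d := Nat.mul_pos hn hd
  calc T ≤ κ * (PIT.nodeBound n d w c 0 * PIT.loopBound n d w c ^ δ) := by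
        refine hT.trans ?_
        set N := PIT.nodeBound n d w c 0
        set L := PIT.loopBound n d w c ^ δ
        have hNL : 1 ≤ N * L := Nat.mul_pos hNpos hLδ
        have g1 : N * (PIT.pendingCond.cost + PIT.nodeProg.timeBound (PIT.loopBound n d w c)) ≤
            N * (PIT.pendingCond.cost * L + PIT.nodeProg.timeBound 1 * L) :=
          Nat.mul_le_mul_left _ (Nat.add_le_add (Nat.le_mul_of_pos_right _ hLδ) hnode)
        have g2 := Nat.le_mul_of_pos_right (PIT.initProg.timeBound 1) hNL
        have g3 := Nat.le_mul_of_pos_right PIT.pendingCond.cost hNL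
        rw [hκ]
        linarith
    _ ≤ max w 2 ^ (κ * 2 ^ c) * (max w 2 ^ (4 * 2 ^ c) * (n * d) ^ c *
        (max w 2 ^ (5 * 2 ^ c) * (n * d)) ^ δ) := by
        refine Nat.mul_le_mul ?_ (Nat.mul_le_mul (PIT.nodeBound_zero_le hd)
          (Nat.pow_le_pow_left (PIT.loopBound_le hn hd) _))
        calc κ ≤ 2 ^ κ := Nat.lt_two_pow_self.le
          _ ≤ max w 2 ^ κ := Nat.pow_le_pow_left hW _
          _ ≤ _ := Nat.pow_le_pow_right (by omega) (Nat.le_mul_of_pos_right _ h2c)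
    _ = max w 2 ^ ((κ + 4 + 5 * δ) * 2 ^ c) * (n * d) ^ (c + δ) := by
        generalize n * d = m
        rw [mul_pow, ← pow_mul, pow_add _ c δ, add_mul, add_mul, pow_add, pow_add]
        ring
    _ ≤ _ := by
        -- The exponent `c + δ` of `n * d` is at most `K * c` because `1 ≤ c`.
        refine Nat.mul_le_mul_left _ (Nat.pow_le_pow_right hnd ?_)
        nlinarith
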